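/- Let $n\ge 2$, $0\le l<k\le n$ and $\theta\in(0,\pi)$. Let $E_1,\dots,E_{n+1}$ be the standard basis of $\mathbb{R}^{n+1}$, put $e=-E_{n+1}$, and let $$\mathcal{C}_\theta=\{\xi\in\mathbb{R}^{n+1} : \xi_{n+1}\ge 0,\ |\xi-\cos\theta\, e|=1\}$$ be the unit spherical cap with its round metric $\sigma$ (induced from $\mathbb{R}^{n+1}$), gradient $\nabla$ and Hessian $\nabla^2$. Let $\mu$ be the outward unit conormal of $\partial\mathcal{C}_\theta$ in $\mathcal{C}_\theta$, and let $\ell(\xi)=\langle \xi,\xi-\cos\theta\, e\rangle$. For $h\in C^2(\mathcal{C}_\theta)$ (twice continuously differentiable up to the boundary) put $W=\nabla^2h+h\sigma$, and let $\sigma_j(W)$ be the $j$-th elementary symmetric function of the $n$ eigenvalues of $W$ with respect to $\sigma$ (with $\sigma_0=1$). Suppose that $h$ is admissible, that is, $h\in C^2(\mathcal{C}_\theta)$ and $\sigma_i(W)>0$ on $\mathcal{C}_\theta$ for all $1\le i\le k$, and that $$\frac{\sigma_k(W)}{\sigma_l(W)}=\frac{\binom{n}{k}}{\binom{n}{l}}\quad\text{in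 } \mathcal{C}_\theta,\qquad \nabla_\mu h=\cot\theta\, h\quad\text{on }\partial\mathcal{C}_\theta .$$ Then there are constants $a_1,\dots,a_n\in\mathbb{R}$ such that $$h(\xi)=\ell(\xi)+\sum_{\alpha=1}^n a_\alpha\langle\xi,E_\alpha\rangle\qquad\text{for all }\xi\in\mathcal{C}_\theta .$$ -/

import Mathlib

open scoped RealInnerProductSpace Gradient

noncomputable section

/-- The Euclidean space `ℝⁿ⁺¹`; the last coordinate is the vertical one. -/
abbrev CapSpace (n : ℕ) : Type := EuclideanSpace ℝ (Fin (n + 1))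

namespace Capillary

variable {n : ℕ}

/-- The vector `e = -E_{n+1}`, the outward unit normal of the upper half-space. -/
def e (n : ℕ) : CapSpace n := -EuclideanSpace.single (Fin.last n) 1

/-- The horizontal coordinate unit vectors `E_1, …, E_n`. -/
def E (α : Fin n) : CapSpace n := EuclideanSpace.single α.castSucc 1

/-- The vector `ξ - cos θ e`. At a point `ξ` of the unit sphere centred at `cos θ e` it is the
outward unit normal of that sphere. -/
def normal (θ : ℝ) (ξ : CapSpace n) : CapSpace n := ξ - Real.cos θ • e n

/-- The closed spherical cap `C_θ`: the points of the closed upper half-space with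
`|ξ - cos θ e| = 1`. -/
def cap (n : ℕ) (θ : ℝ) : Set (CapSpace n) :=
  {ξ | 0 ≤ ξ (Fin.last n) ∧ ‖normal θ ξ‖ = 1}

/-- The boundary `∂C_θ`, where the cap meets the hyperplane `ξ_{n+1} = 0`. -/
def capBoundary (n : ℕ) (θ : ℝ) : Set (CapSpace n) :=
  {ξ | ξ ∈ cap n θ ∧ ξ (Fin.last n) = 0}

/-- The tangential part of an ambient vector `v` at a point `ξ` of the sphere. -/
def tangential (θ : ℝ) (ξ v : CapSpace n) : CapSpace n :=
  v - ⟪v, normal θ ξ⟫ • normal θ ξ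

/-- The tangent space of the cap at `ξ`, with the inner product of `ℝⁿ⁺¹`; this is the standard
round metric `σ`. -/
abbrev tangentSpace (θ : ℝ) (ξ : CapSpace n) : Submodule ℝ (CapSpace n) :=
  (ℝ ∙ normal θ ξ)ᗮ

/-- The outward unit conormal `μ` of `∂C_θ` in `C_θ`: the normalized tangential part of `e`.
(`∂C_θ` is a level set of the height `-⟨ξ, e⟩`, whose gradient along the cap is minus the
tangential part of `e`, and the height is nonnegative on the cap.) -/
def conormal (θ : ℝ) (ξ : CapSpace n) : CapSpace n :=
  ‖tangential θ ξ (e n)‖⁻¹ • tangential θ ξ (e n)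

/-- `h ∈ C²(C_θ)`, up to the boundary. A function on the cap is represented by an extension which
is `C²` on an open neighbourhood of the cap in `ℝⁿ⁺¹`. The derivatives below only involve
directions tangent to the cap, so they depend only on the values of `h` on the cap. -/
def IsC2 (θ : ℝ) (h : CapSpace n → ℝ) : Prop :=
  ∃ U : Set (CapSpace n), IsOpen U ∧ cap n θ ⊆ U ∧ ContDiffOn ℝ 2 h U

/-- The gradient `∇h` of the restriction of `h` to the cap. -/
def capGradient (θ : ℝ) (h : CapSpace n → ℝ) (ξ : CapSpace n) : CapSpace n :=
  tangential θ ξ (∇ h ξ)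

/-- The Hessian `∇²h` of the restriction of `h` to the cap, as an endomorphism of the tangent
space: `u ↦ ∇_u (∇h)`, where the Levi-Civita connection of the cap is the tangential part of the
derivative in `ℝⁿ⁺¹`. -/
def capHessian (θ : ℝ) (h : CapSpace n → ℝ) (ξ : CapSpace n) :
    tangentSpace θ ξ →ₗ[ℝ] tangentSpace θ ξ :=
  ((tangentSpace θ ξ).orthogonalProjectionOnto ∘L fderiv ℝ (capGradient θ h) ξ ∘L
    (tangentSpace θ ξ).subtypeL : tangentSpace θ ξ →L[ℝ] tangentSpace θ ξ)

/-- `W[h] = ∇²h + h σ`, as an endomorphism of the tangent space. -/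
def W (θ : ℝ) (h : CapSpace n → ℝ) (ξ : CapSpace n) :
    tangentSpace θ ξ →ₗ[ℝ] tangentSpace θ ξ :=
  capHessian θ h ξ + h ξ • LinearMap.id

/-- `σ_k(W[h])` at `ξ`: the `k`-th elementary symmetric function of the eigenvalues of `W[h]`,
repeated according to multiplicity. -/
def sigma (θ : ℝ) (k : ℕ) (h : CapSpace n → ℝ) (ξ : CapSpace n) : ℝ :=
  ((W θ h ξ).charpoly.roots).esymm k

/-- `h` is `k`-convex (admissible): `h ∈ C²(C_θ)` and the eigenvalues of `W[h]` lie in the Gårding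
cone `Γ_k` at every point of the cap. -/
def IsKConvex (θ : ℝ) (k : ℕ) (h : CapSpace n → ℝ) : Prop :=
  IsC2 θ h ∧ ∀ ξ ∈ cap n θ, ∀ i : ℕ, 1 ≤ i → i ≤ k → 0 < sigma θ i h ξ

/-- The support function of the cap, `ℓ(ξ) = ⟨ξ, ξ - cos θ e⟩`. -/
def ell (θ : ℝ) (ξ : CapSpace n) : ℝ := ⟪ξ, normal θ ξ⟫

end Capillary

end

/-! Write `c = cos θ` and parametrize the cap by its unit normal `ν = ξ - cos θ e`. The normals fill
a spherical cap, and the cone over it is `0 ≤ coneFun c x`. Extend `h` to a one-homogeneous function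
`H` on this cone and let `G = ∇H`; at a normal, `G = h ν + ∇h`. Then `DG` is symmetric, kills the
radial direction and acts on the tangent space as `W`. The Robin condition says exactly that `G` is
horizontal on the boundary of the cone.

With `L` the extension of `ℓ`, the field `L ∇H - H ∇L` is orthogonal to `x` and tangent to the
boundary of the cone. Its contraction with the cofactors of `1 + t DG`, which are divergence free in
the weak sense, gives a polynomial identity in `t`. Its coefficients are the capillary Minkowski
formulas `∫ (ℓ p_{j+1} - h p_j) = 0` for `j < n`, where `p_j` is the normalized symmetric function
of the eigenvalues of `W` (`integral_minkowski`). Since `G` is only `C¹`, the cofactor identity is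
derived from the change of variables formula for perturbations of the identity
(`integral_detDeriv_one_add_fderiv`).

The equation reads `p_k = p_l`. If `k < n`, subtracting the formulas of orders `k` and `l` leaves `∫
ℓ (p_{k+1} - p_{l+1}) = 0`. Newton's inequalities make the integrand nonpositive and `ℓ > 0`, so
equality holds pointwise and all eigenvalues are `1`. No sign of `h` enters. If `k = n`, the orders
`n - 1` and `l - 1` (or `0` when `l = 0`) are compared. This needs `h > 0`, which a horizontal
translation achieves because `W` is then positive definite (`exists_translation_pos`).

Once `W` is the identity, `DG` is the derivative of `∇L`, so `G - ∇L` is a constant vector,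
horizontal by the boundary condition (`eq_ellGrad_add_of_fderiv_eq`). Pairing with `ν` gives the
formula for `h`. -/

namespace Capillary

/-! ### Newton and Maclaurin inequalities for real multisets, with their equality cases. -/

section Newton

open Polynomial

lemma esymm_cons_succ (a : ℝ) (s : Multiset ℝ) (j : ℕ) :
    (a ::ₘ s).esymm (j + 1) = s.esymm (j + 1) + a * s.esymm j := by
  simp [Multiset.esymm, Multiset.powersetCard_cons, Multiset.sum_map_mul_left]

lemma esymm_zero_eq_one (s : Multiset ℝ) : s.esymm 0 = 1 := by
  simp [Multiset.esymm]

lemma coeff_prod_one_add_C_mul_X (s : Multiset ℝ) (j : ℕ) :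
    (s.map fun r => 1 + C r * X).prod.coeff j = s.esymm j := by
  induction s using Multiset.induction_on generalizing j with
  | empty => cases j <;> simp [Multiset.esymm, Multiset.powersetCard_zero_left,
      Multiset.powersetCard_zero_right, coeff_one]
  | cons a s ih =>
    rw [Multiset.map_cons, Multiset.prod_cons, add_mul, one_mul, coeff_add, ih, mul_assoc,
      coeff_C_mul]
    cases j with
    | zero => simp [esymm_zero_eq_one]
    | succ j => rw [coeff_X_mul, ih, esymm_cons_succ]

/-- Compare coefficients in `∏ (1 + r X) = (∏ r) ∏ (X + r⁻¹)`. The reflection `j ↦ card - j` turns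
the top Newton inequality into the bottom one. -/
lemma esymm_eq_prod_mul_esymm_inv (s : Multiset ℝ) (h0 : (0 : ℝ) ∉ s) {j : ℕ}
    (hj : j ≤ s.card) :
    s.esymm (s.card - j) = s.prod * (s.map fun r => r⁻¹).esymm j := by
  have h1 : (s.map fun r => 1 + C r * X).prod
      = C s.prod * ((s.map fun r => r⁻¹).map fun r => X + C r).prod := by
    clear hj
    induction s using Multiset.induction_on with
    | empty => simp
    | cons a s ih =>
      simp only [Multiset.mem_cons, not_or] at h0
      rw [Multiset.map_cons, Multiset.map_cons, Multiset.map_cons, Multiset.prod_cons,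
        Multiset.prod_cons, Multiset.prod_cons, ih h0.2, C_mul]
      have : C a * C a⁻¹ = (1 : ℝ[X]) := by rw [← C_mul, mul_inv_cancel₀ (Ne.symm h0.1), C_1]
      linear_combination (- C s.prod * ((s.map fun r => r⁻¹).map fun r => X + C r).prod) * this
  have h2 := congrArg (fun p => p.coeff (s.card - j)) h1
  simp only [coeff_prod_one_add_C_mul_X, coeff_C_mul] at h2
  rw [h2, Multiset.prod_X_add_C_coeff _ (by simp)]
  congr 2
  simp; omega

/-- The normalized elementary symmetric functions. -/
noncomputable def symMean (s : Multiset ℝ) (j : ℕ) : ℝ := s.esymm j / (s.card.choose j : ℝ)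

lemma symMean_zero (s : Multiset ℝ) : symMean s 0 = 1 := by
  simp [symMean, esymm_zero_eq_one]

lemma sq_esymm_one (s : Multiset ℝ) :
    s.esymm 1 ^ 2 = (s.map fun r => r ^ 2).sum + 2 * s.esymm 2 := by
  induction s using Multiset.induction_on with
  | empty => simp [Multiset.esymm, Multiset.powersetCard_zero_right]
  | cons a s ih =>
    rw [esymm_cons_succ a s 0, esymm_cons_succ a s 1, Multiset.map_cons, Multiset.sum_cons,
      esymm_zero_eq_one]
    linear_combination ih

lemma sum_sq_sub (s : Multiset ℝ) (c : ℝ) :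
    (s.map fun r => (r - c) ^ 2).sum
      = (s.map fun r => r ^ 2).sum - 2 * c * s.esymm 1 + s.card * c ^ 2 := by
  induction s using Multiset.induction_on with
  | empty => simp [Multiset.esymm, Multiset.powersetCard_zero_right]
  | cons a s ih =>
    rw [esymm_cons_succ a s 0, Multiset.map_cons, Multiset.map_cons, Multiset.sum_cons,
      Multiset.sum_cons, esymm_zero_eq_one, ih, Multiset.card_cons]
    push_cast
    ring

lemma sum_sq_sub_nonneg (s : Multiset ℝ) (c : ℝ) : 0 ≤ (s.map fun r => (r - c) ^ 2).sum := by
  apply Multiset.sum_nonneg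
  intro x hx
  obtain ⟨r, -, rfl⟩ := Multiset.mem_map.1 hx
  positivity

lemma eq_replicate_of_sum_sq_sub_eq_zero (s : Multiset ℝ) (c : ℝ)
    (h : (s.map fun r => (r - c) ^ 2).sum = 0) : s = Multiset.replicate s.card c := by
  rw [Multiset.eq_replicate]
  refine ⟨rfl, fun r hr => ?_⟩
  have h1 : ∀ x ∈ s.map (fun r => (r - c) ^ 2), 0 ≤ x := by
    intro x hx
    obtain ⟨r, -, rfl⟩ := Multiset.mem_map.1 hx
    positivity
  have h2 := Multiset.single_le_sum h1 ((r - c) ^ 2) (Multiset.mem_map_of_mem _ hr)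
  have h3 : (r - c) ^ 2 = 0 := le_antisymm (h2.trans h.le) (sq_nonneg _)
  nlinarith [pow_eq_zero_iff (two_ne_zero) |>.1 h3]

/-- The first Newton defect is a variance; every equality case below is read off from its vanishing.
-/
lemma symMean_one_sq_sub (s : Multiset ℝ) (hs : 2 ≤ s.card) :
    symMean s 1 ^ 2 - symMean s 2
      = (s.map fun r => (r - symMean s 1) ^ 2).sum / (s.card * (s.card - 1)) := by
  have h2 : (2 : ℝ) ≤ s.card := by exact_mod_cast hs
  rw [sum_sq_sub]
  have h3 := sq_esymm_one s
  have h4 : (s.map fun r => r ^ 2).sum = s.esymm 1 ^ 2 - 2 * s.esymm 2 := by linarith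
  rw [h4]
  simp only [symMean, Nat.choose_one_right, Nat.cast_choose_two]
  have h5 : (s.card : ℝ) - 1 ≠ 0 := by linarith
  have h6 : (s.card : ℝ) ≠ 0 := by linarith
  field_simp
  ring

/-- By Rolle, the derivative of `∏ (X + r)` is again real-rooted, and differentiation does not
change the normalized coefficients. This lowers the cardinality in Newton's inequality. -/
lemma exists_symMean_eq_of_derivative (s : Multiset ℝ) (m : ℕ) (hs : s.card = m + 1) :
    ∃ u : Multiset ℝ, u.card = m ∧ ∀ j ≤ m, symMean u j = symMean s j := by
  set p : ℝ[X] := (s.map fun r => X + C r).prod with hp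
  have hpm : p.Monic := monic_multiset_prod_of_monic _ _ fun r _ => monic_X_add_C r
  have hpd : p.natDegree = m + 1 := by
    rw [hp, natDegree_multiset_prod_of_monic]
    · simp [hs, add_comm]
    · intro f hf
      obtain ⟨r, -, rfl⟩ := Multiset.mem_map.1 hf
      exact monic_X_add_C r
  have hproots : p.roots.card = m + 1 := by
    have : p = ((s.map fun r => -r).map fun r => X - C r).prod := by
      rw [hp, Multiset.map_map]; simp
    rw [this, roots_multiset_prod_X_sub_C]; simp [hs]
  have hd : p.derivative.natDegree = m := by
    rw [natDegree_derivative, hpd]; rfl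
  have hdr : p.derivative.roots.card = m := by
    -- Rolle's theorem, counted with multiplicity.
    have h1 := card_roots_le_derivative p
    have h2 := card_roots' p.derivative
    omega
  have hlc : p.derivative.leadingCoeff = m + 1 := by
    rw [leadingCoeff, hd, coeff_derivative, ← hpd, coeff_natDegree, hpm.leadingCoeff, one_mul]
  refine ⟨p.derivative.roots.map Neg.neg, by simpa using hdr, fun j hj => ?_⟩
  have h1 := coeff_eq_esymm_roots_of_card (p := p.derivative) (by rw [hdr, hd])
    (k := m - j) (by omega)
  rw [hlc, hd, coeff_derivative, show m - (m - j) = j by omega,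
    hp, Multiset.prod_X_add_C_coeff s (by omega), hs,
    show m + 1 - (m - j + 1) = j by omega] at h1
  rw [symMean, symMean, Multiset.esymm_neg, Multiset.card_map, hdr, hs]
  have h2 : ((m + 1).choose j : ℝ) * ((m - j : ℕ) + 1) = (m + 1) * (m.choose j) := by
    have := Nat.choose_mul_succ_eq m j
    rw [show m + 1 - j = m - j + 1 by omega] at this
    have h3 : ((m.choose j * (m + 1) : ℕ) : ℝ) = (((m + 1).choose j * (m - j + 1) : ℕ) : ℝ) := by
      rw [this]
    push_cast at h3 ⊢
    linarith
  have h3 : (m.choose j : ℝ) ≠ 0 := by exact_mod_cast (Nat.choose_pos hj).ne'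
  have h4 : ((m + 1).choose j : ℝ) ≠ 0 := by exact_mod_cast (Nat.choose_pos (by omega)).ne'
  have h5 : (m + 1 : ℝ) ≠ 0 := by positivity
  have h6 : ((-1) ^ j * p.derivative.roots.esymm j) * (m + 1)
      = s.esymm j * ((m - j : ℕ) + 1) := by
    rw [h1]; ring
  rw [div_eq_div_iff h3 h4]
  apply mul_right_cancel₀ h5
  linear_combination ((m + 1).choose j : ℝ) * h6 + s.esymm j * h2

/-- Newton's inequality with its case of equality. -/
theorem newton_inequality (d : ℕ) : ∀ (s : Multiset ℝ) (j : ℕ), 1 ≤ j → s.card = j + 1 + d →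
    symMean s (j + 1) * symMean s (j - 1) ≤ symMean s j ^ 2 ∧
    (symMean s (j + 1) * symMean s (j - 1) = symMean s j ^ 2 → symMean s j ≠ 0 →
      ∃ c, s = Multiset.replicate s.card c) := by
  induction d with
  | zero =>
    intro s j hj hs
    have hs : s.card = j + 1 := hs
    by_cases h0 : (0 : ℝ) ∈ s
    · have h1 : symMean s (j + 1) = 0 := by
        rw [symMean, ← hs, show s.esymm s.card = s.prod by
          simp [Multiset.esymm, Multiset.powersetCard_self], Multiset.prod_eq_zero h0, zero_div]
      rw [h1, zero_mul]
      refine ⟨sq_nonneg _, fun h h' => absurd ?_ h'⟩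
      exact pow_eq_zero_iff two_ne_zero |>.1 h.symm
    -- The three top means of `s` are `s.prod` times the means of order `2`, `1`, `0` of the
    -- inverses, so the inequality becomes the nonnegativity of a variance.
    · set u := s.map fun r => r⁻¹ with hu
      have huc : u.card = s.card := by simp [hu]
      have hP : s.prod ≠ 0 := fun h => h0 (Multiset.prod_eq_zero_iff.1 h)
      have key : ∀ i ≤ s.card, symMean s (s.card - i) = s.prod * symMean u i := by
        intro i hi
        rw [symMean, symMean, esymm_eq_prod_mul_esymm_inv s h0 hi, huc, Nat.choose_symm hi,
          mul_div_assoc]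
      have k0 := key 0 (by omega)
      have k1 := key 1 (by omega)
      have k2 := key 2 (by omega)
      rw [symMean_zero, mul_one, hs] at k0
      rw [hs, show j + 1 - 1 = j by omega] at k1
      rw [hs, show j + 1 - 2 = j - 1 by omega] at k2
      rw [show j + 1 - 0 = j + 1 by omega] at k0
      have hd := symMean_one_sq_sub u (by omega)
      have hc : (0 : ℝ) < u.card * (u.card - 1) := by
        have : (2 : ℝ) ≤ u.card := by exact_mod_cast (by omega : 2 ≤ u.card)
        nlinarith
      have hd0 : 0 ≤ symMean u 1 ^ 2 - symMean u 2 := by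
        rw [hd]; exact div_nonneg (sum_sq_sub_nonneg _ _) hc.le
      rw [k0, k1, k2]
      refine ⟨by nlinarith [sq_nonneg s.prod], fun h _ => ?_⟩
      have h1 : symMean u 1 ^ 2 - symMean u 2 = 0 := by
        have : s.prod ^ 2 * (symMean u 1 ^ 2 - symMean u 2) = 0 := by linear_combination -h
        rcases mul_eq_zero.1 this with h | h
        · exact absurd (pow_eq_zero_iff two_ne_zero |>.1 h) hP
        · exact h
      rw [hd, div_eq_zero_iff] at h1
      have h2 := eq_replicate_of_sum_sq_sub_eq_zero u _ (h1.resolve_right hc.ne')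
      refine ⟨(symMean u 1)⁻¹, ?_⟩
      have h3 : s = u.map fun r => r⁻¹ := by simp [hu]
      conv_lhs => rw [h3, h2, Multiset.map_replicate, huc]
  | succ d ih =>
    intro s j hj hs
    obtain ⟨u, hu, hus⟩ := exists_symMean_eq_of_derivative s (j + 1 + d) (by omega)
    obtain ⟨i1, i2⟩ := ih u j hj hu
    rw [hus _ (by omega), hus _ (by omega), hus _ (by omega)] at i1 i2
    refine ⟨i1, fun h h' => ?_⟩
    obtain ⟨c, hc⟩ := i2 h h'
    -- Equality makes the roots of the derivative all equal. The means of order `1` and `2` are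
    -- shared, so the variance of `s` vanishes too.
    have hd := symMean_one_sq_sub s (by omega)
    have hd' := symMean_one_sq_sub u (by omega)
    rw [hus 1 (by omega), hus 2 (by omega), hd] at hd'
    have hpos : ∀ v : Multiset ℝ, 2 ≤ v.card → (0 : ℝ) < v.card * (v.card - 1) := by
      intro v hv
      have : (2 : ℝ) ≤ v.card := by exact_mod_cast hv
      nlinarith
    have h1 : symMean s 1 = c := by
      rw [← hus 1 (by omega), symMean, hc]
      have : u.card ≠ 0 := by omega
      simp only [Multiset.esymm, Multiset.card_replicate, Multiset.powersetCard_one,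
        Multiset.map_map, Function.comp_def, Multiset.prod_singleton, Multiset.map_id',
        Multiset.sum_replicate, Nat.choose_one_right, nsmul_eq_mul]
      field_simp
    have h2 : (u.map fun r => (r - symMean s 1) ^ 2).sum = 0 := by
      rw [h1, hc]; simp
    rw [h2, zero_div, div_eq_zero_iff] at hd'
    exact ⟨_, eq_replicate_of_sum_sq_sub_eq_zero s _
      (hd'.resolve_right (hpos s (by omega)).ne')⟩

/-- Newton's inequality says that the ratios `p_{j+1} / p_j` decrease; chain it from `l` to `k`.
Positivity is assumed only up to order `k`, since the sign of `p_{k+1}` is unknown in the Gårding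
cone. -/
theorem symMean_cross_le (s : Multiset ℝ) (l k : ℕ) (hlk : l ≤ k) (hk : k < s.card)
    (hpos : ∀ i ≤ k, 0 < symMean s i) :
    symMean s (k + 1) * symMean s l ≤ symMean s k * symMean s (l + 1) := by
  induction k, hlk using Nat.le_induction with
  | base => exact (mul_comm _ _).le
  | succ k hlk ih =>
    have h1 := ih (by omega) fun i hi => hpos i (by omega)
    have h2 := (newton_inequality (s.card - (k + 2)) s (k + 1) (by omega) (by omega)).1
    rw [show k + 1 - 1 = k by omega] at h2
    have p0 := hpos k (by omega)
    have p1 := hpos (k + 1) le_rfl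
    have pl := hpos l (by omega)
    refine le_of_mul_le_mul_right ?_ p0
    calc _ = (symMean s (k + 1 + 1) * symMean s k) * symMean s l := by ring
      _ ≤ symMean s (k + 1) ^ 2 * symMean s l := by gcongr
      _ = symMean s (k + 1) * (symMean s (k + 1) * symMean s l) := by ring
      _ ≤ symMean s (k + 1) * (symMean s k * symMean s (l + 1)) := by gcongr
      _ = _ := by ring

/-- Equality in the chain forces equality in its last link, which is Newton's inequality at order
`k`. -/
theorem eq_replicate_of_symMean_cross_eq (s : Multiset ℝ) (l k : ℕ) (hlk : l < k)
    (hk : k < s.card) (hpos : ∀ i ≤ k, 0 < symMean s i)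
    (h : symMean s (k + 1) * symMean s l = symMean s k * symMean s (l + 1)) :
    ∃ c, s = Multiset.replicate s.card c := by
  obtain ⟨k, rfl⟩ : ∃ k', k = k' + 1 := ⟨k - 1, by omega⟩
  have h1 := symMean_cross_le s l k (by omega) (by omega) fun i hi => hpos i (by omega)
  obtain ⟨h2, h3⟩ := newton_inequality (s.card - (k + 2)) s (k + 1) (by omega) (by omega)
  rw [show k + 1 - 1 = k by omega] at h2 h3
  have p0 := hpos k (by omega)
  have p1 := hpos (k + 1) le_rfl
  have pl := hpos l (by omega)
  refine h3 (le_antisymm h2 ?_) p1.ne'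
  refine le_of_mul_le_mul_right ?_ pl
  calc symMean s (k + 1) ^ 2 * symMean s l
      = symMean s (k + 1) * (symMean s (k + 1) * symMean s l) := by ring
    _ ≤ symMean s (k + 1) * (symMean s k * symMean s (l + 1)) := by gcongr
    _ = (symMean s (k + 1) * symMean s (l + 1)) * symMean s k := by ring
    _ = _ := by rw [← h]; ring

lemma symMean_replicate (m : ℕ) (c : ℝ) {j : ℕ} (hj : j ≤ m) :
    symMean (Multiset.replicate m c) j = c ^ j := by
  have h : (m.choose j : ℝ) ≠ 0 := by exact_mod_cast (Nat.choose_pos hj).ne'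
  have h1 := coeff_prod_one_add_C_mul_X (Multiset.replicate m c) j
  rw [Multiset.map_replicate, Multiset.prod_replicate, add_comm, add_pow] at h1
  simp only [one_pow, mul_one, mul_pow, ← C_pow, finsetSum_coeff, mul_assoc] at h1
  simp only [mul_comm (X ^ _), coeff_C_mul, ← C_eq_natCast, coeff_X_pow, mul_ite, mul_one,
    mul_zero] at h1
  rw [Finset.sum_ite_eq, if_pos (by simp; omega)] at h1
  rw [symMean, Multiset.card_replicate, ← h1]
  field_simp

lemma eq_replicate_one {s : Multiset ℝ} (hs : ∃ c, s = Multiset.replicate s.card c) {l k : ℕ}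
    (hlk : l < k) (hk : k ≤ s.card) (hpos : ∀ i ≤ k, 0 < symMean s i)
    (h : symMean s k = symMean s l) : s = Multiset.replicate s.card 1 := by
  obtain ⟨c, hc⟩ := hs
  have h1 : ∀ j ≤ s.card, symMean s j = c ^ j := fun j hj => by
    rw [hc, symMean_replicate _ _ hj]
  have hc0 : 0 < c := by simpa [h1 1 (by omega)] using hpos 1 (by omega)
  rw [h1 k hk, h1 l (by omega)] at h
  have : c = 1 := by
    rcases lt_trichotomy c 1 with h2 | h2 | h2
    · exact absurd h (pow_lt_pow_right_of_lt_one₀ hc0 h2 hlk).ne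
    · exact h2
    · exact absurd h (pow_lt_pow_right₀ h2 hlk).ne'
  rwa [this] at hc

/-- The pointwise inequality for `k < n`. -/
theorem symMean_succ_le_of_eq {s : Multiset ℝ} {l k : ℕ} (hlk : l < k) (hk : k < s.card)
    (hpos : ∀ i ≤ k, 0 < symMean s i) (h : symMean s k = symMean s l) :
    symMean s (k + 1) ≤ symMean s (l + 1) ∧
    (symMean s (k + 1) = symMean s (l + 1) → s = Multiset.replicate s.card 1) := by
  have pl := hpos l (by omega)
  constructor
  · have := symMean_cross_le s l k hlk.le hk hpos
    rw [h, mul_comm (symMean s l)] at this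
    exact le_of_mul_le_mul_right this pl
  · intro h'
    exact eq_replicate_one (eq_replicate_of_symMean_cross_eq s l k hlk hk hpos
      (by rw [h, h', mul_comm])) hlk hk.le hpos h

/-- There is no `p_{n+1}` to compare with when `k = n`, so the orders are shifted down, which
requires `l ≥ 1`. -/
theorem symMean_pred_le_of_eq {s : Multiset ℝ} {l k : ℕ} (hl : 1 ≤ l) (hlk : l < k)
    (hk : k = s.card) (hpos : ∀ i ≤ k, 0 < symMean s i) (h : symMean s k = symMean s l) :
    symMean s (l - 1) ≤ symMean s (k - 1) ∧
    (symMean s (l - 1) = symMean s (k - 1) → s = Multiset.replicate s.card 1) := by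
  have pk := hpos k le_rfl
  constructor
  · have := symMean_cross_le s (l - 1) (k - 1) (by omega) (by omega)
      fun i hi => hpos i (by omega)
    rw [show k - 1 + 1 = k by omega, show l - 1 + 1 = l by omega, ← h,
      mul_comm (symMean s k)] at this
    exact le_of_mul_le_mul_right this pk
  · intro h'
    refine eq_replicate_one (eq_replicate_of_symMean_cross_eq s (l - 1) (k - 1) (by omega)
      (by omega) (fun i hi => hpos i (by omega)) ?_) hlk hk.le hpos h
    rw [show k - 1 + 1 = k by omega, show l - 1 + 1 = l by omega, ← h, h', mul_comm]

/-- The replacement for `k = n`, `l = 0`. Decreasing ratios give `p_k ≤ p_1 ^ k` and `1 ≤ p_k *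
p_{m-1} ^ k`; at `k = m` these exclude `p_1 < 1` and `p_{m-1} < 1`. -/
theorem one_le_symMean_of_eq_one {s : Multiset ℝ} (hs : 2 ≤ s.card)
    (hpos : ∀ i ≤ s.card, 0 < symMean s i) (h : symMean s s.card = 1) :
    1 ≤ symMean s 1 ∧ 1 ≤ symMean s (s.card - 1) ∧
    (symMean s 1 = 1 → symMean s (s.card - 1) = 1 → s = Multiset.replicate s.card 1) := by
  set m := s.card with hm
  have p1 := hpos 1 (by omega)
  have pm := hpos (m - 1) (by omega)
  refine ⟨?_, ?_, ?_⟩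
  · by_contra! hlt
    have key : ∀ k ≤ m, symMean s k ≤ symMean s 1 ^ k := by
      intro k
      induction k with
      | zero => intro; simp [symMean_zero]
      | succ k ih =>
        intro hk
        have := symMean_cross_le s 0 k (by omega) (by omega) fun i hi => hpos i (by omega)
        rw [symMean_zero, mul_one, zero_add] at this
        calc _ ≤ _ := this
          _ ≤ symMean s 1 ^ k * symMean s 1 := by gcongr; exact ih (by omega)
          _ = _ := (pow_succ _ _).symm
    have h1 := key m le_rfl
    have h2 := pow_lt_one₀ p1.le hlt (by omega : m ≠ 0)
    linarith
  · by_contra! hlt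
    have key : ∀ k ≤ m, 1 ≤ symMean s k * symMean s (m - 1) ^ k := by
      intro k
      induction k with
      | zero => intro; simp [symMean_zero]
      | succ k ih =>
        intro hk
        have := symMean_cross_le s k (m - 1) (by omega) (by omega) fun i hi => hpos i (by omega)
        rw [show m - 1 + 1 = m by omega, h, one_mul] at this
        calc 1 ≤ symMean s k * symMean s (m - 1) ^ k := ih (by omega)
          _ ≤ (symMean s (m - 1) * symMean s (k + 1)) * symMean s (m - 1) ^ k := by gcongr
          _ = _ := by ring
    have h1 := key m le_rfl
    have h2 := pow_lt_one₀ pm.le hlt (by omega : m ≠ 0)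
    rw [h, one_mul] at h1
    linarith
  · intro h1 h2
    refine eq_replicate_one (eq_replicate_of_symMean_cross_eq s 0 (m - 1) (by omega)
      (by omega) (fun i hi => hpos i (by omega)) ?_) (by omega : 0 < m) le_rfl hpos
      (by rw [h, symMean_zero])
    rw [show m - 1 + 1 = m by omega, h, h1, h2, symMean_zero]

end Newton
end Capillary

namespace Capillary

variable {n : ℕ}

/-! ### The derivative of the determinant and the coefficients of `det (1 + t A)`. -/

section Determinants

/-- The matrix of an operator in the standard basis. -/
noncomputable def mat (A : CapSpace n →L[ℝ] CapSpace n) : Matrix (Fin (n + 1)) (Fin (n + 1)) ℝ :=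
  LinearMap.toMatrix (EuclideanSpace.basisFun (Fin (n + 1)) ℝ).toBasis
    (EuclideanSpace.basisFun (Fin (n + 1)) ℝ).toBasis (A : CapSpace n →ₗ[ℝ] CapSpace n)

lemma mat_add (A B : CapSpace n →L[ℝ] CapSpace n) : mat (A + B) = mat A + mat B := by
  simp [mat]

lemma mat_sub (A B : CapSpace n →L[ℝ] CapSpace n) : mat (A - B) = mat A - mat B := by
  simp [mat]

lemma mat_smul (t : ℝ) (A : CapSpace n →L[ℝ] CapSpace n) : mat (t • A) = t • mat A := by
  simp [mat]

lemma mat_one : mat (1 : CapSpace n →L[ℝ] CapSpace n) = 1 := by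
  exact LinearMap.toMatrix_one _

lemma mat_zero : mat (0 : CapSpace n →L[ℝ] CapSpace n) = 0 := by
  simp [mat]

lemma mat_mul (A B : CapSpace n →L[ℝ] CapSpace n) : mat (A * B) = mat A * mat B := by
  simp only [mat, ContinuousLinearMap.mul_def]
  exact LinearMap.toMatrix_comp _ _ _ _ _

lemma mat_apply (A : CapSpace n →L[ℝ] CapSpace n) (i j : Fin (n + 1)) :
    mat A i j = ⟪EuclideanSpace.single i (1 : ℝ), A (EuclideanSpace.single j (1 : ℝ))⟫ := by
  simp [mat, LinearMap.toMatrix_apply, EuclideanSpace.inner_single_left]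

lemma mat_transpose_of_symm {A B : CapSpace n →L[ℝ] CapSpace n}
    (h : ∀ u v, ⟪A u, v⟫ = ⟪u, B v⟫) : (mat A).transpose = mat B := by
  ext i j
  rw [Matrix.transpose_apply, mat_apply, mat_apply, real_inner_comm, h]

lemma det_mat (A : CapSpace n →L[ℝ] CapSpace n) : (mat A).det = A.det := by
  simp [mat, ContinuousLinearMap.det]

lemma continuous_mat : Continuous (mat (n := n)) := by
  refine continuous_matrix fun i j => ?_
  simp only [mat_apply]
  fun_prop

/-- The derivative of the determinant at `M` in the direction `B`. -/
noncomputable def detDeriv (M B : CapSpace n →L[ℝ] CapSpace n) : ℝ :=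
  ((mat M).adjugate * mat B).trace

lemma continuous_detDeriv :
    Continuous fun p : (CapSpace n →L[ℝ] CapSpace n) × (CapSpace n →L[ℝ] CapSpace n) =>
      detDeriv p.1 p.2 := by
  unfold detDeriv
  exact (((continuous_mat.comp continuous_fst).matrix_adjugate).mul
    (continuous_mat.comp continuous_snd)).matrix_trace

lemma detDeriv_add (M B C : CapSpace n →L[ℝ] CapSpace n) :
    detDeriv M (B + C) = detDeriv M B + detDeriv M C := by
  simp [detDeriv, mat_add, mul_add]

lemma detDeriv_sub (M B C : CapSpace n →L[ℝ] CapSpace n) :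
    detDeriv M (B - C) = detDeriv M B - detDeriv M C := by
  simp [detDeriv, mat_sub, mul_sub]

lemma detDeriv_smul (M B : CapSpace n →L[ℝ] CapSpace n) (t : ℝ) :
    detDeriv M (t • B) = t * detDeriv M B := by
  simp [detDeriv, mat_smul]

lemma detDeriv_zero (M : CapSpace n →L[ℝ] CapSpace n) : detDeriv M 0 = 0 := by
  simp [detDeriv, mat_zero]

lemma detDeriv_mul_left (M C : CapSpace n →L[ℝ] CapSpace n) :
    detDeriv M (M * C) = M.det * (mat C).trace := by
  rw [detDeriv, mat_mul, ← mul_assoc, Matrix.adjugate_mul, det_mat]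
  simp

lemma detDeriv_mul_right (M C : CapSpace n →L[ℝ] CapSpace n) :
    detDeriv M (C * M) = M.det * (mat C).trace := by
  rw [detDeriv, mat_mul, ← mul_assoc, Matrix.trace_mul_comm, ← mul_assoc, Matrix.mul_adjugate,
    det_mat]
  simp

lemma detDeriv_self (M : CapSpace n →L[ℝ] CapSpace n) : detDeriv M M = (n + 1) * M.det := by
  have := detDeriv_mul_left M 1
  rw [mul_one, mat_one, Matrix.trace_one] at this
  rw [this]; simp [mul_comm]

lemma detDeriv_transpose {M B B' : CapSpace n →L[ℝ] CapSpace n}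
    (hM : ∀ u v, ⟪M u, v⟫ = ⟪u, M v⟫) (hB : ∀ u v, ⟪B u, v⟫ = ⟪u, B' v⟫) :
    detDeriv M B' = detDeriv M B := by
  rw [detDeriv, detDeriv, ← mat_transpose_of_symm hB, ← Matrix.trace_transpose,
    Matrix.transpose_mul, Matrix.transpose_transpose, Matrix.trace_mul_comm,
    Matrix.adjugate_transpose, mat_transpose_of_symm hM]

/-- The operator `v ↦ ⟪b, v⟫ a`. -/
noncomputable def rankOne (a b : CapSpace n) : CapSpace n →L[ℝ] CapSpace n :=
  (innerSL ℝ b).smulRight a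

@[simp] lemma rankOne_apply (a b v : CapSpace n) : rankOne a b v = ⟪b, v⟫ • a := by
  simp [rankOne]

lemma rankOne_add_right (a b b' : CapSpace n) :
    rankOne a (b + b') = rankOne a b + rankOne a b' := by
  ext1 v; simp [inner_add_left, add_smul]

lemma rankOne_smul_right (t : ℝ) (a b : CapSpace n) : rankOne a (t • b) = t • rankOne a b := by
  ext1 v; simp [smul_smul, inner_smul_left]

lemma continuous_rankOne :
    Continuous fun p : CapSpace n × CapSpace n => rankOne p.1 p.2 := by
  unfold rankOne
  fun_prop

lemma trace_mat_rankOne (a b : CapSpace n) : (mat (rankOne a b)).trace = ⟪b, a⟫ := by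
  simp only [Matrix.trace, Matrix.diag_apply, mat_apply, rankOne_apply, inner_smul_right]
  simp [PiLp.inner_apply, mul_comm]

/-- Makes the two rank-one terms in the derivative of the flux cancel. -/
lemma detDeriv_rankOne_comm {M : CapSpace n →L[ℝ] CapSpace n}
    (hM : ∀ u v, ⟪M u, v⟫ = ⟪u, M v⟫) (a b : CapSpace n) :
    detDeriv M (rankOne a b) = detDeriv M (rankOne b a) := by
  refine detDeriv_transpose hM fun u v => ?_
  simp [inner_smul_left, inner_smul_right, mul_comm, real_inner_comm]

/-- For symmetric `M`, `β • rankOne a b = rankOne a b * M`, and the adjugate cancels against `M`. -/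
lemma mul_detDeriv_rankOne_of_eigenvector {M : CapSpace n →L[ℝ] CapSpace n}
    (hM : ∀ u v, ⟪M u, v⟫ = ⟪u, M v⟫) {b : CapSpace n} {β : ℝ} (hb : M b = β • b)
    (a : CapSpace n) : β * detDeriv M (rankOne a b) = M.det * ⟪b, a⟫ := by
  rw [← trace_mat_rankOne a b, ← detDeriv_mul_right, ← detDeriv_smul, ← rankOne_smul_right, ← hb]
  congr 1
  ext1 v
  simp [hM]

lemma detDeriv_rankOne_of_fixed {M : CapSpace n →L[ℝ] CapSpace n}
    (hM : ∀ u v, ⟪M u, v⟫ = ⟪u, M v⟫) {b : CapSpace n} (hb : M b = b)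
    (a : CapSpace n) : detDeriv M (rankOne a b) = M.det * ⟪b, a⟫ := by
  simpa using mul_detDeriv_rankOne_of_eigenvector hM (β := 1) (by simpa using hb) a

lemma detDeriv_rankOne_eq_zero_of_eigenvector {M : CapSpace n →L[ℝ] CapSpace n}
    (hM : ∀ u v, ⟪M u, v⟫ = ⟪u, M v⟫) (hdet : M.det ≠ 0) {b : CapSpace n} {β : ℝ}
    (hb : M b = β • b) {a : CapSpace n} (hab : ⟪b, a⟫ = 0) : detDeriv M (rankOne a b) = 0 := by
  have h := mul_detDeriv_rankOne_of_eigenvector hM hb a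
  rw [hab, mul_zero] at h
  -- A zero eigenvalue with a nonzero eigenvector would contradict `M.det ≠ 0`.
  rcases mul_eq_zero.1 h with rfl | h
  · by_cases hb0 : b = 0
    · subst hb0
      rw [show rankOne a (0 : CapSpace n) = 0 by ext1 v; simp, detDeriv_zero]
    · have h2 : LinearMap.det (M : CapSpace n →ₗ[ℝ] CapSpace n) = 0 := by
        rw [LinearMap.det_eq_zero_iff_ker_ne_bot, Submodule.ne_bot_iff]
        exact ⟨b, by simpa using hb, hb0⟩
      exact absurd h2 hdet
  · exact h

section Polynomial

open Polynomial

/-- The coefficients of `t ↦ det (1 + t N)`: the elementary symmetric functions of the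
eigenvalues. -/
noncomputable def esymMat (j : ℕ) (N : Matrix (Fin (n + 1)) (Fin (n + 1)) ℝ) : ℝ :=
  (Matrix.det (1 + (X : ℝ[X]) • N.map C)).coeff j

/-- The coefficients of `t ↦ det (1 + t A)` for an operator `A`. -/
noncomputable def esymOp (j : ℕ) (A : CapSpace n →L[ℝ] CapSpace n) : ℝ := esymMat j (mat A)

lemma continuous_esymMat (j : ℕ) : Continuous (esymMat (n := n) j) := by
  unfold esymMat
  simp only [Matrix.coeff_det_one_add_X_smul_eq_sum_minors]
  exact continuous_finsetSum _ fun s _ => (continuous_id.matrix_submatrix _ _).matrix_det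

lemma continuous_esymOp (j : ℕ) : Continuous (esymOp (n := n) j) :=
  (continuous_esymMat j).comp continuous_mat

lemma eval_det_one_add_X_smul (t : ℝ) (N : Matrix (Fin (n + 1)) (Fin (n + 1)) ℝ) :
    (Matrix.det (1 + (X : ℝ[X]) • N.map C)).eval t = (1 + t • N).det := by
  rw [← coe_evalRingHom, RingHom.map_det]
  congr 1
  ext i j
  simp [Matrix.one_apply, apply_ite (eval t)]
  ring

lemma det_one_add_smul_eq_sum_esymMat (t : ℝ) (N : Matrix (Fin (n + 1)) (Fin (n + 1)) ℝ) :
    (1 + t • N).det = ∑ j ∈ Finset.range (n + 2), esymMat j N * t ^ j := by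
  have h2 : (Matrix.det (1 + (X : ℝ[X]) • N.map C)).natDegree < n + 2 := by
    have := Polynomial.natDegree_det_X_add_C_le N 1
    rw [add_comm ((X : ℝ[X]) • N.map C), Matrix.map_one C C_0 C_1, Fintype.card_fin] at this
    omega
  rw [← eval_det_one_add_X_smul, Polynomial.eval_eq_sum_range' h2]
  rfl

lemma det_one_add_smul_eq_sum (t : ℝ) (A : CapSpace n →L[ℝ] CapSpace n) :
    (1 + t • A).det = ∑ j ∈ Finset.range (n + 2), esymOp j A * t ^ j := by
  rw [← det_mat, mat_add, mat_one, mat_smul, det_one_add_smul_eq_sum_esymMat]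
  rfl

lemma esymMat_zero_left (N : Matrix (Fin (n + 1)) (Fin (n + 1)) ℝ) : esymMat 0 N = 1 := by
  simp [esymMat, Matrix.coeff_det_one_add_X_smul_eq_sum_minors]

lemma esymMat_one_left (N : Matrix (Fin (n + 1)) (Fin (n + 1)) ℝ) : esymMat 1 N = N.trace := by
  rw [esymMat, Matrix.coeff_det_one_add_X_smul_one]

lemma esymMat_zero_right {j : ℕ} (hj : j ≠ 0) :
    esymMat j (0 : Matrix (Fin (n + 1)) (Fin (n + 1)) ℝ) = 0 := by
  have : (0 : Matrix (Fin (n + 1)) (Fin (n + 1)) ℝ).map (C : ℝ →+* ℝ[X]) = 0 := by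
    ext i j; simp
  simp [esymMat, this, coeff_one, hj]

lemma esymOp_eq_of_det_eq {A : CapSpace n →L[ℝ] CapSpace n} {p : ℝ[X]}
    (h : ∀ t : ℝ, (1 + t • A).det = p.eval t) (j : ℕ) : esymOp j A = p.coeff j := by
  have : Matrix.det (1 + (X : ℝ[X]) • (mat A).map C) = p := by
    refine Polynomial.funext fun t => ?_
    rw [← h, ← det_mat, mat_add, mat_one, mat_smul, eval_det_one_add_X_smul]
  rw [esymOp, esymMat, this]

/-- Factor out the invertible `M`. The linear coefficient in `s` is `detDeriv M B`, by
`det_mul_esymMat_one`. -/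
lemma det_add_smul_eq_sum {M : CapSpace n →L[ℝ] CapSpace n} (hM : M.det ≠ 0)
    (B : CapSpace n →L[ℝ] CapSpace n) (s : ℝ) :
    (M + s • B).det = ∑ j ∈ Finset.range (n + 2),
      M.det * esymMat j ((M.det)⁻¹ • ((mat M).adjugate * mat B)) * s ^ j := by
  have h : mat (M + s • B)
      = mat M * (1 + s • ((M.det)⁻¹ • ((mat M).adjugate * mat B))) := by
    rw [mul_add, mul_one, Matrix.mul_smul, Matrix.mul_smul, ← mul_assoc, Matrix.mul_adjugate,
      det_mat, mat_add, mat_smul, Matrix.smul_mul, one_mul, smul_smul (M.det)⁻¹,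
      inv_mul_cancel₀ hM, one_smul]
  rw [← det_mat, h, Matrix.det_mul, det_mat, det_one_add_smul_eq_sum_esymMat, Finset.mul_sum]
  exact Finset.sum_congr rfl fun j _ => (mul_assoc _ _ _).symm

lemma det_mul_esymMat_one {M : CapSpace n →L[ℝ] CapSpace n} (hM : M.det ≠ 0)
    (B : CapSpace n →L[ℝ] CapSpace n) :
    M.det * esymMat 1 ((M.det)⁻¹ • ((mat M).adjugate * mat B)) = detDeriv M B := by
  rw [esymMat_one_left, Matrix.trace_smul, smul_eq_mul, ← mul_assoc, mul_inv_cancel₀ hM, one_mul]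
  rfl

/-- A polynomial vanishing near `0` has vanishing coefficients. -/
lemma eq_zero_of_sum_mul_pow_eq_zero {N : ℕ} {a : ℕ → ℝ} {δ : ℝ} (hδ : 0 < δ)
    (h : ∀ t : ℝ, |t| < δ → ∑ j ∈ Finset.range N, a j * t ^ j = 0) : ∀ j < N, a j = 0 := by
  set p : ℝ[X] := ∑ j ∈ Finset.range N, C (a j) * X ^ j with hp
  have hp0 : p = 0 := by
    refine Polynomial.eq_zero_of_infinite_isRoot p ((Set.Ioo_infinite hδ).mono fun t ht => ?_)
    rw [Set.mem_ofPred_eq, IsRoot, hp, eval_finsetSum]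
    simpa using h t (by rw [abs_of_pos ht.1]; exact ht.2)
  intro j hj
  have := congrArg (fun q => q.coeff j) hp0
  simpa [hp, finsetSum_coeff, coeff_X_pow, hj] using this

/-- Both sides are the derivative at `s = 0` of `det (1 + (t + s) A)`, expanded once around `1 + t
A` and once in powers of `t + s`. -/
lemma detDeriv_one_add_smul_self {t : ℝ} {A : CapSpace n →L[ℝ] CapSpace n}
    (hM : (1 + t • A).det ≠ 0) :
    detDeriv (1 + t • A) A
      = ∑ j ∈ Finset.range (n + 2), (j : ℝ) * esymOp j A * t ^ (j - 1) := by
  have h1 : HasDerivAt (fun s : ℝ => (1 + t • A + s • A).det) (detDeriv (1 + t • A) A) 0 := by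
    have : (fun s : ℝ => (1 + t • A + s • A).det) = fun s => ∑ j ∈ Finset.range (n + 2),
      (1 + t • A).det * esymMat j (((1 + t • A).det)⁻¹ •
        ((mat (1 + t • A)).adjugate * mat A)) * s ^ j := by
      funext s; exact det_add_smul_eq_sum hM A s
    rw [this, ← det_mul_esymMat_one hM]
    have h2 := HasDerivAt.fun_sum (u := Finset.range (n + 2)) (x := (0 : ℝ)) fun j _ =>
      ((hasDerivAt_pow j (0 : ℝ)).const_mul ((1 + t • A).det *
        esymMat j (((1 + t • A).det)⁻¹ • ((mat (1 + t • A)).adjugate * mat A))))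
    refine h2.congr_deriv ?_
    rw [Finset.sum_eq_single 1]
    · simp
    · intro j _ hj
      rcases Nat.lt_or_ge j 1 with h | h
      · interval_cases j; simp
      · rw [zero_pow (by omega)]; simp
    · simp
  have h3 : HasDerivAt (fun s : ℝ => (1 + t • A + s • A).det)
      (∑ j ∈ Finset.range (n + 2), esymOp j A * (j * t ^ (j - 1))) 0 := by
    have : (fun s : ℝ => (1 + t • A + s • A).det)
        = fun s => ∑ j ∈ Finset.range (n + 2), esymOp j A * (t + s) ^ j := by
      funext s; rw [← det_one_add_smul_eq_sum, show (t + s) • A = t • A + s • A by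
        ext1 v; exact add_smul t s (A v),
        add_assoc]
    rw [this]
    refine HasDerivAt.fun_sum fun j _ => ?_
    have := (((hasDerivAt_id (0 : ℝ)).const_add t).pow j).const_mul (esymOp j A)
    simpa using this
  rw [h1.unique h3]
  exact Finset.sum_congr rfl fun j _ => by ring

end Polynomial

end Determinants
end Capillary

namespace Capillary

variable {n : ℕ}

/-! ### The cofactors of a Jacobian matrix are divergence free, for `C¹` maps. -/

section NullLagrangian

open MeasureTheory Set Metric
open scoped NNReal

lemma det_one : (1 : CapSpace n →L[ℝ] CapSpace n).det = 1 := by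
  rw [← det_mat, mat_one, Matrix.det_one]

lemma det_one_add_ne_zero {D : CapSpace n →L[ℝ] CapSpace n} {c : ℝ} (hD : ‖D‖ ≤ c) (hc : c < 1) :
    (1 + D).det ≠ 0 := by
  intro h
  obtain ⟨v, hv, hv0⟩ := (Submodule.ne_bot_iff _).1
    (LinearMap.det_eq_zero_iff_ker_ne_bot.1 h)
  have h1 : v = -D v := by
    have : v + D v = 0 := by simpa using hv
    exact eq_neg_of_add_eq_zero_left this
  have h2 : ‖v‖ ≤ c * ‖v‖ := by
    calc ‖v‖ = ‖D v‖ := by conv_lhs => rw [h1, norm_neg]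
      _ ≤ ‖D‖ * ‖v‖ := D.le_opNorm v
      _ ≤ c * ‖v‖ := by gcongr
  have h3 : 0 < ‖v‖ := norm_pos_iff.2 hv0
  nlinarith

/-- The determinant does not vanish along the segment from `1` to `1 + D` and equals `1` at its
start. -/
lemma det_one_add_pos {D : CapSpace n →L[ℝ] CapSpace n} {c : ℝ} (hD : ‖D‖ ≤ c) (hc : c < 1) :
    0 < (1 + D).det := by
  by_contra! hle
  have hcont : Continuous fun s : ℝ => (1 + s • D).det := by
    simp only [← det_mat]
    exact (continuous_mat.comp (by fun_prop)).matrix_det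
  have h0 : (0 : ℝ) ∈ Icc ((fun s : ℝ => (1 + s • D).det) 1) ((fun s : ℝ => (1 + s • D).det) 0) := by
    refine ⟨by simpa using hle, ?_⟩
    have : (1 + (0 : ℝ) • D) = 1 := by
      ext1 v; simp
    simp only [this, det_one, zero_le_one]
  obtain ⟨s, hs, hs0⟩ := intermediate_value_Icc' zero_le_one hcont.continuousOn h0
  refine det_one_add_ne_zero (D := s • D) (c := c) ?_ hc hs0
  calc ‖s • D‖ = |s| * ‖D‖ := by rw [norm_smul, Real.norm_eq_abs]
    _ ≤ 1 * c := by
      gcongr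
      rw [abs_of_nonneg hs.1]; exact hs.2
    _ = c := one_mul c

lemma fderiv_eq_zero_of_notMem_tsupport {F : CapSpace n → CapSpace n} {x : CapSpace n}
    (hx : x ∉ tsupport F) : fderiv ℝ F x = 0 := by
  by_contra h
  exact hx (support_fderiv_subset ℝ h)

/-- The map `id + F` is a bijection, because `F` is a contraction, and it is the identity off a
ball. It therefore maps the ball onto itself, and the change of variables formula compares volumes.
-/
theorem integral_det_one_add_fderiv_sub_one {F : CapSpace n → CapSpace n} (hF : ContDiff ℝ 1 F)
    (hs : HasCompactSupport F) {c : ℝ≥0} (hlip : LipschitzWith c F) (hc : c < 1) :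
    ∫ x, ((1 + fderiv ℝ F x).det - 1) = 0 := by
  have hD : ∀ x, ‖fderiv ℝ F x‖ ≤ c := fun x => norm_fderiv_le_of_lipschitz ℝ hlip
  have hc' : (c : ℝ) < 1 := by exact_mod_cast hc
  set Φ : CapSpace n → CapSpace n := fun x => x + F x with hΦ
  have hΦd : ∀ x, HasFDerivAt Φ (1 + fderiv ℝ F x) x := fun x =>
    (hasFDerivAt_id x).add ((hF.differentiable one_ne_zero) x).hasFDerivAt
  have happ : ApproximatesLinearOn Φ
      ((ContinuousLinearEquiv.refl ℝ (CapSpace n) : CapSpace n ≃L[ℝ] CapSpace n) :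
        CapSpace n →L[ℝ] CapSpace n) univ c := by
    rw [ApproximatesLinearOn.approximatesLinearOn_iff_lipschitzOnWith]
    have : (Φ - ⇑((ContinuousLinearEquiv.refl ℝ (CapSpace n) : CapSpace n ≃L[ℝ] CapSpace n) :
        CapSpace n →L[ℝ] CapSpace n)) = F := by
      funext x; simp [hΦ]
    rw [this]
    exact hlip.lipschitzOnWith
  have hN : Subsingleton (CapSpace n) ∨ c < ‖((ContinuousLinearEquiv.refl ℝ (CapSpace n)).symm :
      CapSpace n →L[ℝ] CapSpace n)‖₊⁻¹ := by
    right
    have : ‖((ContinuousLinearEquiv.refl ℝ (CapSpace n)).symm :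
      CapSpace n →L[ℝ] CapSpace n)‖₊ = 1 := by
      have h1 : ((ContinuousLinearEquiv.refl ℝ (CapSpace n)).symm :
        CapSpace n →L[ℝ] CapSpace n) = ContinuousLinearMap.id ℝ (CapSpace n) := rfl
      rw [h1]
      ext
      simp
    rw [this]; simpa using hc
  have hinj : Function.Injective Φ := injOn_univ.1 (happ.injOn hN)
  have hsurj : Function.Surjective Φ := happ.surjective hN
  obtain ⟨R, hR⟩ := hs.isCompact.isBounded.subset_closedBall (0 : CapSpace n)
  have hout : ∀ x, x ∉ closedBall (0 : CapSpace n) R → Φ x = x := by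
    intro x hx
    have : F x = 0 := image_eq_zero_of_notMem_tsupport fun h => hx (hR h)
    simp [hΦ, this]
  have himg : Φ '' closedBall 0 R = closedBall 0 R := by
    apply Subset.antisymm
    · rintro _ ⟨x, hx, rfl⟩
      by_contra hy
      exact hy (by have := hinj (hout _ hy); rwa [this])
    · intro y hy
      obtain ⟨x, rfl⟩ := hsurj y
      refine ⟨x, ?_, rfl⟩
      by_contra hx
      rw [hout x hx] at hy
      exact hx hy
  have h1 := integral_image_eq_integral_abs_det_fderiv_smul volume
    (isClosed_closedBall (x := (0 : CapSpace n)) (ε := R)).measurableSet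
    (fun x _ => (hΦd x).hasFDerivWithinAt) hinj.injOn (fun _ => (1 : ℝ))
  rw [himg] at h1
  have hcont : Continuous fun x => (1 + fderiv ℝ F x).det := by
    simp only [← det_mat]
    exact (continuous_mat.comp
      (continuous_const.add (hF.continuous_fderiv one_ne_zero))).matrix_det
  have h2 : ∫ x, ((1 + fderiv ℝ F x).det - 1)
      = ∫ x in closedBall (0 : CapSpace n) R, ((1 + fderiv ℝ F x).det - 1) := by
    symm
    apply setIntegral_eq_integral_of_forall_compl_eq_zero
    intro x hx
    rw [fderiv_eq_zero_of_notMem_tsupport fun h => hx (hR h), add_zero, det_one,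
      sub_self]
  have hint : ∀ f : CapSpace n → ℝ, Continuous f →
      IntegrableOn f (closedBall (0 : CapSpace n) R) := fun f hf =>
    hf.continuousOn.integrableOn_compact (isCompact_closedBall _ _)
  rw [h2, integral_sub (hint _ hcont) (hint _ continuous_const), sub_eq_zero, h1]
  refine setIntegral_congr_fun isClosed_closedBall.measurableSet fun x _ => ?_
  simp only [smul_eq_mul, mul_one]
  rw [abs_of_pos (det_one_add_pos (hD x) hc')]

/-- Weak form of the fact that the cofactor matrix of a Jacobian matrix is divergence free. -/
theorem integral_detDeriv_one_add_fderiv {F Y : CapSpace n → CapSpace n} (hF : ContDiff ℝ 1 F)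
    (hFs : HasCompactSupport F) {c : ℝ≥0} (hlip : LipschitzWith c F) (hc : c < 1)
    (hY : ContDiff ℝ 1 Y) (hYs : HasCompactSupport Y) :
    ∫ x, detDeriv (1 + fderiv ℝ F x) (fderiv ℝ Y x) = 0 := by
  have hc' : (c : ℝ) < 1 := by exact_mod_cast hc
  have hD : ∀ x, ‖fderiv ℝ F x‖ ≤ c := fun x => norm_fderiv_le_of_lipschitz ℝ hlip
  have hne : ∀ x, (1 + fderiv ℝ F x).det ≠ 0 := fun x => det_one_add_ne_zero (hD x) hc'
  obtain ⟨K, hK⟩ := hY.lipschitzWith_of_hasCompactSupport hYs one_ne_zero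
  have hFc : Continuous fun x => mat (1 + fderiv ℝ F x) := continuous_mat.comp
      (continuous_const.add (hF.continuous_fderiv one_ne_zero))
  have hYc : Continuous fun x => mat (fderiv ℝ Y x) :=
    continuous_mat.comp (hY.continuous_fderiv one_ne_zero)
  have hdet : Continuous fun x => (1 + fderiv ℝ F x).det := by
    simp only [← det_mat]; exact hFc.matrix_det
  set a : ℕ → CapSpace n → ℝ := fun j x => (1 + fderiv ℝ F x).det *
    esymMat j (((1 + fderiv ℝ F x).det)⁻¹ •
      ((mat (1 + fderiv ℝ F x)).adjugate * mat (fderiv ℝ Y x))) with ha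
  have hac : ∀ j, Continuous (a j) := fun j =>
    hdet.mul ((continuous_esymMat j).comp
      ((hdet.inv₀ hne).smul (hFc.matrix_adjugate.mul hYc)))
  have has : ∀ j, j ≠ 0 → HasCompactSupport (a j) := by
    intro j hj
    refine HasCompactSupport.intro hYs.isCompact fun x hx => ?_
    simp only [ha]
    rw [fderiv_eq_zero_of_notMem_tsupport hx, mat_zero, mul_zero, smul_zero,
      esymMat_zero_right hj, mul_zero]
  have hai : ∀ j, j ≠ 0 → Integrable (a j) := fun j hj =>
    (hac j).integrable_of_hasCompactSupport (has j hj)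
  have ha0 : ∀ x, a 0 x = (1 + fderiv ℝ F x).det := fun x => by
    simp [ha, esymMat_zero_left]
  have hi0 : Integrable fun x => (1 + fderiv ℝ F x).det - 1 := by
    refine (hdet.sub continuous_const).integrable_of_hasCompactSupport
      (HasCompactSupport.intro hFs.isCompact fun x hx => ?_)
    rw [Pi.sub_apply, fderiv_eq_zero_of_notMem_tsupport hx, add_zero, det_one, sub_self]
  -- This bound keeps `F + s Y` a contraction for `|s| < δ`.
  set δ : ℝ := (1 - c) / (K + 1) with hδ
  have hK1 : (0 : ℝ) < K + 1 := by positivity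
  have hδ0 : 0 < δ := div_pos (by linarith) hK1
  -- Expand the integral of `det (1 + DF + s DY) - 1` in `s`. The constant term is `∫ (det (1 + DF)
  -- - 1) = 0`; it is entered as `0` because `a 0` alone is not compactly supported. The coefficient
  -- of `s` is the claim.
  have key : ∀ s : ℝ, |s| < δ → ∑ j ∈ Finset.range (n + 2),
      (if j = 0 then 0 else ∫ x, a j x) * s ^ j = 0 := by
    intro s hs
    have hlip' : LipschitzWith (c + ‖s‖₊ * K) (fun x => F x + s • Y x) := by
      refine hlip.add ?_
      exact (lipschitzWith_smul s).comp hK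
    have hlt : c + ‖s‖₊ * K < 1 := by
      have h1 : |s| * (K + 1) < 1 - c := by rwa [hδ, lt_div_iff₀ hK1] at hs
      have h2 : (c : ℝ) + |s| * K < 1 := by nlinarith [abs_nonneg s]
      rw [← NNReal.coe_lt_coe]
      simpa using h2
    have h1 := integral_det_one_add_fderiv_sub_one
      (hF.add (contDiff_const.smul hY)) (hFs.add (hYs.smul_left (f := fun _ => s))) hlip' hlt
    have h2 : ∀ x, (1 + fderiv ℝ (fun x => F x + s • Y x) x).det - 1
        = ((1 + fderiv ℝ F x).det - 1)
          + ∑ j ∈ Finset.range (n + 1), a (j + 1) x * s ^ (j + 1) := by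
      intro x
      have hf : fderiv ℝ (fun x => F x + s • Y x) x = fderiv ℝ F x + s • fderiv ℝ Y x :=
        ((hF.differentiable one_ne_zero x).hasFDerivAt.add
          ((hY.differentiable one_ne_zero x).hasFDerivAt.const_smul s)).fderiv
      rw [hf, ← add_assoc, det_add_smul_eq_sum (hne x), Finset.sum_range_succ']
      have := ha0 x
      simp only [ha] at this ⊢
      rw [this]
      ring
    have h1' : ∫ x, (1 + fderiv ℝ (fun x => F x + s • Y x) x).det - 1 = 0 := h1
    simp only [h2] at h1'
    rw [integral_add hi0, integral_det_one_add_fderiv_sub_one hF hFs hlip hc, zero_add,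
      integral_finsetSum] at h1'
    · rw [Finset.sum_range_succ']
      simp only [integral_mul_const] at h1'
      simpa using h1'
    · exact fun j _ => (hai _ (by omega)).mul_const _
    · exact integrable_finsetSum _ fun j _ => (hai _ (by omega)).mul_const _
  have h1 := eq_zero_of_sum_mul_pow_eq_zero hδ0 key 1 (by omega)
  rw [if_neg one_ne_zero] at h1
  rw [← h1]
  refine integral_congr_ae (Filter.Eventually.of_forall fun x => ?_)
  exact (det_mul_esymMat_one (hne x) _).symm

end NullLagrangian
end Capillary

namespace Capillary

variable {n : ℕ}

/-! ### Homogeneous fields on the cone over the cap, and the divergence of the flux. -/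

section Cone

open MeasureTheory Set Metric
open scoped NNReal

/-- The vertical unit vector. -/
noncomputable def vert (n : ℕ) : CapSpace n := EuclideanSpace.single (Fin.last n) 1

lemma norm_vert : ‖vert n‖ = 1 := by simp [vert]

/-- The function whose superlevel set `0 ≤ coneFun c x` is the cone over the cap. -/
noncomputable def coneFun (c : ℝ) (x : CapSpace n) : ℝ := ⟪vert n, x⟫ - c * ‖x‖

/-- The gradient of `coneFun`. -/
noncomputable def coneGrad (c : ℝ) (x : CapSpace n) : CapSpace n := vert n - (c * ‖x‖⁻¹) • x

/-- The one-homogeneous extension of the support function of the cap. -/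
noncomputable def coneEll (c : ℝ) (x : CapSpace n) : ℝ := ‖x‖ - c * ⟪vert n, x⟫

/-- The gradient of `coneEll`. -/
noncomputable def ellGrad (c : ℝ) (x : CapSpace n) : CapSpace n := ‖x‖⁻¹ • x - c • vert n

/-- The Hessian of `coneEll`. -/
noncomputable def ellHess (x : CapSpace n) : CapSpace n →L[ℝ] CapSpace n :=
  ‖x‖⁻¹ • (1 - (‖x‖⁻¹ ^ 2) • rankOne x x)

lemma hasFDerivAt_norm {x : CapSpace n} (hx : x ≠ 0) :
    HasFDerivAt (fun y : CapSpace n => ‖y‖) (innerSL ℝ (‖x‖⁻¹ • x)) x := by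
  have h0 : ‖x‖ ≠ 0 := norm_ne_zero_iff.2 hx
  have h := ((hasStrictFDerivAt_norm_sq x).hasFDerivAt).sqrt (by positivity)
  simp only [Real.sqrt_sq (norm_nonneg _)] at h
  refine h.congr_fderiv ?_
  ext1 v
  simp
  field_simp

lemma hasFDerivAt_inner_vert (x : CapSpace n) :
    HasFDerivAt (fun y : CapSpace n => ⟪vert n, y⟫) (innerSL ℝ (vert n)) x :=
  (innerSL ℝ (vert n)).hasFDerivAt

lemma hasFDerivAt_coneFun (c : ℝ) {x : CapSpace n} (hx : x ≠ 0) :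
    HasFDerivAt (coneFun c) (innerSL ℝ (coneGrad c x)) x := by
  refine ((hasFDerivAt_inner_vert x).sub ((hasFDerivAt_norm hx).const_mul c)).congr_fderiv ?_
  ext1 v
  simp [coneGrad, mul_assoc]

lemma hasFDerivAt_coneEll (c : ℝ) {x : CapSpace n} (hx : x ≠ 0) :
    HasFDerivAt (coneEll c) (innerSL ℝ (ellGrad c x)) x := by
  refine ((hasFDerivAt_norm hx).sub ((hasFDerivAt_inner_vert x).const_mul c)).congr_fderiv ?_
  ext1 v
  simp [ellGrad]

lemma hasFDerivAt_ellGrad (c : ℝ) {x : CapSpace n} (hx : x ≠ 0) :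
    HasFDerivAt (ellGrad c) (ellHess x) x := by
  have h0 : ‖x‖ ≠ 0 := norm_ne_zero_iff.2 hx
  have h1 := ((hasDerivAt_inv h0).comp_hasFDerivAt x (hasFDerivAt_norm hx)).smul
    (hasFDerivAt_id x)
  refine (h1.sub_const (c • vert n)).congr_fderiv ?_
  ext1 v
  simp only [ellHess, add_apply, sub_apply,
    smul_apply, ContinuousLinearMap.smulRight_apply, rankOne_apply,
    innerSL_apply_apply, inner_smul_left, smul_sub, smul_smul, Function.comp_apply, id_eq,
    one_apply_eq_self, ContinuousLinearMap.id_apply, smul_eq_mul,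
    RCLike.conj_to_real]
  rw [sub_eq_add_neg, ← neg_smul]
  congr 2
  field_simp

lemma contDiffAt_coneFun (c : ℝ) {x : CapSpace n} (hx : x ≠ 0) :
    ContDiffAt ℝ 1 (coneFun c) x := by
  unfold coneFun
  exact ((innerSL ℝ (vert n)).contDiff.contDiffAt).sub (contDiffAt_const.mul (contDiffAt_norm ℝ hx))

lemma contDiffAt_coneEll (c : ℝ) {x : CapSpace n} (hx : x ≠ 0) :
    ContDiffAt ℝ 1 (coneEll c) x := by
  unfold coneEll
  exact (contDiffAt_norm ℝ hx).sub (contDiffAt_const.mul (innerSL ℝ (vert n)).contDiff.contDiffAt)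

lemma contDiffAt_ellGrad (c : ℝ) {x : CapSpace n} (hx : x ≠ 0) :
    ContDiffAt ℝ 1 (ellGrad c) x := by
  unfold ellGrad
  exact (((contDiffAt_norm ℝ hx).inv (norm_ne_zero_iff.2 hx)).smul contDiffAt_id).sub
    contDiffAt_const

lemma inner_ellGrad_self (c : ℝ) {x : CapSpace n} (hx : x ≠ 0) :
    ⟪x, ellGrad c x⟫ = coneEll c x := by
  have h0 : ‖x‖ ≠ 0 := norm_ne_zero_iff.2 hx
  simp only [ellGrad, coneEll, inner_sub_right, inner_smul_right, real_inner_self_eq_norm_sq,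
    real_inner_comm x]
  field_simp

lemma continuous_coneFun (c : ℝ) : Continuous (coneFun (n := n) c) := by
  unfold coneFun; fun_prop

lemma continuous_coneEll (c : ℝ) : Continuous (coneEll (n := n) c) := by
  unfold coneEll; fun_prop

/-- The gradient field of a one-homogeneous `C²` function on a neighbourhood of the cone over the
cap, satisfying the capillary boundary condition. -/
structure IsCapField (c : ℝ) (G : CapSpace n → CapSpace n) (Ω : Set (CapSpace n)) : Prop where
  isOpen : IsOpen Ω
  zero_notMem : (0 : CapSpace n) ∉ Ω
  smul_mem : ∀ x ∈ Ω, ∀ r : ℝ, 0 < r → r • x ∈ Ω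
  mem : ∀ x : CapSpace n, x ≠ 0 → 0 ≤ coneFun c x → x ∈ Ω
  contDiffOn : ContDiffOn ℝ 1 G Ω
  smul_eq : ∀ x ∈ Ω, ∀ r : ℝ, 0 < r → G (r • x) = G x
  symm : ∀ x ∈ Ω, ∀ u v, ⟪fderiv ℝ G x u, v⟫ = ⟪u, fderiv ℝ G x v⟫
  boundary : ∀ x : CapSpace n, x ≠ 0 → coneFun c x = 0 → ⟪vert n, G x⟫ = 0

lemma contDiff_smul_of_tsupport_subset {φ : CapSpace n → ℝ} {Z : CapSpace n → CapSpace n}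
    {Ω : Set (CapSpace n)} (hΩ : IsOpen Ω) (hφ : ContDiff ℝ 1 φ) (hZ : ContDiffOn ℝ 1 Z Ω)
    (h : tsupport φ ⊆ Ω) : ContDiff ℝ 1 fun x => φ x • Z x := by
  rw [contDiff_iff_contDiffAt]
  intro x
  by_cases hx : x ∈ tsupport φ
  · exact hφ.contDiffAt.smul (hZ.contDiffAt (hΩ.mem_nhds (h hx)))
  · refine (contDiffAt_const (c := (0 : CapSpace n))).congr_of_eventuallyEq ?_
    filter_upwards [(isClosed_tsupport φ).isOpen_compl.mem_nhds hx] with y hy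
    rw [image_eq_zero_of_notMem_tsupport hy, zero_smul]

/-- Being `1` near each point of `K`, and not only on `K`, preserves derivatives on `K` after
multiplication by the cutoff. -/
lemma exists_cutoff {K Ω : Set (CapSpace n)} (hK : IsCompact K) (hΩ : IsOpen Ω) (hKΩ : K ⊆ Ω) :
    ∃ χ : CapSpace n → ℝ, tsupport χ ⊆ Ω ∧ ContDiff ℝ 1 χ ∧
      HasCompactSupport χ ∧ ∀ x ∈ K, ∀ᶠ y in nhds x, χ y = 1 := by
  obtain ⟨U, hUo, hKU, hUΩ, hUc⟩ := exists_open_between_and_isCompact_closure hK hΩ hKΩ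
  obtain ⟨f, h0, h1, -⟩ := exists_contMDiffMap_zero_one_nhds_of_isClosed
    (modelWithCornersSelf ℝ (CapSpace n)) (n := 1) hUo.isClosed_compl hK.isClosed
    (disjoint_compl_left_iff_subset.2 hKU)
  have hsupp : tsupport f ⊆ closure U := by
    refine closure_mono fun x hx => ?_
    by_contra hxU
    exact hx (h0.self_of_nhdsSet x hxU)
  exact ⟨f, hsupp.trans hUΩ, f.contMDiff.contDiff,
    hUc.of_isClosed_subset (isClosed_tsupport _) hsupp, fun x hx => (eventually_nhdsSet_iff_forall.1 h1) x hx⟩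

namespace IsCapField

variable {c : ℝ} {G : CapSpace n → CapSpace n} {Ω : Set (CapSpace n)}

lemma ne_zero (hG : IsCapField c G Ω) {x : CapSpace n} (hx : x ∈ Ω) : x ≠ 0 :=
  fun h => hG.zero_notMem (h ▸ hx)

lemma contDiffAt (hG : IsCapField c G Ω) {x : CapSpace n} (hx : x ∈ Ω) : ContDiffAt ℝ 1 G x :=
  hG.contDiffOn.contDiffAt (hG.isOpen.mem_nhds hx)

lemma hasFDerivAt (hG : IsCapField c G Ω) {x : CapSpace n} (hx : x ∈ Ω) :
    HasFDerivAt G (fderiv ℝ G x) x :=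
  ((hG.contDiffAt hx).differentiableAt one_ne_zero).hasFDerivAt

lemma continuousOn_fderiv (hG : IsCapField c G Ω) : ContinuousOn (fderiv ℝ G) Ω :=
  hG.contDiffOn.continuousOn_fderiv_of_isOpen hG.isOpen le_rfl

/-- Euler's relation in degree zero. -/
lemma fderiv_self (hG : IsCapField c G Ω) {x : CapSpace n} (hx : x ∈ Ω) :
    fderiv ℝ G x x = 0 := by
  have h1 : HasDerivAt (fun r : ℝ => r • x) x 1 := by
    simpa using (hasDerivAt_id (1 : ℝ)).smul_const x
  have h2 : HasDerivAt (fun r : ℝ => G (r • x)) (fderiv ℝ G x x) 1 := by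
    have h3 : HasFDerivAt G (fderiv ℝ G x) ((1 : ℝ) • x) := by
      rw [one_smul]; exact hG.hasFDerivAt hx
    exact h3.comp_hasDerivAt 1 h1
  have h4 : HasDerivAt (fun r : ℝ => G (r • x)) 0 1 := by
    refine (hasDerivAt_const (1 : ℝ) (G x)).congr_of_eventuallyEq ?_
    filter_upwards [lt_mem_nhds (zero_lt_one' ℝ)] with r hr using hG.smul_eq x hx r hr
  exact h2.unique h4

lemma fderiv_smul (hG : IsCapField c G Ω) {x : CapSpace n} (hx : x ∈ Ω) {r : ℝ} (hr : 0 < r) :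
    fderiv ℝ G (r • x) = r⁻¹ • fderiv ℝ G x := by
  have h1 : HasFDerivAt (fun y => G (r • y)) ((fderiv ℝ G (r • x)).comp
      (r • ContinuousLinearMap.id ℝ (CapSpace n))) x :=
    (hG.hasFDerivAt (hG.smul_mem x hx r hr)).comp x ((hasFDerivAt_id x).const_smul r)
  have h2 : HasFDerivAt (fun y => G (r • y)) (fderiv ℝ G x) x := by
    refine (hG.hasFDerivAt hx).congr_of_eventuallyEq ?_
    filter_upwards [hG.isOpen.mem_nhds hx] with y hy using hG.smul_eq y hy r hr
  rw [← h1.unique h2]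
  ext1 v
  simp [smul_smul, hr.ne']

/-- Recovers the potential: `G` is the gradient of `H = ⟪G y, y⟫`, by symmetry of `DG` and Euler's
relation. -/
lemma hasFDerivAt_inner_self (hG : IsCapField c G Ω) {x : CapSpace n} (hx : x ∈ Ω) :
    HasFDerivAt (fun y => ⟪G y, y⟫) (innerSL ℝ (G x)) x := by
  refine ((hG.hasFDerivAt hx).inner ℝ (hasFDerivAt_id x)).congr_fderiv ?_
  ext1 v
  simp [hG.symm x hx v x, hG.fderiv_self hx]

/-- Differentiating the boundary condition along the boundary shows that `DG (vert n)` is normal to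
it. Since `coneGrad` differs from `vert n` by a multiple of `x`, which `DG` kills, the conormal is
an eigenvector of `DG`. -/
lemma exists_eigenvalue_of_boundary (hG : IsCapField c G Ω) {x : CapSpace n} (hx0 : x ≠ 0)
    (hx : coneFun c x = 0) (hgrad : coneGrad c x ≠ 0) :
    ∃ β : ℝ, fderiv ℝ G x (coneGrad c x) = β • coneGrad c x := by
  have hxΩ := hG.mem x hx0 hx.ge
  have hs1 : HasStrictFDerivAt (coneFun c) (innerSL ℝ (coneGrad c x)) x :=
    (contDiffAt_coneFun c hx0).hasStrictFDerivAt' (hasFDerivAt_coneFun c hx0) one_ne_zero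
  have hs2 : HasStrictFDerivAt (fun y => ⟪vert n, G y⟫)
      ((innerSL ℝ (vert n)).comp (fderiv ℝ G x)) x :=
    ((innerSL ℝ (vert n)).hasStrictFDerivAt).comp x
      ((hG.contDiffAt hxΩ).hasStrictFDerivAt one_ne_zero)
  -- A function constant on a level set has a local extremum there, so Lagrange multipliers apply.
  have hext : IsLocalExtrOn (fun y => ⟪vert n, G y⟫) {y | coneFun c y = coneFun c x} x := by
    left
    have : ∀ᶠ y in nhdsWithin x {y | coneFun c y = coneFun c x}, y ≠ 0 :=
      nhdsWithin_le_nhds (isOpen_ne.mem_nhds hx0)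
    filter_upwards [this, self_mem_nhdsWithin] with y hy hy'
    have hy' : coneFun c y = coneFun c x := hy'
    rw [hG.boundary x hx0 hx, hG.boundary y hy (hy'.trans hx)]
  obtain ⟨a, b, hab, h⟩ := hext.exists_multipliers_of_hasStrictFDerivAt_1d hs1 hs2
  have h1 : ∀ v, a * ⟪coneGrad c x, v⟫ + b * ⟪vert n, fderiv ℝ G x v⟫ = 0 := by
    intro v
    simpa using congrArg (fun T => T v) h
  have hb : b ≠ 0 := by
    rintro rfl
    have h2 := h1 (coneGrad c x)
    rw [zero_mul, add_zero, real_inner_self_eq_norm_sq] at h2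
    rcases mul_eq_zero.1 h2 with rfl | h2
    · exact hab rfl
    · exact hgrad (norm_eq_zero.1 (pow_eq_zero_iff two_ne_zero |>.1 h2))
  refine ⟨-a / b, ?_⟩
  have h3 : fderiv ℝ G x (coneGrad c x) = fderiv ℝ G x (vert n) := by
    rw [coneGrad, map_sub, map_smul, hG.fderiv_self hxΩ, smul_zero, sub_zero]
  rw [h3]
  refine ext_inner_right ℝ fun v => ?_
  rw [hG.symm x hxΩ, inner_smul_left]
  have := h1 v
  simp only [RCLike.conj_to_real]
  field_simp
  linarith

/-- The vector field `L ∇H - H ∇L` attached to a gradient field `G = ∇H`. -/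
noncomputable def flux (c : ℝ) (G : CapSpace n → CapSpace n) (x : CapSpace n) : CapSpace n :=
  coneEll c x • G x - ⟪G x, x⟫ • ellGrad c x

lemma inner_self_flux (c : ℝ) (G : CapSpace n → CapSpace n) {x : CapSpace n} (hx : x ≠ 0) :
    ⟪x, flux c G x⟫ = 0 := by
  rw [flux, inner_sub_right, inner_smul_right, inner_smul_right, inner_ellGrad_self c hx,
    real_inner_comm x (G x)]
  ring

/-- Both `G` and `ellGrad` are horizontal on the boundary and the flux is orthogonal to `x`, so the
flux is tangent to the boundary of the cone. -/
lemma inner_coneGrad_flux (hG : IsCapField c G Ω) {x : CapSpace n} (hx0 : x ≠ 0)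
    (hx : coneFun c x = 0) : ⟪coneGrad c x, flux c G x⟫ = 0 := by
  have h0 : ‖x‖ ≠ 0 := norm_ne_zero_iff.2 hx0
  have h1 := hG.boundary x hx0 hx
  have h2 : ⟪vert n, ellGrad c x⟫ = 0 := by
    rw [ellGrad, inner_sub_right, inner_smul_right, inner_smul_right,
      real_inner_self_eq_norm_sq, norm_vert]
    rw [coneFun] at hx
    have : ⟪vert n, x⟫ = c * ‖x‖ := by linarith
    rw [this]
    field_simp
    ring
  rw [coneGrad, inner_sub_left, inner_smul_left, inner_self_flux c G hx0, mul_zero, sub_zero,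
    flux, inner_sub_right, inner_smul_right, inner_smul_right, h1, h2]
  ring

lemma contDiffOn_flux (hG : IsCapField c G Ω) : ContDiffOn ℝ 1 (flux c G) Ω := by
  intro x hx
  refine ContDiffAt.contDiffWithinAt ?_
  have h1 := contDiffAt_coneEll c (hG.ne_zero hx)
  have h2 := contDiffAt_ellGrad c (hG.ne_zero hx)
  have h3 := hG.contDiffAt hx
  exact (h1.smul h3).sub ((h3.inner ℝ contDiffAt_id).smul h2)

lemma hasFDerivAt_flux (hG : IsCapField c G Ω) {x : CapSpace n} (hx : x ∈ Ω) :
    HasFDerivAt (flux c G) (coneEll c x • fderiv ℝ G x + rankOne (G x) (ellGrad c x)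
      - (⟪G x, x⟫ • ellHess x + rankOne (ellGrad c x) (G x))) x := by
  have hx0 := hG.ne_zero hx
  have h := ((hasFDerivAt_coneEll c hx0).smul (hG.hasFDerivAt hx)).sub
    ((hG.hasFDerivAt_inner_self hx).smul (hasFDerivAt_ellGrad c hx0))
  exact h

/-- The divergence of the flux contracted with the cofactors of `1 + t DG`. -/
noncomputable def fluxDiv (c : ℝ) (G : CapSpace n → CapSpace n) (t : ℝ) (x : CapSpace n) : ℝ :=
  coneEll c x * detDeriv (1 + t • fderiv ℝ G x) (fderiv ℝ G x)
    - ⟪G x, x⟫ * ‖x‖⁻¹ * (n * (1 + t • fderiv ℝ G x).det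
      - t * detDeriv (1 + t • fderiv ℝ G x) (fderiv ℝ G x))

lemma symm_one_add_smul (hG : IsCapField c G Ω) {x : CapSpace n} (hx : x ∈ Ω) (t : ℝ)
    (u v : CapSpace n) : ⟪(1 + t • fderiv ℝ G x) u, v⟫ = ⟪u, (1 + t • fderiv ℝ G x) v⟫ := by
  simp [inner_add_left, inner_add_right, inner_smul_left, inner_smul_right, hG.symm x hx u v]

lemma detDeriv_one (t : ℝ) (A : CapSpace n →L[ℝ] CapSpace n) :
    detDeriv (1 + t • A) 1 = (n + 1) * (1 + t • A).det - t * detDeriv (1 + t • A) A := by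
  have h := detDeriv_self (1 + t • A)
  conv_lhs at h => rw [detDeriv_add, detDeriv_smul]
  linarith

/-- `ellHess x` is `‖x‖⁻¹` times the projection off `x`, and `1 + t DG` fixes `x`; the projection
turns the factor `n + 1` of `detDeriv_one` into `n`. -/
lemma detDeriv_ellHess (hG : IsCapField c G Ω) {x : CapSpace n} (hx : x ∈ Ω) (t : ℝ) :
    detDeriv (1 + t • fderiv ℝ G x) (ellHess x)
      = ‖x‖⁻¹ * (n * (1 + t • fderiv ℝ G x).det
        - t * detDeriv (1 + t • fderiv ℝ G x) (fderiv ℝ G x)) := by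
  have h0 : ‖x‖ ≠ 0 := norm_ne_zero_iff.2 (hG.ne_zero hx)
  have h1 : detDeriv (1 + t • fderiv ℝ G x) (rankOne x x)
      = (1 + t • fderiv ℝ G x).det * ⟪x, x⟫ :=
    detDeriv_rankOne_of_fixed (hG.symm_one_add_smul hx t) (by simp [hG.fderiv_self hx]) x
  rw [ellHess, detDeriv_smul, detDeriv_sub, detDeriv_smul, h1, detDeriv_one,
    real_inner_self_eq_norm_sq]
  field_simp
  ring

/-- The terms `rankOne (G x) (ellGrad c x)` and `rankOne (ellGrad c x) (G x)` have equal
contractions and opposite signs. -/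
lemma detDeriv_fderiv_flux (hG : IsCapField c G Ω) {x : CapSpace n} (hx : x ∈ Ω) (t : ℝ) :
    detDeriv (1 + t • fderiv ℝ G x) (fderiv ℝ (flux c G) x) = fluxDiv c G t x := by
  rw [(hG.hasFDerivAt_flux hx).fderiv, detDeriv_sub, detDeriv_add, detDeriv_add, detDeriv_smul,
    detDeriv_smul, hG.detDeriv_ellHess hx,
    detDeriv_rankOne_comm (hG.symm_one_add_smul hx t) (ellGrad c x), fluxDiv]
  ring

/-- The cofactor identity for `id + t G`, tested with `φ • flux`. The term containing `g`, the
gradient of `φ`, will carry the boundary contribution. -/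
theorem integral_fluxDiv_add (hG : IsCapField c G Ω) {K : Set (CapSpace n)} (hK : IsCompact K)
    (hKΩ : K ⊆ Ω) : ∃ δ : ℝ, 0 < δ ∧ ∀ t : ℝ, |t| < δ →
      (∀ x ∈ K, (1 + t • fderiv ℝ G x).det ≠ 0) ∧
      ∀ (φ : CapSpace n → ℝ) (g : CapSpace n → CapSpace n), ContDiff ℝ 1 φ → tsupport φ ⊆ K →
        (∀ x ∈ K, HasFDerivAt φ (innerSL ℝ (g x)) x) →
        ∫ x in K, (φ x * fluxDiv c G t x
          + detDeriv (1 + t • fderiv ℝ G x) (rankOne (flux c G x) (g x))) = 0 := by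
  -- `G` is controlled only on `Ω`; `χ • G` is global, compactly supported and has the same
  -- derivative on `K`.
  obtain ⟨χ, hχΩ, hχ, hχs, hχ1⟩ := exists_cutoff hK hG.isOpen hKΩ
  set F : CapSpace n → CapSpace n := fun x => χ x • G x with hF
  have hFc : ContDiff ℝ 1 F := contDiff_smul_of_tsupport_subset hG.isOpen hχ hG.contDiffOn hχΩ
  have hFs : HasCompactSupport F := hχs.smul_right
  have hFK : ∀ x ∈ K, fderiv ℝ F x = fderiv ℝ G x := by
    intro x hx
    refine Filter.EventuallyEq.fderiv_eq ?_
    filter_upwards [hχ1 x hx] with y hy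
    simp only [hF, hy, one_smul]
  obtain ⟨C, hC⟩ := hFc.lipschitzWith_of_hasCompactSupport hFs one_ne_zero
  have hC1 : (0 : ℝ) < C + 1 := by positivity
  -- `C` is a Lipschitz constant of `χ • G`, so `t χ G` is a contraction for these `t`.
  refine ⟨1 / (C + 1), by positivity, fun t ht => ?_⟩
  have hlip : LipschitzWith (‖t‖₊ * C) (fun x => t • F x) := (lipschitzWith_smul t).comp hC
  have hlt : ‖t‖₊ * C < 1 := by
    rw [lt_div_iff₀ hC1] at ht
    rw [← NNReal.coe_lt_coe]
    have : |t| * C < 1 := by nlinarith [abs_nonneg t]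
    simpa using this
  have htF : ∀ x, fderiv ℝ (fun x => t • F x) x = t • fderiv ℝ F x := fun x =>
    ((hFc.differentiable one_ne_zero x).hasFDerivAt.const_smul t).fderiv
  refine ⟨fun x hx => ?_, fun φ g hφ hφK hφg => ?_⟩
  · have := det_one_add_ne_zero (D := fderiv ℝ (fun x => t • F x) x) (c := ((‖t‖₊ * C : ℝ≥0) : ℝ))
      (norm_fderiv_le_of_lipschitz ℝ hlip) (by exact_mod_cast hlt)
    rwa [htF, hFK x hx] at this
  · set Y : CapSpace n → CapSpace n := fun x => φ x • flux c G x with hY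
    have hφs : HasCompactSupport φ := hK.of_isClosed_subset (isClosed_tsupport φ) hφK
    have hYc : ContDiff ℝ 1 Y :=
      contDiff_smul_of_tsupport_subset hG.isOpen hφ hG.contDiffOn_flux (hφK.trans hKΩ)
    have h1 := integral_detDeriv_one_add_fderiv (hFc.const_smul t)
      (hFs.smul_left (f := fun _ => t)) hlip hlt hYc hφs.smul_right
    rw [← setIntegral_eq_integral_of_forall_compl_eq_zero (s := K)] at h1
    · rw [← h1]
      refine setIntegral_congr_fun hK.isClosed.measurableSet fun x hx => ?_
      have h2 : HasFDerivAt Y (φ x • fderiv ℝ (flux c G) x + rankOne (flux c G x) (g x)) x :=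
        (hφg x hx).smul (hG.hasFDerivAt_flux (hKΩ hx)).differentiableAt.hasFDerivAt
      have h3 : fderiv ℝ (t • F) x = t • fderiv ℝ G x := by
        rw [← hFK x hx]; exact htF x
      change _ = detDeriv (1 + fderiv ℝ (t • F) x) (fderiv ℝ Y x)
      rw [h3, h2.fderiv, detDeriv_add, detDeriv_smul, hG.detDeriv_fderiv_flux (hKΩ hx)]
    · intro x hx
      have : x ∉ tsupport Y := fun h => hx (hφK (tsupport_smul_subset_left φ _ h))
      rw [fderiv_eq_zero_of_notMem_tsupport this, detDeriv_zero]

end IsCapField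

end Cone
end Capillary

namespace Capillary

variable {n : ℕ}

/-! ### Minkowski formulas on the cone, by cutoffs collapsing onto its boundary. -/

section Minkowski

open MeasureTheory Set Metric Filter
open scoped NNReal Topology

/-- The part of the closed cone over the cap between the spheres of radii `1` and `2`. -/
def coneShell (n : ℕ) (c : ℝ) : Set (CapSpace n) :=
  {x | (1 ≤ ‖x‖ ∧ ‖x‖ ≤ 2) ∧ 0 ≤ coneFun c x}

lemma isCompact_coneShell (c : ℝ) : IsCompact (coneShell n c) := by
  refine (isCompact_closedBall (0 : CapSpace n) 2).of_isClosed_subset ?_ ?_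
  · exact ((isClosed_le continuous_const continuous_norm).inter
      (isClosed_le continuous_norm continuous_const)).inter
      (isClosed_le continuous_const (continuous_coneFun c))
  · intro x hx
    simpa using hx.1.2

lemma ne_zero_of_mem_coneShell {c : ℝ} {x : CapSpace n} (hx : x ∈ coneShell n c) : x ≠ 0 := by
  rintro rfl
  have := hx.1.1
  rw [norm_zero] at this
  linarith

/-- The cutoff function of the cone at scale `ε`, with radial profile `ψ`. -/
noncomputable def cutoff (c : ℝ) (ψ : ℝ → ℝ) (ε : ℝ) (x : CapSpace n) : ℝ :=
  ψ ‖x‖ * Real.smoothTransition (coneFun c x / ε)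

/-- The boundary layer density of `cutoff`. -/
noncomputable def layer (c : ℝ) (ψ : ℝ → ℝ) (ε : ℝ) (x : CapSpace n) : ℝ :=
  ψ ‖x‖ * (deriv Real.smoothTransition (coneFun c x / ε) / ε)

/-- The gradient of `cutoff`. -/
noncomputable def cutoffGrad (c : ℝ) (ψ : ℝ → ℝ) (ε : ℝ) (x : CapSpace n) : CapSpace n :=
  (deriv ψ ‖x‖ * Real.smoothTransition (coneFun c x / ε) * ‖x‖⁻¹) • x
    + layer c ψ ε x • coneGrad c x

lemma continuous_det : Continuous fun A : CapSpace n →L[ℝ] CapSpace n => A.det := by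
  simp only [← det_mat]
  exact continuous_mat.matrix_det

lemma continuousOn_detDeriv {s : Set (CapSpace n)}
    {M B : CapSpace n → CapSpace n →L[ℝ] CapSpace n} (hM : ContinuousOn M s)
    (hB : ContinuousOn B s) : ContinuousOn (fun x => detDeriv (M x) (B x)) s :=
  Continuous.comp_continuousOn (f := fun x => (M x, B x)) continuous_detDeriv (hM.prodMk hB)

lemma continuousOn_rankOne {s : Set (CapSpace n)} {a b : CapSpace n → CapSpace n}
    (ha : ContinuousOn a s) (hb : ContinuousOn b s) :
    ContinuousOn (fun x => rankOne (a x) (b x)) s :=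
  Continuous.comp_continuousOn (f := fun x => (a x, b x)) continuous_rankOne (ha.prodMk hb)

lemma continuousOn_det {s : Set (CapSpace n)} {M : CapSpace n → CapSpace n →L[ℝ] CapSpace n}
    (hM : ContinuousOn M s) : ContinuousOn (fun x => (M x).det) s :=
  Continuous.comp_continuousOn (f := M) continuous_det hM

section

variable {c : ℝ} {ψ : ℝ → ℝ} {ε : ℝ}

lemma hasFDerivAt_cutoff (hψ : ContDiff ℝ 1 ψ) {x : CapSpace n} (hx : x ≠ 0) :
    HasFDerivAt (cutoff c ψ ε) (innerSL ℝ (cutoffGrad c ψ ε x)) x := by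
  have h1 : HasFDerivAt (fun y : CapSpace n => ψ ‖y‖)
      (deriv ψ ‖x‖ • innerSL ℝ (‖x‖⁻¹ • x)) x :=
    ((hψ.differentiable one_ne_zero ‖x‖).hasDerivAt).comp_hasFDerivAt x (hasFDerivAt_norm hx)
  have h2 : HasDerivAt Real.smoothTransition
      (deriv Real.smoothTransition (coneFun c x / ε)) (coneFun c x / ε) :=
    ((Real.smoothTransition.contDiff (n := 1)).differentiable (by simp) _).hasDerivAt
  have h3 : HasFDerivAt (fun y : CapSpace n => coneFun c y / ε)
      (ε⁻¹ • innerSL ℝ (coneGrad c x)) x := by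
    simp only [div_eq_inv_mul]
    exact (hasFDerivAt_coneFun c hx).const_mul ε⁻¹
  refine (h1.mul (h2.comp_hasFDerivAt x h3)).congr_fderiv ?_
  ext1 v
  simp [cutoffGrad, layer]
  ring

lemma support_cutoff_subset (hψ0 : ∀ r, r ∉ Icc (1 : ℝ) 2 → ψ r = 0) (hε : 0 < ε) :
    tsupport (cutoff (n := n) c ψ ε) ⊆ coneShell n c := by
  refine closure_minimal (fun x hx => ?_) (isCompact_coneShell c).isClosed
  constructor
  · by_contra h
    exact hx (by simp only [cutoff]; rw [hψ0 _ h, zero_mul])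
  · by_contra h
    refine hx ?_
    simp only [cutoff]
    rw [Real.smoothTransition.zero_of_nonpos, mul_zero]
    exact div_nonpos_of_nonpos_of_nonneg (not_le.1 h).le hε.le

lemma contDiff_cutoff (hψ : ContDiff ℝ 1 ψ) (hψ0 : ∀ r, r ∉ Icc (1 : ℝ) 2 → ψ r = 0)
    (hε : 0 < ε) : ContDiff ℝ 1 (cutoff (n := n) c ψ ε) := by
  rw [contDiff_iff_contDiffAt]
  intro x
  by_cases hx : x = 0
  · refine (contDiffAt_const (c := (0 : ℝ))).congr_of_eventuallyEq ?_
    have : x ∉ coneShell n c := fun h => ne_zero_of_mem_coneShell h hx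
    filter_upwards [(isCompact_coneShell c).isClosed.isOpen_compl.mem_nhds this] with y hy
    exact image_eq_zero_of_notMem_tsupport fun h => hy (support_cutoff_subset hψ0 hε h)
  · exact (hψ.contDiffAt.comp x (contDiffAt_norm ℝ hx)).mul
      (Real.smoothTransition.contDiffAt.comp x ((contDiffAt_coneFun c hx).div_const ε))

lemma layer_nonneg (hψn : ∀ r, 0 ≤ ψ r) (hε : 0 < ε) (x : CapSpace n) : 0 ≤ layer c ψ ε x :=
  mul_nonneg (hψn _) (div_nonneg (Real.smoothTransition.monotone.deriv_nonneg) hε.le)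

lemma layer_eq_zero (hε : 0 < ε) {x : CapSpace n} (hx : ε < coneFun c x) :
    layer c ψ ε x = 0 := by
  have : deriv Real.smoothTransition (coneFun c x / ε) = 0 := by
    have h1 : Real.smoothTransition =ᶠ[𝓝 (coneFun c x / ε)] fun _ => (1 : ℝ) := by
      filter_upwards [lt_mem_nhds ((one_lt_div hε).2 hx)] with y hy
      exact Real.smoothTransition.one_of_one_le hy.le
    rw [h1.deriv_eq, deriv_const]
  simp [layer, this]

lemma continuous_layer (hψ : ContDiff ℝ 1 ψ) : Continuous (layer (n := n) c ψ ε) := by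
  have h1 : Continuous (deriv Real.smoothTransition) :=
    (Real.smoothTransition.contDiff (n := 1)).continuous_deriv (by simp)
  exact (hψ.continuous.comp continuous_norm).mul
    ((h1.comp ((continuous_coneFun c).div_const ε)).div_const ε)

lemma continuousOn_coneGrad (c : ℝ) : ContinuousOn (coneGrad (n := n) c) {x | x ≠ 0} := by
  unfold coneGrad
  intro x hx
  have h0 : ‖x‖ ≠ 0 := norm_ne_zero_iff.2 hx
  exact ContinuousAt.continuousWithinAt (by fun_prop (disch := assumption))

/-- The mass of the boundary layer stays bounded as `ε → 0`. Apply the divergence theorem to `cutoff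
• vert n`: the layer appears with the factor `⟪coneGrad, vert n⟫ ≥ 1 - |c|`, and the remaining term
is at most `|ψ'|`. -/
lemma integral_layer_le (hc : |c| < 1) (hψ : ContDiff ℝ 1 ψ)
    (hψ0 : ∀ r, r ∉ Icc (1 : ℝ) 2 → ψ r = 0) (hψn : ∀ r, 0 ≤ ψ r) :
    ∃ C : ℝ, ∀ ε : ℝ, 0 < ε → ∫ x in coneShell n c, layer c ψ ε x ≤ C := by
  have hK := isCompact_coneShell (n := n) c
  have hκ : 0 < 1 - |c| := by linarith
  refine ⟨(∫ x in coneShell n c, |deriv ψ ‖x‖|) / (1 - |c|), fun ε hε => ?_⟩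
  rw [le_div_iff₀ hκ]
  have h0 : ∫ x in coneShell n c, ⟪cutoffGrad c ψ ε x, vert n⟫ = 0 := by
    have hφ := contDiff_cutoff (n := n) (c := c) hψ hψ0 hε
    have hφK := support_cutoff_subset (n := n) (c := c) (ψ := ψ) hψ0 hε
    have hφs : HasCompactSupport (cutoff (n := n) c ψ ε) :=
      hK.of_isClosed_subset (isClosed_tsupport _) hφK
    set Y : CapSpace n → CapSpace n := fun y => cutoff c ψ ε y • vert n with hY
    set F : CapSpace n → CapSpace n := fun _ => 0 with hF
    have hFs : HasCompactSupport F := HasCompactSupport.zero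
    -- For `F = 0` this is the divergence theorem.
    have h1 := integral_detDeriv_one_add_fderiv (F := F) (Y := Y) contDiff_const
      hFs (c := 0) (LipschitzWith.const _) (by norm_num)
      (hφ.smul contDiff_const) hφs.smul_right
    have hF0 : ∀ x, fderiv ℝ F x = 0 := fun x => by simp [hF]
    simp only [hF0, add_zero] at h1
    rw [← setIntegral_eq_integral_of_forall_compl_eq_zero (s := coneShell n c)] at h1
    · rw [← h1]
      refine setIntegral_congr_fun hK.isClosed.measurableSet fun x hx => ?_
      have h2 : HasFDerivAt Y (rankOne (vert n) (cutoffGrad c ψ ε x)) x :=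
        (hasFDerivAt_cutoff hψ (ne_zero_of_mem_coneShell hx)).smul_const (vert n)
      rw [h2.fderiv, detDeriv_rankOne_of_fixed (by simp) (by simp), det_one, one_mul]
    · intro x hx
      have : x ∉ tsupport Y := fun h => hx (hφK (tsupport_smul_subset_left _ _ h))
      rw [fderiv_eq_zero_of_notMem_tsupport this, detDeriv_zero]
  have hd : Continuous fun x : CapSpace n => |deriv ψ ‖x‖| :=
    ((hψ.continuous_deriv le_rfl).comp continuous_norm).abs
  have hlc : Continuous (layer (n := n) c ψ ε) := continuous_layer hψ
  have hgc : ContinuousOn (fun x : CapSpace n => ⟪cutoffGrad c ψ ε x, vert n⟫)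
      (coneShell n c) := by
    refine ContinuousOn.inner ?_ continuousOn_const
    have h1 : ContinuousOn (fun x : CapSpace n => deriv ψ ‖x‖ *
        Real.smoothTransition (coneFun c x / ε) * ‖x‖⁻¹) (coneShell n c) :=
      (((hψ.continuous_deriv le_rfl).comp continuous_norm).mul
        (Real.smoothTransition.continuous.comp
          ((continuous_coneFun c).div_const ε))).continuousOn.mul
        (continuous_norm.continuousOn.inv₀ fun x hx =>
          norm_ne_zero_iff.2 (ne_zero_of_mem_coneShell hx))
    have h2 : ContinuousOn (coneGrad (n := n) c) (coneShell n c) :=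
      (continuousOn_coneGrad c).mono fun x hx => ne_zero_of_mem_coneShell hx
    exact (h1.smul continuousOn_id).add (hlc.continuousOn.smul h2)
  rw [← integral_mul_const, ← sub_nonneg, ← integral_sub]
  · have h7 : ∫ x in coneShell n c, -⟪cutoffGrad c ψ ε x, vert n⟫ = 0 := by
      rw [integral_neg, h0, neg_zero]
    refine h7.symm.le.trans (setIntegral_mono_on
      (hgc.neg.integrableOn_compact hK)
      ((hd.sub (hlc.mul continuous_const)).continuousOn.integrableOn_compact hK)
      hK.isClosed.measurableSet fun x hx => ?_)
    have hxn := ne_zero_of_mem_coneShell hx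
    have h0 : 0 < ‖x‖ := norm_pos_iff.2 hxn
    have hab : |⟪x, vert n⟫| ≤ ‖x‖ := by
      simpa [norm_vert] using abs_real_inner_le_norm x (vert n)
    have hu : |‖x‖⁻¹ * ⟪x, vert n⟫| ≤ 1 := by
      rw [abs_mul, abs_inv, abs_norm, inv_mul_le_iff₀ h0, mul_one]; exact hab
    set u := ‖x‖⁻¹ * ⟪x, vert n⟫ with hu_def
    have h3 : ⟪cutoffGrad c ψ ε x, vert n⟫
        = deriv ψ ‖x‖ * Real.smoothTransition (coneFun c x / ε) * u
          + layer c ψ ε x * (1 - c * u) := by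
      rw [cutoffGrad, inner_add_left, inner_smul_left, inner_smul_left, coneGrad, inner_sub_left,
        inner_smul_left, real_inner_self_eq_norm_sq, norm_vert, hu_def]
      simp only [RCLike.conj_to_real]
      ring
    have h4 : -|deriv ψ ‖x‖| ≤ deriv ψ ‖x‖ * Real.smoothTransition (coneFun c x / ε) * u := by
      refine (neg_le_neg ?_).trans (neg_abs_le _)
      rw [abs_mul, abs_mul, abs_of_nonneg (Real.smoothTransition.nonneg _)]
      calc _ ≤ |deriv ψ ‖x‖| * 1 * 1 := by
            gcongr
            exact Real.smoothTransition.le_one _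
        _ = _ := by ring
    have h5 : c * u ≤ |c| := (le_abs_self _).trans (by
      rw [abs_mul]; exact mul_le_of_le_one_right (abs_nonneg _) hu)
    have h6 := mul_le_mul_of_nonneg_left (by linarith : 1 - |c| ≤ 1 - c * u)
      (layer_nonneg (c := c) hψn hε x)
    rw [h3]
    linarith
  · exact hd.continuousOn.integrableOn_compact hK
  · exact (hlc.mul continuous_const).continuousOn.integrableOn_compact hK

end

namespace IsCapField

variable {c : ℝ} {G : CapSpace n → CapSpace n} {Ω : Set (CapSpace n)}

lemma coneShell_subset (hG : IsCapField c G Ω) : coneShell n c ⊆ Ω := fun x hx =>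
  hG.mem x (ne_zero_of_mem_coneShell hx) hx.2

lemma coneGrad_ne_zero (hc : |c| < 1) {x : CapSpace n} (hx : x ≠ 0) : coneGrad c x ≠ 0 := by
  intro h
  have h1 : vert n = (c * ‖x‖⁻¹) • x := sub_eq_zero.1 h
  have h2 := congrArg norm h1
  rw [norm_vert, norm_smul, norm_mul, norm_inv, norm_norm, mul_assoc,
    inv_mul_cancel₀ (norm_ne_zero_iff.2 hx), mul_one, Real.norm_eq_abs] at h2
  linarith

lemma continuousOn_one_add_smul_fderiv (hG : IsCapField c G Ω) (t : ℝ) :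
    ContinuousOn (fun x => 1 + t • fderiv ℝ G x) Ω := by
  have h : Continuous fun A : CapSpace n →L[ℝ] CapSpace n => 1 + t • A := by fun_prop
  exact h.comp_continuousOn hG.continuousOn_fderiv

lemma continuousOn_inner_self (hG : IsCapField c G Ω) : ContinuousOn (fun x => ⟪G x, x⟫) Ω :=
  ContinuousOn.inner hG.contDiffOn.continuousOn continuousOn_id

lemma continuousOn_norm_inv (hG : IsCapField c G Ω) :
    ContinuousOn (fun x : CapSpace n => ‖x‖⁻¹) Ω :=
  continuous_norm.continuousOn.inv₀ fun _ hx => norm_ne_zero_iff.2 (hG.ne_zero hx)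

lemma continuousOn_fluxDiv (hG : IsCapField c G Ω) (t : ℝ) : ContinuousOn (fluxDiv c G t) Ω := by
  have hM := hG.continuousOn_one_add_smul_fderiv t
  have hD : ContinuousOn (fun x => detDeriv (1 + t • fderiv ℝ G x) (fderiv ℝ G x)) Ω :=
    continuousOn_detDeriv hM hG.continuousOn_fderiv
  have hdet : ContinuousOn (fun x => (1 + t • fderiv ℝ G x).det) Ω :=
    continuousOn_det hM
  have hL : ContinuousOn (coneEll (n := n) c) Ω := (continuous_coneEll c).continuousOn
  have h1 := hG.continuousOn_inner_self
  have h2 := hG.continuousOn_norm_inv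
  unfold fluxDiv
  exact (hL.mul hD).sub ((h1.mul h2).mul
    ((continuousOn_const.mul hdet).sub (continuousOn_const.mul hD)))

/-- The radial part of the cutoff gradient contributes nothing, because `x` is fixed by `1 + t DG`
and orthogonal to the flux. The layer part has density `γ`, which vanishes on the boundary because
there the conormal is an eigenvector orthogonal to the flux. Bounded layer mass then makes the
boundary term tend to zero. -/
theorem integral_fluxDiv_eq_zero (hG : IsCapField c G Ω) (hc : |c| < 1) :
    ∃ δ : ℝ, 0 < δ ∧ ∀ t : ℝ, |t| < δ →
      (∀ x ∈ coneShell n c, (1 + t • fderiv ℝ G x).det ≠ 0) ∧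
      ∀ ψ : ℝ → ℝ, ContDiff ℝ 1 ψ → (∀ r, r ∉ Icc (1 : ℝ) 2 → ψ r = 0) → (∀ r, 0 ≤ ψ r) →
        ∫ x in coneShell n c ∩ {x | 0 < coneFun c x}, ψ ‖x‖ * fluxDiv c G t x = 0 := by
  have hK := isCompact_coneShell (n := n) c
  have hKm := hK.isClosed.measurableSet
  have hKΩ := hG.coneShell_subset
  obtain ⟨δ, hδ, H⟩ := hG.integral_fluxDiv_add hK hKΩ
  refine ⟨δ, hδ, fun t ht => ⟨(H t ht).1, fun ψ hψ hψ0 hψn => ?_⟩⟩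
  obtain ⟨hdet, H⟩ := H t ht
  obtain ⟨C, hC⟩ := integral_layer_le (n := n) hc hψ hψ0 hψn
  set γ : CapSpace n → ℝ := fun x =>
    detDeriv (1 + t • fderiv ℝ G x) (rankOne (flux c G x) (coneGrad c x)) with hγ
  have hγc : ContinuousOn γ (coneShell n c) := by
    have hM := hG.continuousOn_one_add_smul_fderiv t
    exact continuousOn_detDeriv (hM.mono hKΩ) (continuousOn_rankOne
      (hG.contDiffOn_flux.continuousOn.mono hKΩ)
      ((continuousOn_coneGrad c).mono fun x hx => ne_zero_of_mem_coneShell hx))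
  have hγ0 : ∀ x ∈ coneShell n c, coneFun c x = 0 → γ x = 0 := by
    intro x hx hx0
    have hxn := ne_zero_of_mem_coneShell hx
    obtain ⟨β, hβ⟩ := hG.exists_eigenvalue_of_boundary hxn hx0 (coneGrad_ne_zero hc hxn)
    refine detDeriv_rankOne_eq_zero_of_eigenvector (hG.symm_one_add_smul (hKΩ hx) t)
      (hdet x hx) (β := 1 + t * β) ?_ (hG.inner_coneGrad_flux hxn hx0)
    simp [hβ, add_smul, mul_smul]
  have hPc : ContinuousOn (fluxDiv c G t) (coneShell n c) := (hG.continuousOn_fluxDiv t).mono hKΩ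
  have hφc : ∀ ε : ℝ, Continuous (cutoff (n := n) c ψ ε) := fun ε =>
    (hψ.continuous.comp continuous_norm).mul
      (Real.smoothTransition.continuous.comp ((continuous_coneFun c).div_const ε))
  have h1 : ∀ ε : ℝ, 0 < ε → ∫ x in coneShell n c, cutoff c ψ ε x * fluxDiv c G t x
      = - ∫ x in coneShell n c, layer c ψ ε x * γ x := by
    intro ε hε
    have h2 := H (cutoff c ψ ε) (cutoffGrad c ψ ε) (contDiff_cutoff hψ hψ0 hε)
      (support_cutoff_subset hψ0 hε) fun x hx =>
        hasFDerivAt_cutoff hψ (ne_zero_of_mem_coneShell hx)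
    rw [← add_eq_zero_iff_eq_neg, ← integral_add]
    · rw [← h2]
      refine setIntegral_congr_fun hKm fun x hx => ?_
      have hxn := ne_zero_of_mem_coneShell hx
      simp only [cutoffGrad, rankOne_add_right, rankOne_smul_right, detDeriv_add, detDeriv_smul]
      rw [detDeriv_rankOne_of_fixed (hG.symm_one_add_smul (hKΩ hx) t)
        (b := x) (by simp [hG.fderiv_self (hKΩ hx)]), inner_self_flux c G hxn]
      ring
    · exact ((hφc ε).continuousOn.mul hPc).integrableOn_compact hK
    · exact ((continuous_layer hψ).continuousOn.mul hγc).integrableOn_compact hK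
  have h2 : ∀ α : ℝ, 0 < α → ∃ ε₀ : ℝ, 0 < ε₀ ∧ ∀ ε : ℝ, 0 < ε → ε < ε₀ →
      |∫ x in coneShell n c, cutoff c ψ ε x * fluxDiv c G t x| ≤ α * C := by
    intro α hα
    -- By compactness `coneFun` has a positive minimum on `{|γ| ≥ α}`; below that height `|γ| < α`.
    obtain ⟨ε₀, hε₀, hsmall⟩ : ∃ ε₀ : ℝ, 0 < ε₀ ∧ ∀ x ∈ coneShell n c, coneFun c x < ε₀ →
        |γ x| ≤ α := by
      have hcl : IsCompact (coneShell n c ∩ (fun x => |γ x|) ⁻¹' Ici α) :=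
        hK.of_isClosed_subset (hγc.abs.preimage_isClosed_of_isClosed hK.isClosed isClosed_Ici)
          inter_subset_left
      rcases (coneShell n c ∩ (fun x => |γ x|) ⁻¹' Ici α).eq_empty_or_nonempty with he | hne
      · refine ⟨1, one_pos, fun x hx _ => ?_⟩
        by_contra! hlt
        exact (eq_empty_iff_forall_notMem.1 he x) ⟨hx, hlt.le⟩
      · obtain ⟨x₀, hx₀, hmin⟩ := hcl.exists_isMinOn hne (continuous_coneFun c).continuousOn
        refine ⟨coneFun c x₀, ?_, fun x hx hlt => ?_⟩
        · refine lt_of_le_of_ne hx₀.1.2 fun h => ?_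
          have h3 : α ≤ |γ x₀| := hx₀.2
          rw [hγ0 x₀ hx₀.1 h.symm, abs_zero] at h3
          linarith
        · by_contra! hlt'
          have := hmin (show x ∈ _ from ⟨hx, hlt'.le⟩)
          exact absurd this (not_le.2 hlt)
    refine ⟨ε₀, hε₀, fun ε hε hlt => ?_⟩
    rw [h1 ε hε, abs_neg]
    have hli : IntegrableOn (layer (n := n) c ψ ε) (coneShell n c) :=
      (continuous_layer hψ).continuousOn.integrableOn_compact hK
    calc |∫ x in coneShell n c, layer c ψ ε x * γ x|
        ≤ ∫ x in coneShell n c, |layer c ψ ε x * γ x| := abs_integral_le_integral_abs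
      _ ≤ ∫ x in coneShell n c, α * layer c ψ ε x := by
        refine setIntegral_mono_on ?_ (hli.const_mul α) hKm fun x hx => ?_
        · exact ((continuous_layer hψ).continuousOn.mul hγc).abs.integrableOn_compact hK
        · by_cases h : ε < coneFun c x
          · rw [layer_eq_zero hε h]; simp
          · rw [abs_mul, abs_of_nonneg (layer_nonneg hψn hε x), mul_comm]
            exact mul_le_mul_of_nonneg_right (hsmall x hx (by linarith))
              (layer_nonneg hψn hε x)
      _ = α * ∫ x in coneShell n c, layer c ψ ε x := integral_const_mul _ _
      _ ≤ α * C := by gcongr; exact hC ε hε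
  -- Along `ε = 1 / (m + 1)` the cutoffs converge pointwise to the indicator of the open cone times
  -- `ψ ‖x‖`.
  have hlim : Tendsto (fun m : ℕ => ∫ x in coneShell n c,
      cutoff c ψ (1 / ((m : ℝ) + 1)) x * fluxDiv c G t x) atTop
      (𝓝 (∫ x in coneShell n c,
        {x | 0 < coneFun c x}.indicator (fun x => ψ ‖x‖ * fluxDiv c G t x) x)) := by
    refine tendsto_integral_of_dominated_convergence (fun x => ψ ‖x‖ * |fluxDiv c G t x|)
      (fun m => ?_) ?_ (fun m => ?_) ?_
    · exact (((hφc _).continuousOn.mul hPc).integrableOn_compact hK).aestronglyMeasurable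
    · exact ((hψ.continuous.comp continuous_norm).continuousOn.mul
        hPc.abs).integrableOn_compact hK
    · refine Eventually.of_forall fun x => ?_
      rw [norm_mul, Real.norm_eq_abs, Real.norm_eq_abs, cutoff, abs_mul, abs_of_nonneg (hψn _),
        abs_of_nonneg (Real.smoothTransition.nonneg _)]
      exact mul_le_mul_of_nonneg_right
        (mul_le_of_le_one_right (hψn _) (Real.smoothTransition.le_one _)) (abs_nonneg _)
    · refine Eventually.of_forall fun x => ?_
      by_cases hx : 0 < coneFun c x
      · rw [indicator_of_mem (show x ∈ {x | 0 < coneFun c x} from hx)]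
        refine tendsto_const_nhds.congr' ?_
        filter_upwards [eventually_ge_atTop ⌈(coneFun c x)⁻¹⌉₊] with m hm
        rw [cutoff, Real.smoothTransition.one_of_one_le, mul_one]
        have h3 : (coneFun c x)⁻¹ ≤ m := (Nat.le_ceil _).trans (by exact_mod_cast hm)
        rw [div_div_eq_mul_div, div_one]
        calc (1 : ℝ) = coneFun c x * (coneFun c x)⁻¹ := (mul_inv_cancel₀ hx.ne').symm
          _ ≤ coneFun c x * (m + 1) := by gcongr; linarith
      · rw [indicator_of_notMem (show x ∉ {x | 0 < coneFun c x} from hx)]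
        refine tendsto_const_nhds.congr fun m => ?_
        rw [cutoff, Real.smoothTransition.zero_of_nonpos, mul_zero, zero_mul]
        exact div_nonpos_of_nonpos_of_nonneg (not_lt.1 hx) (by positivity)
  have hm : MeasurableSet {x : CapSpace n | 0 < coneFun c x} :=
    (isOpen_lt continuous_const (continuous_coneFun c)).measurableSet
  rw [setIntegral_indicator hm] at hlim
  have hε : Tendsto (fun m : ℕ => 1 / ((m : ℝ) + 1)) atTop (𝓝 0) :=
    tendsto_one_div_add_atTop_nhds_zero_nat
  have hbound : ∀ α : ℝ, 0 < α →
      |∫ x in coneShell n c ∩ {x | 0 < coneFun c x}, ψ ‖x‖ * fluxDiv c G t x| ≤ α * C := by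
    intro α hα
    obtain ⟨ε₀, hε₀, h3⟩ := h2 α hα
    refine le_of_tendsto hlim.abs ?_
    filter_upwards [hε.eventually (gt_mem_nhds hε₀)] with m hm
    exact h3 _ (by positivity) hm
  have h4 : Tendsto (fun α : ℝ => α * C) (𝓝[>] 0) (𝓝 (0 * C)) :=
    (tendsto_id.mono_left nhdsWithin_le_nhds).mul_const C
  rw [zero_mul] at h4
  have h5 := ge_of_tendsto h4 (by
    filter_upwards [self_mem_nhdsWithin] with α hα using hbound α hα)
  exact abs_eq_zero.1 (le_antisymm h5 (abs_nonneg _))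

/-- The coefficients of `fluxDiv` as a polynomial in `t`. -/
noncomputable def fluxCoeff (c : ℝ) (G : CapSpace n → CapSpace n) (j : ℕ) (x : CapSpace n) : ℝ :=
  coneEll c x * ((j + 1) * esymOp (j + 1) (fderiv ℝ G x))
    - ⟪G x, x⟫ * ‖x‖⁻¹ * ((n - j) * esymOp j (fderiv ℝ G x))

lemma fluxDiv_eq_sum {t : ℝ} {x : CapSpace n} (hdet : (1 + t • fderiv ℝ G x).det ≠ 0) :
    fluxDiv c G t x = ∑ j ∈ Finset.range (n + 2), fluxCoeff c G j x * t ^ j := by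
  -- Closes the index shift: the top term that it introduces vanishes in dimension `n + 1`.
  have htop : esymOp (n + 2) (fderiv ℝ G x) = 0 := by
    rw [esymOp, esymMat, Matrix.coeff_det_one_add_X_smul_eq_sum_minors,
      Finset.powersetCard_eq_empty.2 (by simp), Finset.sum_empty]
  set a : ℕ → ℝ := fun j => esymOp j (fderiv ℝ G x) with ha
  have h1 : ∑ j ∈ Finset.range (n + 2), (j : ℝ) * a j * t ^ (j - 1)
      = ∑ j ∈ Finset.range (n + 2), (((j : ℝ) + 1) * a (j + 1)) * t ^ j := by
    rw [Finset.sum_range_succ', Finset.sum_range_succ _ (n + 1)]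
    have : a (n + 1 + 1) = 0 := htop
    simp [this]
  have h2 : t * ∑ j ∈ Finset.range (n + 2), (j : ℝ) * a j * t ^ (j - 1)
      = ∑ j ∈ Finset.range (n + 2), (j * a j) * t ^ j := by
    rw [Finset.mul_sum]
    refine Finset.sum_congr rfl fun j _ => ?_
    cases j with
    | zero => simp
    | succ j => rw [Nat.add_sub_cancel, pow_succ]; ring
  rw [fluxDiv, detDeriv_one_add_smul_self hdet, det_one_add_smul_eq_sum, h2, h1,
    Finset.mul_sum, Finset.mul_sum, ← Finset.sum_sub_distrib, Finset.mul_sum,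
    ← Finset.sum_sub_distrib]
  refine Finset.sum_congr rfl fun j _ => ?_
  simp only [fluxCoeff, ha]
  ring

lemma continuousOn_esymOp (hG : IsCapField c G Ω) (j : ℕ) :
    ContinuousOn (fun x => esymOp j (fderiv ℝ G x)) Ω :=
  (continuous_esymOp j).comp_continuousOn hG.continuousOn_fderiv

lemma continuousOn_fluxCoeff (hG : IsCapField c G Ω) (j : ℕ) :
    ContinuousOn (fluxCoeff c G j) Ω := by
  unfold fluxCoeff
  exact ((continuous_coneEll c).continuousOn.mul
    (continuousOn_const.mul (hG.continuousOn_esymOp _))).sub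
    ((hG.continuousOn_inner_self.mul hG.continuousOn_norm_inv).mul
      (continuousOn_const.mul (hG.continuousOn_esymOp _)))

/-- The capillary Minkowski formulas, integrated over the cone with a radial weight. -/
theorem integral_fluxCoeff_eq_zero (hG : IsCapField c G Ω) (hc : |c| < 1) {ψ : ℝ → ℝ}
    (hψ : ContDiff ℝ 1 ψ) (hψ0 : ∀ r, r ∉ Icc (1 : ℝ) 2 → ψ r = 0) (hψn : ∀ r, 0 ≤ ψ r)
    {j : ℕ} (hj : j ≤ n) :
    ∫ x in coneShell n c ∩ {x | 0 < coneFun c x}, ψ ‖x‖ * fluxCoeff c G j x = 0 := by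
  have hK := isCompact_coneShell (n := n) c
  have hm : MeasurableSet (coneShell n c ∩ {x : CapSpace n | 0 < coneFun c x}) :=
    hK.isClosed.measurableSet.inter
      (isOpen_lt continuous_const (continuous_coneFun c)).measurableSet
  obtain ⟨δ, hδ, H⟩ := hG.integral_fluxDiv_eq_zero hc
  refine eq_zero_of_sum_mul_pow_eq_zero (N := n + 2) hδ (a := fun j =>
    ∫ x in coneShell n c ∩ {x | 0 < coneFun c x}, ψ ‖x‖ * fluxCoeff c G j x)
    (fun t ht => ?_) j (by omega)
  obtain ⟨hdet, H⟩ := H t ht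
  simp only [← integral_mul_const]
  rw [← integral_finsetSum]
  · refine Eq.trans (setIntegral_congr_fun hm fun x hx => ?_) (H ψ hψ hψ0 hψn)
    rw [fluxDiv_eq_sum (hdet x hx.1), Finset.mul_sum]
    exact Finset.sum_congr rfl fun j _ => by ring
  · intro j _
    refine IntegrableOn.mono_set (t := coneShell n c) ?_ inter_subset_left
    have h1 : ContinuousOn (fun x : CapSpace n => ψ ‖x‖) (coneShell n c) :=
      (hψ.continuous.comp continuous_norm).continuousOn
    exact ((h1.mul ((hG.continuousOn_fluxCoeff j).mono hG.coneShell_subset)).mul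
      continuousOn_const).integrableOn_compact hK

end IsCapField

end Minkowski
end Capillary

namespace Capillary

variable {n : ℕ}

/-! ### Arguments along circles: positivity after translation, and integration of `DG`. -/

section GreatCircles

open Set Real

lemma exists_unit_orthogonal {F : Type*} [NormedAddCommGroup F] [InnerProductSpace ℝ F]
    [FiniteDimensional ℝ F] (hF : 2 ≤ Module.finrank ℝ F) (p : F) :
    ∃ q : F, ‖q‖ = 1 ∧ ⟪p, q⟫ = 0 := by
  have h1 : Module.finrank ℝ (ℝ ∙ p) ≤ 1 := by
    simpa using finrank_span_le_card (R := ℝ) ({p} : Set F)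
  have h2 := (ℝ ∙ p).finrank_add_finrank_orthogonal
  have h3 : (ℝ ∙ p)ᗮ ≠ ⊥ := by
    intro h
    rw [h, finrank_bot] at h2
    omega
  obtain ⟨w, hw, hw0⟩ := (Submodule.ne_bot_iff _).1 h3
  refine ⟨‖w‖⁻¹ • w, norm_smul_inv_norm hw0, ?_⟩
  rw [inner_smul_right, Submodule.mem_orthogonal_singleton_iff_inner_right.1 hw, mul_zero]

lemma exists_angle {F : Type*} [NormedAddCommGroup F] [InnerProductSpace ℝ F]
    [FiniteDimensional ℝ F] (hF : 2 ≤ Module.finrank ℝ F) {p u : F} (hp : ‖p‖ = 1)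
    (hu : ‖u‖ = 1) : ∃ q : F, ‖q‖ = 1 ∧ ⟪p, q⟫ = 0 ∧
      u = cos (arccos ⟪p, u⟫) • p + sin (arccos ⟪p, u⟫) • q := by
  have hb : |⟪p, u⟫| ≤ 1 := by simpa [hp, hu] using abs_real_inner_le_norm p u
  obtain ⟨hb1, hb2⟩ := abs_le.1 hb
  rw [cos_arccos hb1 hb2]
  set b := ⟪p, u⟫ with hbdef
  have hw : ‖u - b • p‖ = sin (arccos b) := by
    rw [sin_arccos, ← Real.sqrt_sq (norm_nonneg (u - b • p))]
    congr 1
    rw [norm_sub_sq_real, norm_smul, hu, hp, inner_smul_right, real_inner_comm, ← hbdef,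
      mul_one, Real.norm_eq_abs, sq_abs]
    ring
  by_cases h0 : sin (arccos b) = 0
  · obtain ⟨q, hq, hpq⟩ := exists_unit_orthogonal hF p
    refine ⟨q, hq, hpq, ?_⟩
    rw [h0, norm_eq_zero, sub_eq_zero] at hw
    rw [h0, zero_smul, add_zero]; exact hw
  · refine ⟨(sin (arccos b))⁻¹ • (u - b • p), ?_, ?_, ?_⟩
    · rw [norm_smul, hw, norm_inv, Real.norm_eq_abs, abs_of_nonneg (by rw [← hw]; positivity),
        inv_mul_cancel₀ h0]
    · rw [inner_smul_right, inner_sub_right, inner_smul_right, real_inner_self_eq_norm_sq, hp,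
        ← hbdef]
      ring
    · rw [smul_smul, mul_inv_cancel₀ h0, one_smul]; abel

/-- The circle of radius `ρ` around `o` in the plane of `p` and `q`. -/
noncomputable def circ (o p q : CapSpace n) (ρ τ : ℝ) : CapSpace n :=
  o + ρ • (cos τ • p + sin τ • q)

/-- The velocity of `circ`. -/
noncomputable def circVel (p q : CapSpace n) (ρ τ : ℝ) : CapSpace n :=
  ρ • ((-sin τ) • p + cos τ • q)

lemma hasDerivAt_circ (o p q : CapSpace n) (ρ τ : ℝ) :
    HasDerivAt (circ o p q ρ) (circVel p q ρ τ) τ :=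
  ((((hasDerivAt_cos τ).smul_const p).add ((hasDerivAt_sin τ).smul_const q)).const_smul ρ).const_add
    o

lemma norm_cos_add_sin_sq {p q : CapSpace n} (hp : ‖p‖ = 1) (hq : ‖q‖ = 1) (hpq : ⟪p, q⟫ = 0)
    (a b : ℝ) : ‖a • p + b • q‖ ^ 2 = a ^ 2 + b ^ 2 := by
  rw [norm_add_sq_real, norm_smul, norm_smul, hp, hq, inner_smul_left, inner_smul_right, hpq]
  simp

lemma circVel_ne_zero {p q : CapSpace n} (hp : ‖p‖ = 1) (hq : ‖q‖ = 1) (hpq : ⟪p, q⟫ = 0)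
    {ρ : ℝ} (hρ : ρ ≠ 0) (τ : ℝ) : circVel p q ρ τ ≠ 0 := by
  intro h
  have h1 := norm_cos_add_sin_sq hp hq hpq (-sin τ) (cos τ)
  rw [circVel, smul_eq_zero] at h
  rw [h.resolve_left hρ, norm_zero] at h1
  nlinarith [sin_sq_add_cos_sq τ]

/-- The base point `x τ₀` is written in the moving frame at `τ`, so that differentiating `⟪G (x τ),
x τ₀⟫` leaves only the velocity component. -/
lemma circ_eq (o p q : CapSpace n) (ρ τ τ₀ : ℝ) :
    circ o p q ρ τ₀ = o + cos (τ₀ - τ) • (circ o p q ρ τ - o) + sin (τ₀ - τ) • circVel p q ρ τ := by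
  have h1 : cos τ₀ = cos (τ₀ - τ) * cos τ - sin (τ₀ - τ) * sin τ := by
    rw [← cos_add]; congr 1; ring
  have h2 : sin τ₀ = sin (τ₀ - τ) * cos τ + cos (τ₀ - τ) * sin τ := by
    rw [← sin_add]; congr 1; ring
  simp only [circ, circVel, h1, h2]
  module

namespace IsCapField

variable {c : ℝ} {G : CapSpace n → CapSpace n} {Ω : Set (CapSpace n)}

lemma inner_fderiv_self (hG : IsCapField c G Ω) {x : CapSpace n} (hx : x ∈ Ω) (v : CapSpace n) :
    ⟪fderiv ℝ G x v, x⟫ = 0 := by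
  rw [hG.symm x hx, hG.fderiv_self hx, inner_zero_right]

/-- Monotonicity of the support of a tangent plane along a circle. -/
lemma hasDerivAt_inner_circ (hG : IsCapField c G Ω) {o p q : CapSpace n} {ρ τ : ℝ}
    (hx : circ o p q ρ τ ∈ Ω) (ho : ⟪fderiv ℝ G (circ o p q ρ τ) (circVel p q ρ τ), o⟫ = 0)
    (τ₀ : ℝ) : HasDerivAt (fun τ => ⟪G (circ o p q ρ τ), circ o p q ρ τ₀⟫)
      (sin (τ₀ - τ) * ⟪fderiv ℝ G (circ o p q ρ τ) (circVel p q ρ τ), circVel p q ρ τ⟫) τ := by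
  have h1 : HasDerivAt (fun τ => G (circ o p q ρ τ))
      (fderiv ℝ G (circ o p q ρ τ) (circVel p q ρ τ)) τ :=
    (hG.hasFDerivAt hx).comp_hasDerivAt τ (hasDerivAt_circ o p q ρ τ)
  have h2 := h1.inner ℝ (hasDerivAt_const τ (circ o p q ρ τ₀))
  refine h2.congr_deriv ?_
  rw [inner_zero_right, zero_add]
  conv_lhs => rw [circ_eq o p q ρ τ τ₀]
  rw [inner_add_right, inner_add_right, inner_smul_right, inner_smul_right, inner_sub_right, ho,
    hG.inner_fderiv_self hx]
  ring

end IsCapField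

lemma inner_vert_vert : ⟪vert n, vert n⟫ = 1 := by
  rw [real_inner_self_eq_norm_sq, norm_vert, one_pow]

/-- Unit vectors of the closed cone. -/
def unitCap (n : ℕ) (c : ℝ) : Set (CapSpace n) := {x | ‖x‖ = 1 ∧ 0 ≤ coneFun c x}

lemma ne_zero_of_mem_unitCap {c : ℝ} {x : CapSpace n} (hx : x ∈ unitCap n c) : x ≠ 0 := by
  rintro rfl
  simpa using hx.1

section

variable {θ : ℝ}

lemma exists_meridian (hn : 2 ≤ n) (hθ0 : 0 < θ) (hθπ : θ < π) {x : CapSpace n}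
    (hx : x ∈ unitCap n (cos θ)) : ∃ r ∈ Icc 0 θ, ∃ q : CapSpace n, ‖q‖ = 1 ∧
      ⟪vert n, q⟫ = 0 ∧ x = circ 0 (vert n) q 1 r := by
  obtain ⟨q, hq, hvq, h⟩ := exists_angle (F := CapSpace n) (by simp; omega) norm_vert hx.1
  refine ⟨arccos ⟪vert n, x⟫, ⟨arccos_nonneg _, ?_⟩, q, hq, hvq, by simpa [circ] using h⟩
  have h1 : cos θ ≤ ⟪vert n, x⟫ := by
    have := hx.2
    rw [coneFun, hx.1] at this
    linarith
  rw [← arccos_cos hθ0.le hθπ.le]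
  exact antitone_arccos h1

lemma coneFun_meridian {q : CapSpace n} (hq : ‖q‖ = 1) (hvq : ⟪vert n, q⟫ = 0) (r : ℝ) :
    ‖circ 0 (vert n) q 1 r‖ = 1 ∧ coneFun (cos θ) (circ 0 (vert n) q 1 r) = cos r - cos θ := by
  have h1 : ‖circ 0 (vert n) q 1 r‖ = 1 := by
    have := norm_cos_add_sin_sq norm_vert hq hvq (cos r) (sin r)
    rw [cos_sq_add_sin_sq] at this
    simpa [circ] using (pow_eq_one_iff_of_nonneg (norm_nonneg _) two_ne_zero).1 this
  refine ⟨h1, ?_⟩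
  rw [coneFun, h1]
  simp [circ, inner_add_right, inner_smul_right, hvq, norm_vert]

lemma meridian_mem (hθπ : θ < π) {q : CapSpace n} (hq : ‖q‖ = 1) (hvq : ⟪vert n, q⟫ = 0)
    {r : ℝ} (hr : r ∈ Icc 0 θ) : circ 0 (vert n) q 1 r ∈ unitCap n (cos θ) := by
  obtain ⟨h1, h2⟩ := coneFun_meridian (θ := θ) hq hvq r
  refine ⟨h1, ?_⟩
  rw [h2, sub_nonneg]
  exact cos_le_cos_of_nonneg_of_le_pi hr.1 hθπ.le hr.2

lemma coneFun_parallel {ω : CapSpace n} (hω : ‖ω‖ = 1)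
    (hvω : ⟪vert n, ω⟫ = 0) : ‖cos θ • vert n + sin θ • ω‖ = 1 ∧
      coneFun (cos θ) (cos θ • vert n + sin θ • ω) = 0 := by
  obtain ⟨h1, h2⟩ := coneFun_meridian (θ := θ) hω hvω θ
  simpa [circ] using And.intro h1 h2

lemma exists_parallel (hθ0 : 0 < θ) (hθπ : θ < π) {x : CapSpace n} (hx1 : ‖x‖ = 1)
    (hx : coneFun (cos θ) x = 0) : ∃ ω : CapSpace n, ‖ω‖ = 1 ∧ ⟪vert n, ω⟫ = 0 ∧
      x = cos θ • vert n + sin θ • ω := by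
  have hs : 0 < sin θ := sin_pos_of_pos_of_lt_pi hθ0 hθπ
  have hvx : ⟪vert n, x⟫ = cos θ := by
    rw [coneFun, hx1] at hx; linarith
  have hn : ‖x - cos θ • vert n‖ = sin θ := by
    rw [← Real.sqrt_sq (norm_nonneg (x - cos θ • vert n)), ← Real.sqrt_sq hs.le]
    congr 1
    rw [norm_sub_sq_real, norm_smul, hx1, norm_vert, inner_smul_right, real_inner_comm, hvx,
      mul_one, Real.norm_eq_abs, sq_abs]
    nlinarith [sin_sq_add_cos_sq θ]
  refine ⟨(sin θ)⁻¹ • (x - cos θ • vert n), ?_, ?_, ?_⟩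
  · rw [norm_smul, hn, norm_inv, Real.norm_eq_abs, abs_of_pos hs, inv_mul_cancel₀ hs.ne']
  · rw [inner_smul_right, inner_sub_right, inner_smul_right, inner_vert_vert, hvx]
    ring
  · rw [smul_smul, mul_inv_cancel₀ hs.ne', one_smul]; abel

namespace IsCapField

variable {G : CapSpace n → CapSpace n} {Ω : Set (CapSpace n)}

lemma mem_of_unitCap (hG : IsCapField (cos θ) G Ω) {x : CapSpace n}
    (hx : x ∈ unitCap n (cos θ)) : x ∈ Ω := hG.mem x (ne_zero_of_mem_unitCap hx) hx.2

/-- Positivity of the Hessian on tangent vectors. -/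
def IsPosDef (c : ℝ) (G : CapSpace n → CapSpace n) : Prop :=
  ∀ x ∈ unitCap n c, ∀ v : CapSpace n, v ≠ 0 → ⟪x, v⟫ = 0 → 0 < ⟪fderiv ℝ G x v, v⟫

/-- Move from `y` to `z` along a circle in the boundary sphere at height `cos θ`. There `G` stays
horizontal, so its derivative is orthogonal to the centre of the circle and `⟪G (x τ), z⟫` strictly
increases. -/
lemma inner_lt_of_boundary (hn : 2 ≤ n) (hθ0 : 0 < θ) (hθπ : θ < π)
    (hG : IsCapField (cos θ) G Ω) (hpos : IsPosDef (cos θ) G) {y z : CapSpace n} (hy1 : ‖y‖ = 1)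
    (hz1 : ‖z‖ = 1) (hy : coneFun (cos θ) y = 0) (hz : coneFun (cos θ) z = 0) (hyz : y ≠ z) :
    ⟪G y, z⟫ < ⟪G z, z⟫ := by
  have hs : 0 < sin θ := sin_pos_of_pos_of_lt_pi hθ0 hθπ
  obtain ⟨ω, hω, hvω, rfl⟩ := exists_parallel hθ0 hθπ hy1 hy
  obtain ⟨η, hη, hvη, rfl⟩ := exists_parallel hθ0 hθπ hz1 hz
  have hωη : ω ≠ η := by rintro rfl; exact hyz rfl
  set S : Submodule ℝ (CapSpace n) := (ℝ ∙ vert n)ᗮ with hS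
  have hmem : ∀ w, w ∈ S ↔ ⟪vert n, w⟫ = 0 := fun w =>
    Submodule.mem_orthogonal_singleton_iff_inner_right
  have hSn : 2 ≤ Module.finrank ℝ S := by
    have h1 : Module.finrank ℝ (ℝ ∙ vert n) ≤ 1 := by
      simpa using finrank_span_le_card (R := ℝ) ({vert n} : Set (CapSpace n))
    have h2 := (ℝ ∙ vert n).finrank_add_finrank_orthogonal
    rw [finrank_euclideanSpace_fin, ← hS] at h2
    omega
  obtain ⟨⟨q, hqS⟩, hq, hpq, h⟩ := exists_angle (F := S) hSn (p := ⟨ω, (hmem _).2 hvω⟩)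
    (u := ⟨η, (hmem _).2 hvη⟩) hω hη
  have hq : ‖q‖ = 1 := hq
  have hpq : ⟪ω, q⟫ = 0 := hpq
  have hvq : ⟪vert n, q⟫ = 0 := (hmem _).1 hqS
  set τ₀ := arccos ⟪ω, η⟫ with hτ₀
  have h : η = cos τ₀ • ω + sin τ₀ • q := congrArg Subtype.val h
  have hτpos : 0 < τ₀ := by
    rcases (arccos_nonneg ⟪ω, η⟫).lt_or_eq with h' | h'
    · exact h'
    · exfalso
      apply hωη
      rw [h, hτ₀, ← h']
      simp
  have hτπ : τ₀ ≤ π := arccos_le_pi _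
  set x : ℝ → CapSpace n := circ (cos θ • vert n) ω q (sin θ) with hx
  have hu : ∀ τ, ‖cos τ • ω + sin τ • q‖ = 1 := fun τ => by
    have := norm_cos_add_sin_sq hω hq hpq (cos τ) (sin τ)
    rw [cos_sq_add_sin_sq] at this
    exact (pow_eq_one_iff_of_nonneg (norm_nonneg _) two_ne_zero).1 this
  have hxb : ∀ τ, ‖x τ‖ = 1 ∧ coneFun (cos θ) (x τ) = 0 := fun τ =>
    coneFun_parallel (hu τ) (by simp [inner_add_right, inner_smul_right, hvω, hvq])
  have hxm : ∀ τ, x τ ∈ unitCap n (cos θ) := fun τ => ⟨(hxb τ).1, (hxb τ).2.ge⟩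
  have hxΩ : ∀ τ, x τ ∈ Ω := fun τ => hG.mem_of_unitCap (hxm τ)
  have hvel : ∀ τ, ⟪x τ, circVel ω q (sin θ) τ⟫ = 0 := by
    intro τ
    simp only [hx, circ, circVel, inner_add_left, inner_add_right, inner_smul_left,
      inner_smul_right, hvω, hvq, real_inner_self_eq_norm_sq, hω, hq, hpq,
      real_inner_comm ω q, RCLike.conj_to_real]
    ring
  have ho : ∀ τ, ⟪fderiv ℝ G (x τ) (circVel ω q (sin θ) τ), cos θ • vert n⟫ = 0 := by
    intro τ
    have h1 : HasDerivAt (fun τ => G (x τ)) (fderiv ℝ G (x τ) (circVel ω q (sin θ) τ)) τ :=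
      (hG.hasFDerivAt (hxΩ τ)).comp_hasDerivAt τ (hasDerivAt_circ _ _ _ _ τ)
    have h2 := h1.inner ℝ (hasDerivAt_const τ (cos θ • vert n))
    have h3 : (fun τ => ⟪G (x τ), cos θ • vert n⟫) = fun _ => 0 := by
      funext τ
      rw [inner_smul_right, real_inner_comm,
        hG.boundary _ (ne_zero_of_mem_unitCap (hxm τ)) (hxb τ).2, mul_zero]
    rw [h3, inner_zero_right, zero_add] at h2
    exact h2.unique (hasDerivAt_const τ 0)
  have hd : ∀ τ, HasDerivAt (fun τ => ⟪G (x τ), x τ₀⟫) (sin (τ₀ - τ) *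
      ⟪fderiv ℝ G (x τ) (circVel ω q (sin θ) τ), circVel ω q (sin θ) τ⟫) τ := fun τ =>
    hG.hasDerivAt_inner_circ (hxΩ τ) (ho τ) τ₀
  have hmono : StrictMonoOn (fun τ => ⟪G (x τ), x τ₀⟫) (Icc 0 τ₀) := by
    refine strictMonoOn_of_deriv_pos (convex_Icc _ _)
      (fun τ _ => (hd τ).continuousAt.continuousWithinAt) fun τ hτ => ?_
    rw [interior_Icc] at hτ
    rw [(hd τ).deriv]
    -- `0 < τ₀ - τ < π` in the interior, even when the endpoints are antipodal and `τ₀ = π`.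
    refine mul_pos (sin_pos_of_pos_of_lt_pi (by linarith [hτ.2]) (by linarith [hτ.1])) ?_
    exact hpos _ (hxm τ) _ (circVel_ne_zero hω hq hpq hs.ne' τ) (hvel τ)
  have hfin := hmono (left_mem_Icc.2 hτpos.le) (right_mem_Icc.2 hτpos.le) hτpos
  have hx0 : x 0 = cos θ • vert n + sin θ • ω := by simp [hx, circ]
  have hxτ : x τ₀ = cos θ • vert n + sin θ • η := by simp only [hx, circ]; rw [← h]
  simpa only [hx0, hxτ] using hfin

lemma meridian_vel {q : CapSpace n} (hq : ‖q‖ = 1) (hvq : ⟪vert n, q⟫ = 0) (r : ℝ) :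
    ⟪circ 0 (vert n) q 1 r, circVel (vert n) q 1 r⟫ = 0 := by
  simp only [circ, circVel, inner_add_left, inner_add_right, inner_smul_left, zero_add,
      inner_smul_right, hvq, real_inner_self_eq_norm_sq, norm_vert, hq,
      real_inner_comm (vert n) q, RCLike.conj_to_real]
  ring

/-- Follow the meridian through `x` to its endpoint on the boundary. Monotonicity gives `⟪G x, x⟫ >
⟪G (x θ), x⟫`, and since `G (x θ)` is horizontal the latter is `sin r / sin θ` times the positive
boundary value. -/
lemma pos_of_boundary (hn : 2 ≤ n) (hθ0 : 0 < θ) (hθπ : θ < π)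
    (hG : IsCapField (cos θ) G Ω) (hpos : IsPosDef (cos θ) G)
    (hb : ∀ z : CapSpace n, ‖z‖ = 1 → coneFun (cos θ) z = 0 → 0 < ⟪G z, z⟫) {x : CapSpace n}
    (hx : x ∈ unitCap n (cos θ)) : 0 < ⟪G x, x⟫ := by
  have hs : 0 < sin θ := sin_pos_of_pos_of_lt_pi hθ0 hθπ
  obtain ⟨r, hr, q, hq, hvq, rfl⟩ := exists_meridian hn hθ0 hθπ hx
  set x : ℝ → CapSpace n := circ 0 (vert n) q 1 with hxdef
  have hxm : ∀ τ ∈ Icc 0 θ, x τ ∈ unitCap n (cos θ) := fun τ hτ => meridian_mem hθπ hq hvq hτ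
  have hd : ∀ τ ∈ Icc 0 θ, HasDerivAt (fun τ => ⟪G (x τ), x r⟫) (sin (r - τ) *
      ⟪fderiv ℝ G (x τ) (circVel (vert n) q 1 τ), circVel (vert n) q 1 τ⟫) τ := fun τ hτ =>
    hG.hasDerivAt_inner_circ (hG.mem_of_unitCap (hxm τ hτ)) (inner_zero_right _) r
  have hxθ : x θ = cos θ • vert n + sin θ • q := by simp [hxdef, circ]
  obtain ⟨hb1, hb2⟩ := coneFun_parallel (θ := θ) hq hvq
  have hbθ := hb _ hb1 hb2
  rcases hr.2.lt_or_eq with hrθ | rfl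
  swap
  · rwa [hxθ]
  have hanti : StrictAntiOn (fun τ => ⟪G (x τ), x r⟫) (Icc r θ) := by
    refine strictAntiOn_of_deriv_neg (convex_Icc _ _)
      (fun τ hτ => (hd τ ⟨hr.1.trans hτ.1, hτ.2⟩).continuousAt.continuousWithinAt) ?_
    intro τ hτ
    rw [interior_Icc] at hτ
    have hτ' : τ ∈ Icc 0 θ := ⟨hr.1.trans hτ.1.le, hτ.2.le⟩
    rw [(hd τ hτ').deriv]
    refine mul_neg_of_neg_of_pos
      (sin_neg_of_neg_of_neg_pi_lt (by linarith [hτ.1]) (by linarith [hτ.2, hr.1])) ?_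
    exact hpos _ (hxm τ hτ') _ (circVel_ne_zero norm_vert hq hvq one_ne_zero τ)
      (meridian_vel hq hvq τ)
  have h1 : ⟪G (x θ), x r⟫ < ⟪G (x r), x r⟫ :=
    hanti (left_mem_Icc.2 hrθ.le) (right_mem_Icc.2 hrθ.le) hrθ
  have h2 : ⟪G (x θ), vert n⟫ = 0 := by
    rw [real_inner_comm]
    exact hG.boundary _ (ne_zero_of_mem_unitCap (hxm θ (right_mem_Icc.2 hθ0.le)))
      (by rw [hxθ]; exact hb2)
  rw [← hxθ] at hbθ
  have h3 : 0 < sin θ * ⟪G (x θ), q⟫ := by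
    have : ⟪G (x θ), x θ⟫ = sin θ * ⟪G (x θ), q⟫ := by
      conv_lhs => rw [hxθ, inner_add_right, inner_smul_right, inner_smul_right, ← hxθ, h2]
      ring
    rwa [this] at hbθ
  have h4 : ⟪G (x θ), x r⟫ = sin r * ⟪G (x θ), q⟫ := by
    have : x r = cos r • vert n + sin r • q := by simp [hxdef, circ]
    rw [this, inner_add_right, inner_smul_right, inner_smul_right, h2]
    ring
  have h5 : 0 ≤ sin r := sin_nonneg_of_nonneg_of_le_pi hr.1 (by linarith)
  have h6 : 0 < ⟪G (x θ), q⟫ := pos_of_mul_pos_right h3 hs.le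
  have h7 := mul_nonneg h5 h6.le
  linarith

lemma fderiv_sub_const (G : CapSpace n → CapSpace n) (a x : CapSpace n) :
    fderiv ℝ (fun y => G y - a) x = fderiv ℝ G x := _root_.fderiv_sub_const a

lemma sub_const (hG : IsCapField (cos θ) G Ω) {a : CapSpace n} (ha : ⟪vert n, a⟫ = 0) :
    IsCapField (cos θ) (fun x => G x - a) Ω where
  isOpen := hG.isOpen
  zero_notMem := hG.zero_notMem
  smul_mem := hG.smul_mem
  mem := hG.mem
  contDiffOn := hG.contDiffOn.sub contDiffOn_const
  smul_eq x hx r hr := by rw [hG.smul_eq x hx r hr]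
  symm x hx u v := by rw [fderiv_sub_const, hG.symm x hx]
  boundary x hx hx' := by rw [inner_sub_right, hG.boundary x hx hx', ha, sub_zero]

/-- After a horizontal translation, a strictly convex capillary support function is positive. -/
theorem exists_translation_pos (hn : 2 ≤ n) (hθ0 : 0 < θ) (hθπ : θ < π)
    (hG : IsCapField (cos θ) G Ω) (hpos : IsPosDef (cos θ) G) :
    ∃ a : CapSpace n, ⟪vert n, a⟫ = 0 ∧ ∀ x ∈ unitCap n (cos θ), 0 < ⟪G x - a, x⟫ := by
  have hs : 0 < sin θ := sin_pos_of_pos_of_lt_pi hθ0 hθπ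
  obtain ⟨ω, hω, hvω⟩ := exists_unit_orthogonal (F := CapSpace n) (by simp; omega) (vert n)
  have hω' : ‖-ω‖ = 1 := by rwa [norm_neg]
  have hvω' : ⟪vert n, -ω⟫ = 0 := by rw [inner_neg_right, hvω, neg_zero]
  obtain ⟨hy1, hy2⟩ := coneFun_parallel (θ := θ) hω hvω
  obtain ⟨hz1, hz2⟩ := coneFun_parallel (θ := θ) hω' hvω'
  set y := cos θ • vert n + sin θ • ω with hy
  set z := cos θ • vert n + sin θ • -ω with hz
  have hyz : y ≠ z := by
    intro h
    rw [hy, hz, add_right_inj, smul_right_inj hs.ne', eq_neg_iff_add_eq_zero, ← two_smul ℝ,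
      smul_eq_zero] at h
    rw [h.resolve_left two_ne_zero, norm_zero] at hω
    exact zero_ne_one hω
  have hne : ∀ w : CapSpace n, ‖w‖ = 1 → w ≠ 0 := fun w hw h => by
    rw [h, norm_zero] at hw; exact zero_ne_one hw
  -- For a boundary point `w`, `⟪G w - a, w⟫` is the average of `⟪G w - G y, w⟫` and `⟪G w - G z,
  -- w⟫`. Both are nonnegative, and as `y ≠ z` at most one vanishes.
  set a : CapSpace n := (1 / 2 : ℝ) • (G y + G z) with ha_def
  have ha : ⟪vert n, a⟫ = 0 := by
    rw [ha_def, inner_smul_right, inner_add_right, hG.boundary y (hne y hy1) hy2,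
      hG.boundary z (hne z hz1) hz2, add_zero, mul_zero]
  refine ⟨a, ha, fun x hx => ?_⟩
  refine pos_of_boundary hn hθ0 hθπ (hG.sub_const ha) (fun x hx v hv hxv => ?_)
    (fun w hw1 hw2 => ?_) hx
  · rw [fderiv_sub_const]; exact hpos x hx v hv hxv
  · rw [inner_sub_left, ha_def, inner_smul_left, inner_add_left]
    simp only [RCLike.conj_to_real]
    have key : ∀ u : CapSpace n, ‖u‖ = 1 → coneFun (cos θ) u = 0 → u ≠ w →
        ⟪G u, w⟫ < ⟪G w, w⟫ := fun u hu1 hu2 huw =>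
      inner_lt_of_boundary hn hθ0 hθπ hG hpos hu1 hw1 hu2 hw2 huw
    by_cases h1 : y = w
    · have := key z hz1 hz2 (fun h => hyz (h1.trans h.symm))
      rw [h1]; linarith
    · have h3 := key y hy1 hy2 h1
      by_cases h2 : z = w
      · rw [h2]; linarith
      · have := key z hz1 hz2 h2
        linarith

/-- If the Hessian is that of the unit cap, the support function is that of a translated cap. -/
theorem eq_ellGrad_add_of_fderiv_eq (hn : 2 ≤ n) (hθ0 : 0 < θ) (hθπ : θ < π)
    (hG : IsCapField (cos θ) G Ω)
    (h : ∀ x ∈ unitCap n (cos θ), fderiv ℝ G x = ellHess x) :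
    ∃ a : CapSpace n, ⟪vert n, a⟫ = 0 ∧ ∀ x ∈ unitCap n (cos θ),
      G x = ellGrad (cos θ) x + a := by
  -- The difference of the two fields at the pole, from which all meridians start.
  set a := G (vert n) - ellGrad (cos θ) (vert n) with ha
  have key : ∀ x ∈ unitCap n (cos θ), G x = ellGrad (cos θ) x + a := by
    intro x hx
    obtain ⟨r, hr, q, hq, hvq, rfl⟩ := exists_meridian hn hθ0 hθπ hx
    set x : ℝ → CapSpace n := circ 0 (vert n) q 1 with hxdef
    have hxm : ∀ τ ∈ Icc 0 θ, x τ ∈ unitCap n (cos θ) := fun τ hτ => meridian_mem hθπ hq hvq hτ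
    have hd : ∀ τ ∈ Icc 0 θ, HasDerivAt (fun τ => G (x τ) - ellGrad (cos θ) (x τ)) 0 τ := by
      intro τ hτ
      have h1 := (hG.hasFDerivAt (hG.mem_of_unitCap (hxm τ hτ))).comp_hasDerivAt τ
        (hasDerivAt_circ 0 (vert n) q 1 τ)
      have h2 := (hasFDerivAt_ellGrad (cos θ) (ne_zero_of_mem_unitCap (hxm τ hτ))).comp_hasDerivAt τ
        (hasDerivAt_circ 0 (vert n) q 1 τ)
      refine (h1.sub h2).congr_deriv ?_
      rw [h _ (hxm τ hτ), sub_self]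
    have h3 := constant_of_derivWithin_zero (a := 0) (b := θ)
      (f := fun τ => G (x τ) - ellGrad (cos θ) (x τ))
      (fun τ hτ => (hd τ hτ).differentiableAt.differentiableWithinAt)
      (fun τ hτ => (hd τ ⟨hτ.1, hτ.2.le⟩).hasDerivWithinAt.derivWithin
        ((uniqueDiffOn_Icc hθ0) τ ⟨hτ.1, hτ.2.le⟩)) r hr
    have hx0 : x 0 = vert n := by simp [hxdef, circ]
    simp only [hx0] at h3
    rw [ha, ← h3]; abel
  refine ⟨a, ?_, key⟩
  obtain ⟨ω, hω, hvω⟩ := exists_unit_orthogonal (F := CapSpace n) (by simp; omega) (vert n)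
  obtain ⟨hy1, hy2⟩ := coneFun_parallel (θ := θ) hω hvω
  set y := cos θ • vert n + sin θ • ω with hy
  have hyc : y ∈ unitCap n (cos θ) := ⟨hy1, hy2.ge⟩
  have h1 := hG.boundary y (ne_zero_of_mem_unitCap hyc) hy2
  have hvy : ⟪vert n, y⟫ = cos θ := by
    rw [coneFun, hy1] at hy2; linarith
  rw [key y hyc, inner_add_right, ellGrad, inner_sub_right, inner_smul_right, inner_smul_right,
    inner_vert_vert, hvy, hy1] at h1
  linarith

end IsCapField

end

end GreatCircles
end Capillary

namespace Capillary

variable {n : ℕ}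

/-! ### Newton's inequalities against the Minkowski formulas force all eigenvalues to be `1`. -/

section Rigidity

open MeasureTheory Set Filter
open scoped Topology

/-- A smooth radial profile, positive exactly on `(1, 2)`. -/
noncomputable def profile (r : ℝ) : ℝ :=
  Real.smoothTransition (r - 1) * Real.smoothTransition (2 - r)

lemma contDiff_profile : ContDiff ℝ 1 profile :=
  (Real.smoothTransition.contDiff.comp (contDiff_id.sub contDiff_const)).mul
    (Real.smoothTransition.contDiff.comp (contDiff_const.sub contDiff_id))

lemma profile_nonneg (r : ℝ) : 0 ≤ profile r :=
  mul_nonneg (Real.smoothTransition.nonneg _) (Real.smoothTransition.nonneg _)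

lemma profile_eq_zero {r : ℝ} (hr : r ∉ Icc (1 : ℝ) 2) : profile r = 0 := by
  rw [mem_Icc, not_and_or, not_le, not_le] at hr
  rcases hr with h | h
  · rw [profile, Real.smoothTransition.zero_of_nonpos (by linarith), zero_mul]
  · rw [profile, Real.smoothTransition.zero_of_nonpos (x := 2 - r) (by linarith), mul_zero]

lemma profile_pos {r : ℝ} (h1 : 1 < r) (h2 : r < 2) : 0 < profile r :=
  mul_pos (Real.smoothTransition.pos_of_pos (by linarith))
    (Real.smoothTransition.pos_of_pos (by linarith))

lemma esymOp_smul (j : ℕ) (r : ℝ) (A : CapSpace n →L[ℝ] CapSpace n) :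
    esymOp j (r • A) = r ^ j * esymOp j A := by
  simp only [esymOp, esymMat, Matrix.coeff_det_one_add_X_smul_eq_sum_minors, mat_smul]
  rw [Finset.mul_sum]
  refine Finset.sum_congr rfl fun s hs => ?_
  have h : (r • mat A).submatrix (Subtype.val : s → Fin (n + 1)) (Subtype.val : s → Fin (n + 1))
      = r • (mat A).submatrix Subtype.val Subtype.val := rfl
  rw [h, Matrix.det_smul, Fintype.card_coe, (Finset.mem_powersetCard.1 hs).2]

lemma coneFun_smul (c : ℝ) {r : ℝ} (hr : 0 < r) (x : CapSpace n) :
    coneFun c (r • x) = r * coneFun c x := by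
  simp only [coneFun, inner_smul_right, norm_smul, Real.norm_eq_abs, abs_of_pos hr]
  ring

lemma coneEll_smul (c : ℝ) {r : ℝ} (hr : 0 < r) (x : CapSpace n) :
    coneEll c (r • x) = r * coneEll c x := by
  simp only [coneEll, inner_smul_right, norm_smul, Real.norm_eq_abs, abs_of_pos hr]
  ring

lemma coneEll_pos {c : ℝ} (hc : |c| < 1) {x : CapSpace n} (hx : ‖x‖ = 1) : 0 < coneEll c x := by
  have h1 : |c * ⟪vert n, x⟫| ≤ |c| := by
    rw [abs_mul]
    refine mul_le_of_le_one_right (abs_nonneg _) ?_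
    simpa [norm_vert, hx] using abs_real_inner_le_norm (vert n) x
  have h2 := le_abs_self (c * ⟪vert n, x⟫)
  rw [coneEll, hx]
  linarith

/-- The multiset `s x` consists of the nontrivial eigenvalues of `A x`, for unit vectors `x`. -/
def IsSpectrum (c : ℝ) (A : CapSpace n → CapSpace n →L[ℝ] CapSpace n)
    (s : CapSpace n → Multiset ℝ) : Prop :=
  ∀ x ∈ unitCap n c, (s x).card = n ∧
    ∀ t : ℝ, (1 + t • A x).det = ((s x).map fun r => 1 + r * t).prod

lemma IsSpectrum.esymOp_eq {c : ℝ} {A : CapSpace n → CapSpace n →L[ℝ] CapSpace n}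
    {s : CapSpace n → Multiset ℝ} (hs : IsSpectrum c A s) {x : CapSpace n}
    (hx : x ∈ unitCap n c) (j : ℕ) : esymOp j (A x) = (s x).esymm j := by
  rw [← coeff_prod_one_add_C_mul_X]
  refine esymOp_eq_of_det_eq (fun t => ?_) j
  rw [(hs x hx).2, Polynomial.eval_multiset_prod, Multiset.map_map]
  simp

namespace IsCapField

variable {c : ℝ} {G : CapSpace n → CapSpace n} {Ω : Set (CapSpace n)}

/-- The normalized Minkowski integrand. -/
noncomputable def minkowski (c : ℝ) (G : CapSpace n → CapSpace n) (j : ℕ) (x : CapSpace n) : ℝ :=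
  ‖x‖ ^ j * fluxCoeff c G j x / ((n - j) * n.choose j)

/-- `DG` has degree `-1`, so the weight `‖x‖ ^ j` makes the integrand constant on rays. The
binomials are absorbed by `(j + 1) C(n, j + 1) = (n - j) C(n, j)`. -/
lemma minkowski_smul (hG : IsCapField c G Ω) {s : CapSpace n → Multiset ℝ}
    (hs : IsSpectrum c (fderiv ℝ G) s) {j : ℕ} (hj : j < n) {r : ℝ} (hr : 0 < r)
    {x : CapSpace n} (hx : x ∈ unitCap n c) :
    minkowski c G j (r • x)
      = coneEll c x * symMean (s x) (j + 1) - ⟪G x, x⟫ * symMean (s x) j := by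
  have hxΩ := hG.mem x (ne_zero_of_mem_unitCap hx) hx.2
  have hnj : (0 : ℝ) < n - j := by
    have : (j : ℝ) < n := by exact_mod_cast hj
    linarith
  have hC : (0 : ℝ) < n.choose j := by exact_mod_cast Nat.choose_pos hj.le
  have hC1 : (0 : ℝ) < n.choose (j + 1) := by exact_mod_cast Nat.choose_pos hj
  have hCC : (n.choose (j + 1) : ℝ) * (j + 1) = n.choose j * (n - j) := by
    have := Nat.choose_succ_right_eq n j
    have h2 : ((n.choose (j + 1) * (j + 1) : ℕ) : ℝ) = ((n.choose j * (n - j) : ℕ) : ℝ) := by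
      rw [this]
    push_cast [Nat.cast_sub hj.le] at h2
    exact h2
  rw [minkowski, fluxCoeff, hG.fderiv_smul hxΩ hr, esymOp_smul, esymOp_smul, hs.esymOp_eq hx,
    hs.esymOp_eq hx, coneEll_smul c hr, hG.smul_eq x hxΩ r hr, inner_smul_right, norm_smul, hx.1,
    mul_one, Real.norm_eq_abs, abs_of_pos hr, symMean, symMean, (hs x hx).1,
    div_eq_iff (by positivity), inv_pow, inv_pow, pow_succ]
  field_simp
  linear_combination (coneEll c x * (s x).esymm (j + 1)) * hCC

lemma continuousOn_minkowski (hG : IsCapField c G Ω) (j : ℕ) :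
    ContinuousOn (minkowski c G j) Ω := by
  unfold minkowski
  exact ((continuous_norm.pow j).continuousOn.mul (hG.continuousOn_fluxCoeff j)).div_const _

lemma integral_minkowski (hG : IsCapField c G Ω) (hc : |c| < 1) {j : ℕ} (hj : j < n) :
    ∫ x in coneShell n c ∩ {x | 0 < coneFun c x}, profile ‖x‖ * minkowski c G j x = 0 := by
  have h := hG.integral_fluxCoeff_eq_zero hc (ψ := fun r => profile r * r ^ j)
    (contDiff_profile.mul (contDiff_id.pow j))
    (fun r hr => by rw [profile_eq_zero hr, zero_mul]) (fun r => ?_) hj.le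
  · have h2 : ∀ x : CapSpace n, profile ‖x‖ * minkowski c G j x
        = (profile ‖x‖ * ‖x‖ ^ j * fluxCoeff c G j x) * ((n - j) * n.choose j : ℝ)⁻¹ := by
      intro x; rw [minkowski, div_eq_mul_inv]; ring
    simp only [h2]
    rw [integral_mul_const, h, zero_mul]
  · by_cases hr : r ∈ Icc (1 : ℝ) 2
    · exact mul_nonneg (profile_nonneg r) (pow_nonneg (by linarith [hr.1]) j)
    · rw [profile_eq_zero hr, zero_mul]

/-- A continuous function of one sign with zero weighted integral vanishes where the weight is
positive. The radius `3 / 2` lies inside the support of `profile`, and boundary rays are reached by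
continuity. -/
lemma eq_zero_of_integral_eq_zero (hG : IsCapField c G Ω) (hc : |c| < 1) {f : CapSpace n → ℝ}
    (hf : ContinuousOn f Ω) (hf0 : ∀ x ∈ coneShell n c, f x ≤ 0)
    (hint : ∫ x in coneShell n c ∩ {x | 0 < coneFun c x}, profile ‖x‖ * f x = 0)
    {x : CapSpace n} (hx : x ∈ unitCap n c) : f ((3 / 2 : ℝ) • x) = 0 := by
  have hK := isCompact_coneShell (n := n) c
  have hP : Continuous fun x : CapSpace n => profile ‖x‖ :=
    contDiff_profile.continuous.comp continuous_norm
  have hgc : ContinuousOn (fun x => profile ‖x‖ * f x) Ω := hP.continuousOn.mul hf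
  have hgi : IntegrableOn (fun x => profile ‖x‖ * f x)
      (coneShell n c ∩ {x | 0 < coneFun c x}) :=
    ((hgc.mono hG.coneShell_subset).integrableOn_compact hK).mono_set inter_subset_left
  have hSm : MeasurableSet (coneShell n c ∩ {x : CapSpace n | 0 < coneFun c x}) :=
    hK.isClosed.measurableSet.inter
      (isOpen_lt continuous_const (continuous_coneFun c)).measurableSet
  set O : Set (CapSpace n) := {x | (1 < ‖x‖ ∧ ‖x‖ < 2) ∧ 0 < coneFun c x} with hO
  have hOo : IsOpen O := ((isOpen_lt continuous_const continuous_norm).inter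
    (isOpen_lt continuous_norm continuous_const)).inter
    (isOpen_lt continuous_const (continuous_coneFun c))
  have hOS : O ⊆ coneShell n c ∩ {x | 0 < coneFun c x} := fun y hy =>
    ⟨⟨⟨hy.1.1.le, hy.1.2.le⟩, hy.2.le⟩, hy.2⟩
  have hOΩ : O ⊆ Ω := fun y hy => hG.coneShell_subset (hOS hy).1
  have hint' : ∫ x in coneShell n c ∩ {x | 0 < coneFun c x}, -(profile ‖x‖ * f x) = 0 := by
    rw [integral_neg, hint, neg_zero]
  have hae : (fun x => -(profile ‖x‖ * f x)) =ᵐ[volume.restrict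
      (coneShell n c ∩ {x | 0 < coneFun c x})] 0 := by
    refine (setIntegral_eq_zero_iff_of_nonneg_ae ?_ hgi.neg).1 hint'
    refine (ae_restrict_iff' hSm).2 (Eventually.of_forall fun y hy => ?_)
    exact neg_nonneg.2 (mul_nonpos_of_nonneg_of_nonpos (profile_nonneg _) (hf0 y hy.1))
  have hae' : (fun x => -(profile ‖x‖ * f x)) =ᵐ[volume.restrict O] fun _ => 0 :=
    ae_restrict_of_ae_restrict_of_subset hOS hae
  have hzero : ∀ y ∈ O, f y = 0 := by
    intro y hy
    have h1 := Measure.eqOn_open_of_ae_eq hae' hOo (hgc.mono hOΩ).neg continuousOn_const hy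
    have h2 := profile_pos hy.1.1 hy.1.2
    exact (mul_eq_zero.1 (neg_eq_zero.1 h1)).resolve_left h2.ne'
  set z : CapSpace n := (3 / 2 : ℝ) • x with hz
  have hz1 : ‖z‖ = 3 / 2 := by
    rw [hz, norm_smul, hx.1]; norm_num
  have hzc : 0 ≤ coneFun c z := by
    rw [hz, coneFun_smul c (by norm_num)]
    exact mul_nonneg (by norm_num) hx.2
  have hzΩ : z ∈ Ω := hG.mem z (by rintro h; rw [h, norm_zero] at hz1; norm_num at hz1) hzc
  -- Moving up by `δ` raises `coneFun` by at least `(1 - |c|) δ`, so the path enters the open cone.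
  have hpath : Tendsto (fun δ : ℝ => z + δ • vert n) (𝓝[>] 0) (𝓝 z) := by
    have : Continuous fun δ : ℝ => z + δ • vert n := by fun_prop
    have h := (this.tendsto 0).mono_left (nhdsWithin_le_nhds (s := Ioi 0))
    simpa using h
  have hlim : Tendsto (fun δ : ℝ => f (z + δ • vert n)) (𝓝[>] 0) (𝓝 (f z)) :=
    ((hf.continuousAt (hG.isOpen.mem_nhds hzΩ)).tendsto).comp hpath
  have hev : ∀ᶠ δ in 𝓝[>] (0 : ℝ), f (z + δ • vert n) = 0 := by
    have hn := hpath.norm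
    rw [hz1] at hn
    filter_upwards [self_mem_nhdsWithin, hn.eventually (lt_mem_nhds (by norm_num : (1 : ℝ) < 3 / 2)),
      hn.eventually (gt_mem_nhds (by norm_num : (3 / 2 : ℝ) < 2))] with δ hδ h1 h2
    have hδ : 0 < δ := hδ
    refine hzero _ ⟨⟨h1, h2⟩, ?_⟩
    rw [coneFun, inner_add_right, inner_smul_right (vert n) (vert n), inner_vert_vert]
    rw [coneFun] at hzc
    have h3 : |‖z + δ • vert n‖ - ‖z‖| ≤ δ := by
      refine (abs_norm_sub_norm_le _ _).trans ?_
      rw [add_sub_cancel_left, norm_smul, norm_vert, mul_one, Real.norm_eq_abs, abs_of_pos hδ]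
    have h4 : c * (‖z + δ • vert n‖ - ‖z‖) ≤ |c| * δ := by
      refine (le_abs_self _).trans ?_
      rw [abs_mul]
      gcongr
    have h5 : |c| * δ < δ := by nlinarith
    nlinarith
  exact tendsto_nhds_unique (hlim.congr' hev) tendsto_const_nhds |>.symm ▸ rfl

lemma exists_unit {x : CapSpace n} (hx : x ∈ coneShell n c) :
    ∃ u ∈ unitCap n c, ∃ r : ℝ, 0 < r ∧ x = r • u := by
  have h0 : 0 < ‖x‖ := norm_pos_iff.2 (ne_zero_of_mem_coneShell hx)
  refine ⟨‖x‖⁻¹ • x, ⟨norm_smul_inv_norm (norm_pos_iff.1 h0), ?_⟩, ‖x‖, h0, ?_⟩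
  · rw [coneFun_smul c (inv_pos.2 h0)]
    exact mul_nonneg (inv_nonneg.2 h0.le) hx.2
  · rw [smul_smul, mul_inv_cancel₀ h0.ne', one_smul]

/-- A sign on the difference of two Minkowski integrands forces it to vanish. -/
lemma minkowski_sub_eq_zero (hG : IsCapField c G Ω) (hc : |c| < 1) {s : CapSpace n → Multiset ℝ}
    (hs : IsSpectrum c (fderiv ℝ G) s) {i j : ℕ} (hi : i < n) (hj : j < n)
    (hsign : ∀ x ∈ unitCap n c,
      (coneEll c x * symMean (s x) (i + 1) - ⟪G x, x⟫ * symMean (s x) i)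
        - (coneEll c x * symMean (s x) (j + 1) - ⟪G x, x⟫ * symMean (s x) j) ≤ 0)
    {x : CapSpace n} (hx : x ∈ unitCap n c) :
    (coneEll c x * symMean (s x) (i + 1) - ⟪G x, x⟫ * symMean (s x) i)
        - (coneEll c x * symMean (s x) (j + 1) - ⟪G x, x⟫ * symMean (s x) j) = 0 := by
  have hK := isCompact_coneShell (n := n) c
  have hP : Continuous fun x : CapSpace n => profile ‖x‖ :=
    contDiff_profile.continuous.comp continuous_norm
  have hint : ∀ m, IntegrableOn (fun x => profile ‖x‖ * minkowski c G m x)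
      (coneShell n c ∩ {x | 0 < coneFun c x}) := fun m =>
    ((hP.continuousOn.mul ((hG.continuousOn_minkowski m).mono
      hG.coneShell_subset)).integrableOn_compact hK).mono_set inter_subset_left
  have h := hG.eq_zero_of_integral_eq_zero hc (f := fun x => minkowski c G i x - minkowski c G j x)
    ((hG.continuousOn_minkowski i).sub (hG.continuousOn_minkowski j)) ?_ ?_ hx
  · rwa [hG.minkowski_smul hs hi (by norm_num) hx, hG.minkowski_smul hs hj (by norm_num) hx] at h
  · intro y hy
    obtain ⟨u, hu, r, hr, rfl⟩ := exists_unit hy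
    rw [hG.minkowski_smul hs hi hr hu, hG.minkowski_smul hs hj hr hu]
    exact hsign u hu
  · simp only [mul_sub]
    rw [integral_sub (hint i) (hint j), hG.integral_minkowski hc hi, hG.integral_minkowski hc hj,
      sub_zero]

/-- In the difference of orders `k` and `l` the terms with `⟪G x, x⟫` cancel because `p_k = p_l`, so
only `coneEll > 0` matters. -/
theorem spectrum_eq_replicate_of_lt (hG : IsCapField c G Ω) (hc : |c| < 1)
    {s : CapSpace n → Multiset ℝ} (hs : IsSpectrum c (fderiv ℝ G) s) {k l : ℕ} (hlk : l < k)
    (hk : k < n) (hpos : ∀ x ∈ unitCap n c, ∀ i ≤ k, 0 < symMean (s x) i)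
    (heq : ∀ x ∈ unitCap n c, symMean (s x) k = symMean (s x) l) {x : CapSpace n}
    (hx : x ∈ unitCap n c) : s x = Multiset.replicate n 1 := by
  have key : ∀ x ∈ unitCap n c, symMean (s x) (k + 1) ≤ symMean (s x) (l + 1) ∧
      (symMean (s x) (k + 1) = symMean (s x) (l + 1) → s x = Multiset.replicate n 1) := by
    intro x hx
    have h := symMean_succ_le_of_eq hlk (by rwa [(hs x hx).1]) (hpos x hx) (heq x hx)
    rwa [(hs x hx).1] at h
  have h := hG.minkowski_sub_eq_zero hc hs hk (hlk.trans hk) (fun y hy => ?_) hx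
  · refine (key x hx).2 ?_
    rw [heq x hx] at h
    have h2 : coneEll c x * (symMean (s x) (k + 1) - symMean (s x) (l + 1)) = 0 := by linarith
    exact sub_eq_zero.1 ((mul_eq_zero.1 h2).resolve_left (coneEll_pos hc hx.1).ne')
  · rw [heq y hy]
    have := mul_le_mul_of_nonneg_left (key y hy).1 (coneEll_pos hc hy.1).le
    linarith

/-- Now the `coneEll` terms cancel for `l > 0` and the sign of `⟪G x, x⟫` decides. -/
theorem spectrum_eq_replicate_of_eq (hn : 2 ≤ n) (hG : IsCapField c G Ω) (hc : |c| < 1)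
    {s : CapSpace n → Multiset ℝ} (hs : IsSpectrum c (fderiv ℝ G) s) {l : ℕ} (hl : l < n)
    (hpos : ∀ x ∈ unitCap n c, ∀ i ≤ n, 0 < symMean (s x) i)
    (heq : ∀ x ∈ unitCap n c, symMean (s x) n = symMean (s x) l)
    (hG0 : ∀ x ∈ unitCap n c, 0 < ⟪G x, x⟫) {x : CapSpace n}
    (hx : x ∈ unitCap n c) : s x = Multiset.replicate n 1 := by
  rcases Nat.eq_zero_or_pos l with rfl | hl0
  · have key : ∀ x ∈ unitCap n c, 1 ≤ symMean (s x) 1 ∧ 1 ≤ symMean (s x) (n - 1) ∧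
        (symMean (s x) 1 = 1 → symMean (s x) (n - 1) = 1 → s x = Multiset.replicate n 1) := by
      intro x hx
      have hcard := (hs x hx).1
      have h := one_le_symMean_of_eq_one (s := s x) (by omega) (by rw [hcard]; exact hpos x hx)
        (by rw [hcard, heq x hx, symMean_zero])
      rwa [hcard] at h
    have heq1 : ∀ x ∈ unitCap n c, symMean (s x) (n - 1 + 1) = 1 := fun x hx => by
      rw [show n - 1 + 1 = n by omega, heq x hx, symMean_zero]
    have h1 : ∀ y ∈ unitCap n c, 0 ≤ coneEll c y * (symMean (s y) 1 - 1) ∧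
        0 ≤ ⟪G y, y⟫ * (symMean (s y) (n - 1) - 1) := fun y hy =>
      ⟨mul_nonneg (coneEll_pos hc hy.1).le (by linarith [(key y hy).1]),
        mul_nonneg (hG0 y hy).le (by linarith [(key y hy).2.1])⟩
    -- For `l = 0` the order `l - 1` is not available. With order `0` instead, the integrand is `L
    -- (1 - p_1) + H (1 - p_{n-1})`, a sum of two nonpositive terms.
    have h := hG.minkowski_sub_eq_zero hc hs (i := n - 1) (j := 0) (by omega) (by omega)
      (fun y hy => by
        rw [heq1 y hy, zero_add, symMean_zero]
        linarith [(h1 y hy).1, (h1 y hy).2]) hx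
    rw [heq1 x hx, zero_add, symMean_zero] at h
    obtain ⟨h2, h3⟩ := h1 x hx
    have h4 : coneEll c x * (symMean (s x) 1 - 1) = 0 := by linarith
    have h5 : ⟪G x, x⟫ * (symMean (s x) (n - 1) - 1) = 0 := by linarith
    exact (key x hx).2.2
      (sub_eq_zero.1 ((mul_eq_zero.1 h4).resolve_left (coneEll_pos hc hx.1).ne'))
      (sub_eq_zero.1 ((mul_eq_zero.1 h5).resolve_left (hG0 x hx).ne'))
  · have key : ∀ x ∈ unitCap n c, symMean (s x) (l - 1) ≤ symMean (s x) (n - 1) ∧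
        (symMean (s x) (l - 1) = symMean (s x) (n - 1) → s x = Multiset.replicate n 1) := by
      intro x hx
      have hcard := (hs x hx).1
      have h := symMean_pred_le_of_eq (s := s x) hl0 hl hcard.symm (hpos x hx) (heq x hx)
      rwa [hcard] at h
    have heq1 : ∀ x ∈ unitCap n c, symMean (s x) (n - 1 + 1) = symMean (s x) (l - 1 + 1) :=
      fun x hx => by
        rw [show n - 1 + 1 = n by omega, heq x hx, show l - 1 + 1 = l by omega]
    have h := hG.minkowski_sub_eq_zero hc hs (i := n - 1) (j := l - 1) (by omega) (by omega)
      (fun y hy => by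
        rw [heq1 y hy]
        have := mul_le_mul_of_nonneg_left (key y hy).1 (hG0 y hy).le
        linarith) hx
    rw [heq1 x hx] at h
    refine (key x hx).2 ?_
    have h4 : ⟪G x, x⟫ * (symMean (s x) (n - 1) - symMean (s x) (l - 1)) = 0 := by linarith
    exact (sub_eq_zero.1 ((mul_eq_zero.1 h4).resolve_left (hG0 x hx).ne')).symm

end IsCapField

end Rigidity
end Capillary

namespace Capillary

variable {n : ℕ}

/-! ### The gradient field of the homogeneous extension of `h`, pulled back by the Gauss map. -/

section SupportFunction

open Set

variable {θ : ℝ} {h : CapSpace n → ℝ}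

lemma inner_gradient {ξ : CapSpace n} (v : CapSpace n) : ⟪∇ h ξ, v⟫ = fderiv ℝ h ξ v := by
  simp [gradient]

lemma contDiffAt_gradient {ξ : CapSpace n} (hh : ContDiffAt ℝ 2 h ξ) : ContDiffAt ℝ 1 (∇ h) ξ :=
  (InnerProductSpace.toDual ℝ (CapSpace n)).symm.contDiff.contDiffAt.comp ξ
    (hh.fderiv_right (m := 1) (by norm_num))

lemma hasFDerivAt_gradient {ξ : CapSpace n} (hh : ContDiffAt ℝ 2 h ξ) :
    HasFDerivAt (∇ h) (fderiv ℝ (∇ h) ξ) ξ :=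
  ((contDiffAt_gradient hh).differentiableAt one_ne_zero).hasFDerivAt

lemma inner_fderiv_gradient {ξ : CapSpace n} (hh : ContDiffAt ℝ 2 h ξ) (u v : CapSpace n) :
    ⟪fderiv ℝ (∇ h) ξ u, v⟫ = fderiv ℝ (fderiv ℝ h) ξ u v := by
  have h1 : HasFDerivAt (fun y => ⟪∇ h y, v⟫) _ ξ :=
    (hasFDerivAt_gradient hh).inner ℝ (hasFDerivAt_const v ξ)
  have h2 : HasFDerivAt (fun y => fderiv ℝ h y v) _ ξ :=
    (((hh.fderiv_right (m := 1) (by norm_num)).differentiableAt one_ne_zero).hasFDerivAt).clm_apply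
      (hasFDerivAt_const v ξ)
  simp only [inner_gradient] at h1
  simpa using congrArg (fun T => T u) (h1.unique h2)

lemma fderiv_gradient_symm {ξ : CapSpace n} (hh : ContDiffAt ℝ 2 h ξ) (u v : CapSpace n) :
    ⟪fderiv ℝ (∇ h) ξ u, v⟫ = ⟪u, fderiv ℝ (∇ h) ξ v⟫ := by
  rw [inner_fderiv_gradient hh, real_inner_comm, inner_fderiv_gradient hh]
  exact hh.isSymmSndFDerivAt (by simp) u v

/-- The derivative of `h • normal + capGradient θ h` in tangent directions. -/
noncomputable def shapeOp (θ : ℝ) (h : CapSpace n → ℝ) (ξ : CapSpace n) :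
    CapSpace n →L[ℝ] CapSpace n :=
  (h ξ - ⟪∇ h ξ, normal θ ξ⟫) • 1 + fderiv ℝ (∇ h) ξ
    - rankOne (normal θ ξ) (normal θ ξ) ∘L fderiv ℝ (∇ h) ξ

lemma shapeOp_apply (θ : ℝ) (h : CapSpace n → ℝ) (ξ u : CapSpace n) :
    shapeOp θ h ξ u = (h ξ - ⟪∇ h ξ, normal θ ξ⟫) • u + fderiv ℝ (∇ h) ξ u
      - ⟪normal θ ξ, fderiv ℝ (∇ h) ξ u⟫ • normal θ ξ := by
  simp [shapeOp, rankOne_apply]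

lemma hasFDerivAt_normal (θ : ℝ) (ξ : CapSpace n) :
    HasFDerivAt (normal θ) (1 : CapSpace n →L[ℝ] CapSpace n) ξ :=
  (hasFDerivAt_id ξ).sub_const _

lemma fderiv_capGradient_apply {ξ : CapSpace n} (hh : ContDiffAt ℝ 2 h ξ) (u : CapSpace n) :
    fderiv ℝ (capGradient θ h) ξ u = fderiv ℝ (∇ h) ξ u
      - ((⟪∇ h ξ, u⟫ + ⟪fderiv ℝ (∇ h) ξ u, normal θ ξ⟫) • normal θ ξ
        + ⟪∇ h ξ, normal θ ξ⟫ • u) := by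
  have h1 := hasFDerivAt_gradient hh
  have h2 := hasFDerivAt_normal θ ξ
  have h3 : HasFDerivAt (capGradient θ h) _ ξ := h1.sub ((h1.inner ℝ h2).smul h2)
  rw [h3.fderiv]
  simp [add_comm]

lemma differentiableAt_capGradient {ξ : CapSpace n} (hh : ContDiffAt ℝ 2 h ξ) :
    DifferentiableAt ℝ (capGradient θ h) ξ := by
  have h1 := hasFDerivAt_gradient hh
  have h2 := hasFDerivAt_normal θ ξ
  exact (h1.sub ((h1.inner ℝ h2).smul h2)).differentiableAt

/-- The gradient of the one-homogeneous extension of `h`, as a field on the cone. -/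
noncomputable def capField (θ : ℝ) (h : CapSpace n → ℝ) (y : CapSpace n) : CapSpace n :=
  h (ellGrad (Real.cos θ) y) • normal θ (ellGrad (Real.cos θ) y)
    + capGradient θ h (ellGrad (Real.cos θ) y)

lemma e_eq (n : ℕ) : e n = -vert n := rfl

lemma normal_ellGrad (θ : ℝ) (y : CapSpace n) :
    normal θ (ellGrad (Real.cos θ) y) = ‖y‖⁻¹ • y := by
  simp [normal, ellGrad, e_eq]

lemma ellHess_apply (y v : CapSpace n) :
    ellHess y v = ‖y‖⁻¹ • (v - (‖y‖⁻¹ ^ 2 * ⟪y, v⟫) • y) := by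
  simp [ellHess, rankOne_apply, smul_smul]

lemma inner_ellHess_self {y : CapSpace n} (hy : y ≠ 0) (v : CapSpace n) :
    ⟪y, ellHess y v⟫ = 0 := by
  have h0 : ‖y‖ ≠ 0 := norm_ne_zero_iff.2 hy
  rw [ellHess_apply, inner_smul_right, inner_sub_right, inner_smul_right,
    real_inner_self_eq_norm_sq]
  field_simp
  ring

lemma ellHess_symm (y u v : CapSpace n) : ⟪ellHess y u, v⟫ = ⟪u, ellHess y v⟫ := by
  simp only [ellHess_apply, inner_smul_left, inner_smul_right, inner_sub_left, inner_sub_right,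
    RCLike.conj_to_real, real_inner_comm y u]
  ring

/-- The chain rule through `ellGrad`, the inverse Gauss map. Its derivative takes tangential values,
where the terms with `⟪∇ h, ·⟫ • normal` cancel. -/
lemma hasFDerivAt_capField {y : CapSpace n} (hy : y ≠ 0)
    (hh : ContDiffAt ℝ 2 h (ellGrad (Real.cos θ) y)) :
    HasFDerivAt (capField θ h) (shapeOp θ h (ellGrad (Real.cos θ) y) ∘L ellHess y) y := by
  set ξ := ellGrad (Real.cos θ) y with hξ
  have h0 := (hh.differentiableAt two_ne_zero).hasFDerivAt
  have h1 := (differentiableAt_capGradient (θ := θ) hh).hasFDerivAt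
  have h2 : HasFDerivAt (fun ξ => h ξ • normal θ ξ + capGradient θ h ξ) _ ξ :=
    (h0.smul (hasFDerivAt_normal θ ξ)).add h1
  refine (h2.comp y (hasFDerivAt_ellGrad (Real.cos θ) hy)).congr_fderiv ?_
  ext1 v
  have h3 : ⟪normal θ ξ, ellHess y v⟫ = 0 := by
    rw [hξ, normal_ellGrad, inner_smul_left, inner_ellHess_self hy, mul_zero]
  set w := ellHess y v
  simp only [ContinuousLinearMap.comp_apply, add_apply, smul_apply, one_apply_eq_self,
    ContinuousLinearMap.smulRight_apply, fderiv_capGradient_apply hh, shapeOp_apply,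
    ← inner_gradient, real_inner_comm (normal θ ξ)]
  module

/-- Since `‖y‖ • ellHess y` is the projection off `y`, the bilinear form reduces to `ellHess` and
the Hessian of `h` between tangential vectors, both symmetric. -/
lemma capField_symm {y : CapSpace n} (hy : y ≠ 0)
    (hh : ContDiffAt ℝ 2 h (ellGrad (Real.cos θ) y)) (u v : CapSpace n) :
    ⟪fderiv ℝ (capField θ h) y u, v⟫ = ⟪u, fderiv ℝ (capField θ h) y v⟫ := by
  have h0 : ‖y‖ ≠ 0 := norm_ne_zero_iff.2 hy
  have key : ∀ u v, ⟪fderiv ℝ (capField θ h) y u, v⟫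
      = (h (ellGrad (Real.cos θ) y)
          - ⟪∇ h (ellGrad (Real.cos θ) y), normal θ (ellGrad (Real.cos θ) y)⟫) * ⟪ellHess y u, v⟫
        + ‖y‖ * ⟪fderiv ℝ (∇ h) (ellGrad (Real.cos θ) y) (ellHess y u), ellHess y v⟫ := by
    intro u v
    rw [(hasFDerivAt_capField hy hh).fderiv, ContinuousLinearMap.comp_apply, shapeOp_apply,
      normal_ellGrad]
    set w := fderiv ℝ (∇ h) (ellGrad (Real.cos θ) y) (ellHess y u)
    rw [ellHess_apply y v]
    simp only [inner_add_left, inner_sub_left, inner_smul_left, inner_smul_right, inner_sub_right,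
      RCLike.conj_to_real, real_inner_comm y w]
    field_simp
    ring
  rw [real_inner_comm (fderiv ℝ (capField θ h) y v) u, key, key, fderiv_gradient_symm hh,
    ellHess_symm, real_inner_comm (ellHess y v) u, real_inner_comm (ellHess y u)]

lemma apply_last (x : CapSpace n) : x (Fin.last n) = ⟪vert n, x⟫ := by
  simp [vert, EuclideanSpace.inner_single_left]

lemma ellGrad_apply_last (θ : ℝ) {y : CapSpace n} (hy : y ≠ 0) :
    (ellGrad (Real.cos θ) y) (Fin.last n) = ‖y‖⁻¹ * coneFun (Real.cos θ) y := by
  have h0 : ‖y‖ ≠ 0 := norm_ne_zero_iff.2 hy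
  rw [apply_last, ellGrad, coneFun, inner_sub_right, inner_smul_right, inner_smul_right,
    inner_vert_vert]
  field_simp

lemma ellGrad_mem_cap {y : CapSpace n} (hy : y ≠ 0) (hc : 0 ≤ coneFun (Real.cos θ) y) :
    ellGrad (Real.cos θ) y ∈ cap n θ := by
  refine ⟨?_, ?_⟩
  · rw [ellGrad_apply_last θ hy]
    positivity
  · rw [normal_ellGrad]
    exact norm_smul_inv_norm hy

lemma ellGrad_smul (c : ℝ) {r : ℝ} (hr : 0 < r) (y : CapSpace n) :
    ellGrad c (r • y) = ellGrad c y := by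
  rw [ellGrad, ellGrad, norm_smul, Real.norm_of_nonneg hr.le, smul_smul]
  congr 2
  rw [mul_inv]
  field_simp

lemma ellGrad_normal {ξ : CapSpace n} (hξ : ‖normal θ ξ‖ = 1) :
    ellGrad (Real.cos θ) (normal θ ξ) = ξ := by
  rw [ellGrad, hξ]
  simp [normal, e_eq]

lemma normal_mem_unitCap {ξ : CapSpace n} (hξ : ξ ∈ cap n θ) :
    normal θ ξ ∈ unitCap n (Real.cos θ) := by
  refine ⟨hξ.2, ?_⟩
  have h0 : normal θ ξ ≠ 0 := by
    intro h0
    simpa [h0] using hξ.2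
  have h1 := ellGrad_apply_last θ h0
  rw [ellGrad_normal hξ.2, hξ.2, inv_one, one_mul] at h1
  rw [← h1]
  exact hξ.1

/-- On the boundary the conormal is `(cos θ ν - vert) / sin θ`; inserted in the Robin condition, it
gives precisely the vanishing of the vertical component of `h ν + ∇h`. -/
lemma inner_vert_capField (hθ0 : 0 < θ) (hθπ : θ < Real.pi)
    (h_robin : ∀ ξ ∈ capBoundary n θ, fderiv ℝ h ξ (conormal θ ξ) = Real.cot θ * h ξ)
    {y : CapSpace n} (hy : y ≠ 0) (hc : coneFun (Real.cos θ) y = 0) :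
    ⟪vert n, capField θ h y⟫ = 0 := by
  have h0 : ‖y‖ ≠ 0 := norm_ne_zero_iff.2 hy
  have hs := Real.sin_pos_of_pos_of_lt_pi hθ0 hθπ
  have hb : ellGrad (Real.cos θ) y ∈ capBoundary n θ :=
    ⟨ellGrad_mem_cap hy hc.ge, by rw [ellGrad_apply_last θ hy, hc, mul_zero]⟩
  have h1 := h_robin _ hb
  set ξ := ellGrad (Real.cos θ) y with hξ
  have hν : ‖normal θ ξ‖ = 1 := hb.1.2
  have hvν : ⟪vert n, normal θ ξ⟫ = Real.cos θ := by
    rw [hξ, normal_ellGrad, inner_smul_right]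
    rw [coneFun] at hc
    field_simp
    linarith
  have hT : tangential θ ξ (e n) = Real.cos θ • normal θ ξ - vert n := by
    rw [tangential, e_eq, inner_neg_left, hvν]
    module
  have hTn : ‖tangential θ ξ (e n)‖ = Real.sin θ := by
    rw [← abs_of_nonneg (norm_nonneg (tangential θ ξ (e n))), ← abs_of_pos hs, ← sq_eq_sq_iff_abs_eq_abs, hT,
      norm_sub_sq_real, norm_smul, inner_smul_left, hν, norm_vert, real_inner_comm, hvν,
      Real.norm_eq_abs]
    have := Real.sin_sq_add_cos_sq θ
    simp only [RCLike.conj_to_real, mul_one, sq_abs]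
    linarith
  rw [conormal, hTn, hT, map_smul, ← inner_gradient, inner_sub_right, inner_smul_right,
    Real.cot_eq_cos_div_sin, smul_eq_mul] at h1
  change ⟪vert n, h ξ • normal θ ξ + (∇ h ξ - ⟪∇ h ξ, normal θ ξ⟫ • normal θ ξ)⟫ = 0
  rw [inner_add_right, inner_sub_right, inner_smul_right, inner_smul_right, hvν,
    real_inner_comm]
  field_simp at h1
  linarith

theorem isCapField_capField (hθ0 : 0 < θ) (hθπ : θ < Real.pi) {U : Set (CapSpace n)}
    (hU : IsOpen U) (hcU : cap n θ ⊆ U) (hh : ContDiffOn ℝ 2 h U)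
    (h_robin : ∀ ξ ∈ capBoundary n θ, fderiv ℝ h ξ (conormal θ ξ) = Real.cot θ * h ξ) :
    IsCapField (Real.cos θ) (capField θ h) ({0}ᶜ ∩ ellGrad (Real.cos θ) ⁻¹' U) where
  isOpen := by
    refine ContinuousOn.isOpen_inter_preimage (fun y hy => ?_) isOpen_compl_singleton hU
    exact (contDiffAt_ellGrad _ hy).continuousAt.continuousWithinAt
  zero_notMem := by simp
  smul_mem := by
    rintro y ⟨hy, hyU⟩ r hr
    exact ⟨smul_ne_zero hr.ne' hy, by rwa [mem_preimage, ellGrad_smul _ hr]⟩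
  mem := fun y hy hc => ⟨hy, hcU (ellGrad_mem_cap hy hc)⟩
  contDiffOn := by
    rintro y ⟨hy, hyU⟩
    have h1 : ContDiffAt ℝ 2 h (ellGrad (Real.cos θ) y) := hh.contDiffAt (hU.mem_nhds hyU)
    have h2 := contDiffAt_gradient h1
    have h3 : ContDiffAt ℝ 1 (normal θ) (ellGrad (Real.cos θ) y) :=
      contDiffAt_id.sub contDiffAt_const
    have h4 : ContDiffAt ℝ 1 (fun ξ => h ξ • normal θ ξ + capGradient θ h ξ)
        (ellGrad (Real.cos θ) y) :=
      ((h1.of_le (by norm_num)).smul h3).add (h2.sub ((h2.inner ℝ h3).smul h3))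
    exact (h4.comp y (contDiffAt_ellGrad _ hy)).contDiffWithinAt
  smul_eq := fun y _ r hr => by simp only [capField, ellGrad_smul _ hr]
  symm := fun y hy u v => capField_symm hy.1 (hh.contDiffAt (hU.mem_nhds hy.2)) u v
  boundary := fun y hy hc => inner_vert_capField hθ0 hθπ h_robin hy hc

end SupportFunction
end Capillary

namespace Capillary

variable {n : ℕ}

/-! ### Eigenvalues of `W` and the ambient operator `DG`. -/

section Spectrum

open Set

/-- If `r ≤ 0`, then `∏ (X + r')` has a root at `-r ≥ 0`, impossible for a polynomial with positive
coefficients. -/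
lemma pos_of_esymm_pos {s : Multiset ℝ} (hs : ∀ i ≤ s.card, 0 < s.esymm i) {r : ℝ} (hr : r ∈ s) :
    0 < r := by
  by_contra! h
  have h1 := congrArg (Polynomial.eval (-r)) (Multiset.prod_X_add_C_eq_sum_esymm s)
  rw [Polynomial.eval_multiset_prod, Polynomial.eval_finsetSum, Multiset.map_map] at h1
  have h2 : (Multiset.map (Polynomial.eval (-r) ∘ fun r => Polynomial.X + Polynomial.C r) s).prod
      = 0 := Multiset.prod_eq_zero (Multiset.mem_map.2 ⟨r, hr, by simp⟩)
  rw [h2] at h1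
  have h3 : 0 < ∑ j ∈ Finset.range (s.card + 1), Polynomial.eval (-r)
      (Polynomial.C (s.esymm j) * Polynomial.X ^ (s.card - j)) := by
    refine Finset.sum_pos' (fun j hj => ?_) ⟨s.card, by simp, by simpa using hs _ le_rfl⟩
    have := (hs j (by simpa [Nat.lt_succ_iff] using hj)).le
    simp only [Polynomial.eval_mul, Polynomial.eval_C, Polynomial.eval_pow, Polynomial.eval_X]
    exact mul_nonneg this (pow_nonneg (by linarith) _)
  exact h3.ne h1

/-- Sylvester's identity, used to pass from determinants on the ambient space to determinants on the
tangent space. -/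
lemma det_one_add_comp {V T : Type*} [AddCommGroup V] [Module ℝ V] [FiniteDimensional ℝ V]
    [AddCommGroup T] [Module ℝ T] [FiniteDimensional ℝ T] (f : T →ₗ[ℝ] V) (g : V →ₗ[ℝ] T) :
    LinearMap.det (1 + f ∘ₗ g) = LinearMap.det (1 + g ∘ₗ f) := by
  let b := Module.finBasis ℝ V
  let d := Module.finBasis ℝ T
  rw [← LinearMap.det_toMatrix b, ← LinearMap.det_toMatrix d, map_add, map_add,
    LinearMap.toMatrix_comp b d b, LinearMap.toMatrix_comp d b d, LinearMap.toMatrix_one,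
    LinearMap.toMatrix_one, Matrix.det_one_add_mul_comm]

lemma det_one_add_smul_eq_prod_roots {F : Type*} [NormedAddCommGroup F] [InnerProductSpace ℝ F]
    [FiniteDimensional ℝ F] {T : F →ₗ[ℝ] F} (hT : T.IsSymmetric) (t : ℝ) :
    LinearMap.det (1 + t • T) = (T.charpoly.roots.map fun r => 1 + r * t).prod := by
  let b := (hT.eigenvectorBasis rfl).toBasis
  have h1 : (1 + t • T).toMatrix b b
      = Matrix.diagonal fun i => 1 + hT.eigenvalues rfl i * t := by
    rw [map_add, map_smul, hT.toMatrix_eigenvectorBasis, LinearMap.toMatrix_one,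
      ← Matrix.diagonal_one, ← Matrix.diagonal_smul, Matrix.diagonal_add]
    congr 1
    ext i
    simp [mul_comm]
  rw [← LinearMap.det_toMatrix b, h1, Matrix.det_diagonal,
    hT.roots_charpoly_eq_eigenvalues rfl, Multiset.map_map]
  rfl

lemma eigenvalues_mem_roots {F : Type*} [NormedAddCommGroup F] [InnerProductSpace ℝ F]
    [FiniteDimensional ℝ F] {T : F →ₗ[ℝ] F} (hT : T.IsSymmetric)
    (i : Fin (Module.finrank ℝ F)) : hT.eigenvalues rfl i ∈ T.charpoly.roots := by
  rw [hT.roots_charpoly_eq_eigenvalues rfl]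
  exact Multiset.mem_map.2 ⟨i, Finset.mem_univ i, rfl⟩

lemma eq_id_of_roots_charpoly {F : Type*} [NormedAddCommGroup F] [InnerProductSpace ℝ F]
    [FiniteDimensional ℝ F] {T : F →ₗ[ℝ] F} (hT : T.IsSymmetric)
    (h : ∀ r ∈ T.charpoly.roots, r = 1) : T = LinearMap.id := by
  refine (hT.eigenvectorBasis rfl).toBasis.ext fun i => ?_
  simp [h _ (eigenvalues_mem_roots hT i)]

lemma inner_pos_of_roots_charpoly_pos {F : Type*} [NormedAddCommGroup F] [InnerProductSpace ℝ F]
    [FiniteDimensional ℝ F] {T : F →ₗ[ℝ] F} (hT : T.IsSymmetric)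
    (h : ∀ r ∈ T.charpoly.roots, 0 < r) {v : F} (hv : v ≠ 0) : 0 < ⟪T v, v⟫ := by
  let b := hT.eigenvectorBasis rfl
  have h1 : ⟪T v, v⟫ = ∑ i, hT.eigenvalues rfl i * ⟪b i, v⟫ ^ 2 := by
    rw [← b.sum_inner_mul_inner]
    refine Finset.sum_congr rfl fun i _ => ?_
    rw [hT v, hT.apply_eigenvectorBasis, inner_smul_right, real_inner_comm]
    simp only [RCLike.ofReal_real_eq_id, id_eq, b]
    ring
  rw [h1]
  obtain ⟨i, hi⟩ : ∃ i, ⟪b i, v⟫ ≠ 0 := by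
    by_contra! h0
    exact hv (InnerProductSpace.ext_inner_left_basis b.toBasis fun i => by simpa using h0 i)
  have hp : ∀ i, 0 < hT.eigenvalues rfl i := fun i => h _ (eigenvalues_mem_roots hT i)
  exact Finset.sum_pos' (fun i _ => mul_nonneg (hp i).le (sq_nonneg _))
    ⟨i, Finset.mem_univ i, mul_pos (hp i) (by positivity)⟩

variable {θ : ℝ} {h : CapSpace n → ℝ} {ξ : CapSpace n}

lemma coe_orthogonalProjectionOnto_tangentSpace (hξ : ‖normal θ ξ‖ = 1) (v : CapSpace n) :
    ((tangentSpace θ ξ).orthogonalProjectionOnto v : CapSpace n) = ellHess (normal θ ξ) v := by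
  rw [Submodule.coe_orthogonalProjectionOnto_apply, Submodule.starProjection_orthogonal_val,
    Submodule.starProjection_unit_singleton ℝ hξ, ellHess_apply, hξ]
  simp

lemma inner_normal_coe (u : tangentSpace θ ξ) : ⟪normal θ ξ, (u : CapSpace n)⟫ = 0 :=
  Submodule.mem_orthogonal_singleton_iff_inner_right.1 u.2

lemma coe_W (hξ : ‖normal θ ξ‖ = 1) (hh : ContDiffAt ℝ 2 h ξ) (u : tangentSpace θ ξ) :
    (W θ h ξ u : CapSpace n) = shapeOp θ h ξ u := by
  have h1 : (W θ h ξ u : CapSpace n)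
      = ((tangentSpace θ ξ).orthogonalProjectionOnto (fderiv ℝ (capGradient θ h) ξ u) : CapSpace n)
        + h ξ • (u : CapSpace n) := rfl
  rw [h1, coe_orthogonalProjectionOnto_tangentSpace hξ, ellHess_apply, hξ,
    fderiv_capGradient_apply hh, shapeOp_apply]
  simp only [inner_sub_right, inner_add_right, inner_smul_right, inner_normal_coe,
    real_inner_self_eq_norm_sq, hξ, inv_one, one_smul, real_inner_comm (normal θ ξ)]
  module

/-- `DG` at a unit normal is `W` preceded by the tangential projection, which ties the cone picture
to the Hessian equation. -/
lemma fderiv_capField (hξ : ‖normal θ ξ‖ = 1) (hh : ContDiffAt ℝ 2 h ξ) (v : CapSpace n) :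
    fderiv ℝ (capField θ h) (normal θ ξ) v
      = W θ h ξ ((tangentSpace θ ξ).orthogonalProjectionOnto v) := by
  have h0 : normal θ ξ ≠ 0 := by
    intro h0
    simp [h0] at hξ
  rw [(hasFDerivAt_capField h0 (by rwa [ellGrad_normal hξ])).fderiv, coe_W hξ hh,
    coe_orthogonalProjectionOnto_tangentSpace hξ, ellGrad_normal hξ]
  rfl

lemma orthogonalProjectionOnto_coe (u : tangentSpace θ ξ) :
    (tangentSpace θ ξ).orthogonalProjectionOnto (u : CapSpace n) = u :=
  Submodule.orthogonalProjectionOnto_mem_subspace_eq_self u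

lemma isSymmetric_W (hξ : ‖normal θ ξ‖ = 1) (hh : ContDiffAt ℝ 2 h ξ) :
    (W θ h ξ).IsSymmetric := by
  have h0 : normal θ ξ ≠ 0 := by
    intro h0
    simp [h0] at hξ
  intro u v
  have h1 := capField_symm h0 (h := h) (by rwa [ellGrad_normal hξ]) (u : CapSpace n) v
  rwa [fderiv_capField hξ hh, fderiv_capField hξ hh, orthogonalProjectionOnto_coe,
    orthogonalProjectionOnto_coe] at h1

lemma finrank_tangentSpace (hξ : ‖normal θ ξ‖ = 1) :
    Module.finrank ℝ (tangentSpace θ ξ) = n := by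
  have : Fact (Module.finrank ℝ (CapSpace n) = n + 1) := ⟨by simp⟩
  refine Submodule.finrank_orthogonal_span_singleton fun h0 => ?_
  simp [h0] at hξ

/-- The eigenvalues of `W θ h`, in terms of the unit normal. -/
noncomputable def capSpectrum (θ : ℝ) (h : CapSpace n → ℝ) (x : CapSpace n) : Multiset ℝ :=
  (W θ h (ellGrad (Real.cos θ) x)).charpoly.roots

lemma capSpectrum_normal (hξ : ‖normal θ ξ‖ = 1) :
    capSpectrum θ h (normal θ ξ) = (W θ h ξ).charpoly.roots :=
  congrArg (fun η => (W θ h η).charpoly.roots) (ellGrad_normal hξ)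

lemma sigma_eq_esymm_capSpectrum (hξ : ‖normal θ ξ‖ = 1) (k : ℕ) :
    sigma θ k h ξ = (capSpectrum θ h (normal θ ξ)).esymm k := by
  rw [capSpectrum_normal hξ, sigma]

lemma exists_cap_of_mem_unitCap {x : CapSpace n} (hx : x ∈ unitCap n (Real.cos θ)) :
    ∃ ξ ∈ cap n θ, x = normal θ ξ :=
  ⟨_, ellGrad_mem_cap (ne_zero_of_mem_unitCap hx) hx.2, by
    rw [normal_ellGrad, hx.1, inv_one, one_smul]⟩

lemma isSpectrum_capSpectrum (hh : ∀ ξ ∈ cap n θ, ContDiffAt ℝ 2 h ξ) :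
    IsSpectrum (Real.cos θ) (fderiv ℝ (capField θ h)) (capSpectrum θ h) := by
  intro x hx
  obtain ⟨ξ, hξ, rfl⟩ := exists_cap_of_mem_unitCap hx
  have hW := isSymmetric_W hξ.2 (hh ξ hξ)
  rw [capSpectrum_normal hξ.2]
  refine ⟨?_, fun t => ?_⟩
  · rw [hW.roots_charpoly_eq_eigenvalues (finrank_tangentSpace hξ.2)]
    simp
  · rw [← det_one_add_smul_eq_prod_roots hW]
    set π : CapSpace n →ₗ[ℝ] tangentSpace θ ξ :=
      (tangentSpace θ ξ).orthogonalProjectionOnto.toLinearMap with hπ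
    set ι : tangentSpace θ ξ →ₗ[ℝ] CapSpace n := (tangentSpace θ ξ).subtype with hι
    have h1 : ((1 + t • fderiv ℝ (capField θ h) (normal θ ξ) : CapSpace n →L[ℝ] CapSpace n)
        : CapSpace n →ₗ[ℝ] CapSpace n) = 1 + ι ∘ₗ ((t • W θ h ξ) ∘ₗ π) := by
      refine LinearMap.ext fun v => ?_
      change v + t • fderiv ℝ (capField θ h) (normal θ ξ) v = _
      rw [fderiv_capField hξ.2 (hh ξ hξ)]
      rfl
    have h2 : ((t • W θ h ξ) ∘ₗ π) ∘ₗ ι = t • W θ h ξ := by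
      refine LinearMap.ext fun u => ?_
      change (t • W θ h ξ) ((tangentSpace θ ξ).orthogonalProjectionOnto (u : CapSpace n)) = _
      rw [orthogonalProjectionOnto_coe]
    change LinearMap.det ((1 + t • fderiv ℝ (capField θ h) (normal θ ξ) :
      CapSpace n →L[ℝ] CapSpace n) : CapSpace n →ₗ[ℝ] CapSpace n) = _
    rw [h1, det_one_add_comp, h2]

lemma fderiv_capField_eq_ellHess (hξ : ξ ∈ cap n θ) (hh : ContDiffAt ℝ 2 h ξ)
    (hs : capSpectrum θ h (normal θ ξ) = Multiset.replicate n 1) :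
    fderiv ℝ (capField θ h) (normal θ ξ) = ellHess (normal θ ξ) := by
  rw [capSpectrum_normal hξ.2] at hs
  have h1 : W θ h ξ = LinearMap.id := eq_id_of_roots_charpoly (isSymmetric_W hξ.2 hh) fun r hr =>
    Multiset.eq_of_mem_replicate (hs ▸ hr)
  ext1 v
  rw [fderiv_capField hξ.2 hh, h1, ← coe_orthogonalProjectionOnto_tangentSpace hξ.2]
  rfl

lemma isPosDef_capField (hh : ∀ ξ ∈ cap n θ, ContDiffAt ℝ 2 h ξ)
    (hpos : ∀ x ∈ unitCap n (Real.cos θ), ∀ i ≤ n, 0 < (capSpectrum θ h x).esymm i) :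
    IsCapField.IsPosDef (Real.cos θ) (capField θ h) := by
  intro x hx v hv0 hxv
  have h1 := hpos x hx
  have hcard := (isSpectrum_capSpectrum hh x hx).1
  obtain ⟨ξ, hξ, rfl⟩ := exists_cap_of_mem_unitCap hx
  rw [capSpectrum_normal hξ.2] at h1 hcard
  lift v to tangentSpace θ ξ using Submodule.mem_orthogonal_singleton_iff_inner_right.2 hxv
  rw [fderiv_capField hξ.2 (hh ξ hξ), orthogonalProjectionOnto_coe]
  exact inner_pos_of_roots_charpoly_pos (isSymmetric_W hξ.2 (hh ξ hξ))
    (fun r hr => pos_of_esymm_pos (fun i hi => h1 i (hcard ▸ hi)) hr) (by simpa using hv0)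

lemma inner_horizontal (a x : CapSpace n) (ha : ⟪vert n, a⟫ = 0) :
    ⟪a, x⟫ = ∑ α : Fin n, a α.castSucc * ⟪x, E α⟫ := by
  have h1 : a (Fin.last n) = 0 := by rw [apply_last, ha]
  rw [PiLp.inner_apply, Fin.sum_univ_castSucc]
  simp [h1, E, EuclideanSpace.inner_single_right, mul_comm]

lemma inner_normal_horizontal (a : CapSpace n) (ha : ⟪vert n, a⟫ = 0) :
    ⟪a, normal θ ξ⟫ = ⟪a, ξ⟫ := by
  simp [normal, e_eq, inner_add_right, inner_smul_right, real_inner_comm (vert n), ha]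

lemma inner_capField_normal (hξ : ‖normal θ ξ‖ = 1) :
    ⟪capField θ h (normal θ ξ), normal θ ξ⟫ = h ξ := by
  rw [capField, ellGrad_normal hξ, capGradient, tangential]
  simp [inner_add_left, inner_sub_left, inner_smul_left, hξ]

end Spectrum
end Capillary

/-! ### Assembly of the theorem. -/

theorem mainTheorem9 (n k l : ℕ) (hn : 2 ≤ n) (hlk : l < k) (hkn : k ≤ n)
    (θ : ℝ) (hθ0 : 0 < θ) (hθπ : θ < Real.pi)
    (h : CapSpace n → ℝ)
    (h_adm : Capillary.IsKConvex θ k h)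
    (h_eq : ∀ ξ ∈ Capillary.cap n θ,
      Capillary.sigma θ k h ξ / Capillary.sigma θ l h ξ = (n.choose k : ℝ) / (n.choose l : ℝ))
    (h_robin : ∀ ξ ∈ Capillary.capBoundary n θ,
      fderiv ℝ h ξ (Capillary.conormal θ ξ) = Real.cot θ * h ξ) :
    ∃ a : Fin n → ℝ, ∀ ξ ∈ Capillary.cap n θ,
      h ξ = Capillary.ell θ ξ + ∑ α : Fin n, a α * ⟪ξ, Capillary.E α⟫ := by
  open Capillary in
  obtain ⟨⟨U, hU, hcU, hhU⟩, hσ⟩ := h_adm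
  have hh : ∀ ξ ∈ cap n θ, ContDiffAt ℝ 2 h ξ := fun ξ hξ =>
    hhU.contDiffAt (hU.mem_nhds (hcU hξ))
  have hG := isCapField_capField hθ0 hθπ hU hcU hhU h_robin
  have hs := isSpectrum_capSpectrum hh
  have hc : |Real.cos θ| < 1 := by
    rw [← sq_lt_one_iff_abs_lt_one]
    nlinarith [Real.sin_sq_add_cos_sq θ, Real.sin_pos_of_pos_of_lt_pi hθ0 hθπ]
  have hchoose : ∀ i ≤ n, (0 : ℝ) < n.choose i := fun i hi => by exact_mod_cast Nat.choose_pos hi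
  have hesymm : ∀ x ∈ unitCap n (Real.cos θ), ∀ i ≤ k, 0 < (capSpectrum θ h x).esymm i := by
    intro x hx i hi
    obtain ⟨ξ, hξ, rfl⟩ := exists_cap_of_mem_unitCap hx
    rcases Nat.eq_zero_or_pos i with rfl | hi0
    · rw [esymm_zero_eq_one]
      exact one_pos
    · rw [← sigma_eq_esymm_capSpectrum hξ.2]
      exact hσ ξ hξ i hi0 hi
  have hpos : ∀ x ∈ unitCap n (Real.cos θ), ∀ i ≤ k, 0 < symMean (capSpectrum θ h x) i := by
    intro x hx i hi
    rw [symMean, (hs x hx).1]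
    exact div_pos (hesymm x hx i hi) (hchoose i (hi.trans hkn))
  have heq : ∀ x ∈ unitCap n (Real.cos θ),
      symMean (capSpectrum θ h x) k = symMean (capSpectrum θ h x) l := by
    intro x hx
    have h1 := hesymm x hx l hlk.le
    rw [symMean, symMean, (hs x hx).1]
    obtain ⟨ξ, hξ, rfl⟩ := exists_cap_of_mem_unitCap hx
    have h2 := h_eq ξ hξ
    rw [sigma_eq_esymm_capSpectrum hξ.2, sigma_eq_esymm_capSpectrum hξ.2,
      div_eq_div_iff h1.ne' (hchoose l (hlk.le.trans hkn)).ne'] at h2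
    rw [div_eq_div_iff (hchoose k hkn).ne' (hchoose l (hlk.le.trans hkn)).ne', h2, mul_comm]
  have hrep : ∀ x ∈ unitCap n (Real.cos θ), capSpectrum θ h x = Multiset.replicate n 1 := by
    intro x hx
    rcases hkn.lt_or_eq with hk | rfl
    · exact hG.spectrum_eq_replicate_of_lt hc hs hlk hk hpos heq hx
    -- For `k = n` admissibility makes `W` positive definite, so the support function can be made
    -- positive. The translation leaves `DG`, hence the spectrum, unchanged.
    · obtain ⟨a, ha, hpa⟩ := hG.exists_translation_pos hn hθ0 hθπ (isPosDef_capField hh hesymm)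
      refine (hG.sub_const ha).spectrum_eq_replicate_of_eq hn hc ?_ hlk hpos heq hpa hx
      intro y hy
      rw [IsCapField.fderiv_sub_const]
      exact hs y hy
  obtain ⟨a, ha, hGa⟩ := hG.eq_ellGrad_add_of_fderiv_eq hn hθ0 hθπ fun x hx => by
    have h1 := hrep x hx
    obtain ⟨ξ, hξ, rfl⟩ := exists_cap_of_mem_unitCap hx
    exact fderiv_capField_eq_ellHess hξ (hh ξ hξ) h1
  refine ⟨fun α => a α.castSucc, fun ξ hξ => ?_⟩
  -- `h ξ = ⟪G ν, ν⟫ = ⟪ξ, ν⟫ + ⟪a, ν⟫`, and `⟪a, ν⟫ = ⟪a, ξ⟫` as `a` is horizontal.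
  rw [← inner_capField_normal (h := h) hξ.2, hGa _ (normal_mem_unitCap hξ), inner_add_left,
    inner_normal_horizontal a ha, inner_horizontal a ξ ha, ellGrad_normal hξ.2, ell]
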